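/- Let $\mathcal{R}$ be the $\mathbb{F}_2$-linear category whose objects are the integers and in which $\mathcal{R}(a,b)$ has as basis the sequences $a=c_1<c_2<\dots<c_m=b$, composition being concatenation; write $\mathrm{Sq}^i:n\to n+i$ for the one-step sequence if $i>0$, and $\mathrm{Sq}^0=\mathrm{id}$. Let $\mathcal{Q}$ be the quotient of $\mathcal{R}$ by the ideal generated by the Adem relations $$\mathrm{Sq}^i\mathrm{Sq}^j=\sum_{t=0}^{\lfloor i/2\rfloor}\binom{j-t-1}{i-2t}\mathrm{Sq}^{i+j-t}\mathrm{Sq}^t\in\mathcal{R}(n,n+i+j)\qquad(0<i<2j,\ n\in\mathbb{Z},\ \text{the right-hand factor acting first})$$ and by the squares $\mathrm{Sq}^i:n\to n+i$ with $i\ge 0$, $i>n$. For $k\ge 0$ let $\mathcal{Q}_k\subseteq\mathcal{Q}$ be the wide additive subcategory generated by the squares $\mathrm{Sq}^i:n\to n+i$ with $i\ge0$, $n-i<k$, and let $\mathcal{U}_k$ be the abelian category of additive functors $M:\mathcal{Q}_k\to\mathbf{Ab}$, $n\mapsto M^n$ (unstable modules over the Steenrod algebra with only the top $k$ squares). Write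 $\mathrm{Ext}_k^s$ for $\mathrm{Ext}^s$ in $\mathcal{U}_k$ (zero for $s<0$); it is an $\mathbb{F}_2$-vector space. Let $k\ge 1$. The suspension $\Sigma:\mathcal{U}_{k-1}\to\mathcal{U}_k$ is $(\Sigma N)^{n+1}=N^n$ with $\mathrm{Sq}^i(\Sigma x)=\Sigma(\mathrm{Sq}^ix)$. For $M\in\mathcal{U}_k$ let $\Phi M$ be the module with $(\Phi M)^{2n}=M^n$, $(\Phi M)^{\mathrm{odd}}=0$, $\mathrm{Sq}^{2i}(\Phi x)=\Phi(\mathrm{Sq}^ix)$, $\mathrm{Sq}^{\mathrm{odd}}(\Phi x)=0$; a priori it is an object of $\mathcal{U}_{2k}$, and it is regarded here as an object of $\mathcal{U}_k$. Let $\lambda_M:\Phi M\to M$ be the map $\Phi x\mapsto \mathrm{Sq}_0x:=\mathrm{Sq}^{|x|}x$. Then there are modules $\Omega M,\Omega_1M\in\mathcal{U}_{k-1}$, namely the desuspensions of the cokernel and of the kernel of $\lambda_M$, with $\Sigma\Omega M\cong\operatorname{coker}\lambda_M$ and $\Sigma\Omega_1M\cong\ker\lambda_M$; here the desuspension of a module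 $C\in\mathcal{U}_k$ is the value at $C$ of the right adjoint of $\Sigma$. For every $M\in\mathcal{U}_k$ and $N\in\mathcal{U}_{k-1}$ there is a long exact sequence of $\mathbb{F}_2$-vector spaces, for $s\in\mathbb{Z}$, $$\cdots\to\mathrm{Ext}^{s}_{k-1}(\Omega M,N)\to\mathrm{Ext}^{s}_{k}(M,\Sigma N)\to\mathrm{Ext}^{s-1}_{k-1}(\Omega_1M,N)\to\mathrm{Ext}^{s+1}_{k-1}(\Omega M,N)\to\mathrm{Ext}^{s+1}_{k}(M,\Sigma N)\to\cdots.$$ -/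

import Mathlib

open CategoryTheory CategoryTheory.Limits

universe u v

namespace TopSquares

/-! ### Ringoids: ideals, quotients, subringoids -/

section Ringoids

variable {C : Type*} [Category* C] [Preadditive C]

/-- An ideal of a ringoid (small preadditive category). -/
@[ext]
structure RIdeal (C : Type*) [Category* C] [Preadditive C] where
  hom : ∀ a b : C, AddSubgroup (a ⟶ b)
  comp_left : ∀ {a b c : C} (f : a ⟶ b) {g : b ⟶ c}, g ∈ hom b c → f ≫ g ∈ hom a c
  comp_right : ∀ {a b c : C} {f : a ⟶ b} (g : b ⟶ c), f ∈ hom a b → f ≫ g ∈ hom a c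

namespace RIdeal

/-- The smallest ideal containing a class of morphisms. -/
def generated (P : MorphismProperty C) : RIdeal C where
  hom a b := ⨅ I : {I : RIdeal C // ∀ ⦃x y : C⦄ (f : x ⟶ y), P f → f ∈ I.hom x y}, I.1.hom a b
  comp_left f g hg := by
    simp only [AddSubgroup.mem_iInf] at hg ⊢
    exact fun I => I.1.comp_left f (hg I)
  comp_right g hf := by
    simp only [AddSubgroup.mem_iInf] at hf ⊢
    exact fun I => I.1.comp_right g (hf I)

theorem mem_generated (P : MorphismProperty C) {a b : C} {f : a ⟶ b} (hf : P f) :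
    f ∈ (generated P).hom a b := by
  simp only [generated, AddSubgroup.mem_iInf]
  exact fun I => I.2 f hf

theorem generated_le (P : MorphismProperty C) (I : RIdeal C)
    (h : ∀ ⦃x y : C⦄ (f : x ⟶ y), P f → f ∈ I.hom x y) {a b : C} {f : a ⟶ b}
    (hf : f ∈ (generated P).hom a b) : f ∈ I.hom a b := by
  simp only [generated, AddSubgroup.mem_iInf] at hf
  exact hf ⟨I, h⟩

/-- The ideal of morphisms killed by an additive functor. -/
def ker {D : Type*} [Category* D] [Preadditive D] (F : C ⥤ D) [F.Additive] : RIdeal C where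
  hom _ _ := (F.mapAddHom).ker
  comp_left f g hg := by
    simp only [AddMonoidHom.mem_ker, Functor.coe_mapAddHom] at hg ⊢
    simp [hg]
  comp_right g hf := by
    simp only [AddMonoidHom.mem_ker, Functor.coe_mapAddHom] at hf ⊢
    simp [hf]

/-- Two parallel morphisms are congruent modulo `I` when their difference lies in `I`. -/
def rel (I : RIdeal C) : HomRel C := fun a b f g => f - g ∈ I.hom a b

instance (I : RIdeal C) : Congruence I.rel where
  comp_left f g g' h := by
    have := I.comp_left f h
    rwa [Preadditive.comp_sub] at this
  comp_right g h := by
    have := I.comp_right g h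
    rwa [Preadditive.sub_comp] at this
  equivalence :=
    { refl f := by simp [rel, zero_mem]
      symm {f g} h := by
        have := neg_mem (show f - g ∈ I.hom _ _ from h)
        rwa [neg_sub] at this
      trans {f g h} h₁ h₂ := by
        have := add_mem (show f - g ∈ I.hom _ _ from h₁) (show g - h ∈ I.hom _ _ from h₂)
        rwa [sub_add_sub_cancel] at this }

theorem rel_add (I : RIdeal C) ⦃X Y : C⦄ (f₁ f₂ g₁ g₂ : X ⟶ Y) (h : I.rel f₁ f₂)
    (h' : I.rel g₁ g₂) : I.rel (f₁ + g₁) (f₂ + g₂) := by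
  have := add_mem (show f₁ - f₂ ∈ I.hom _ _ from h) (show g₁ - g₂ ∈ I.hom _ _ from h')
  rwa [← add_sub_add_comm] at this

/-- The quotient ringoid. -/
abbrev Quo (I : RIdeal C) := Quotient I.rel

instance (I : RIdeal C) : Preadditive I.Quo := Quotient.preadditive I.rel I.rel_add

instance (I : RIdeal C) : (Quotient.functor I.rel).Additive :=
  Quotient.functor_additive I.rel I.rel_add

/-- Descend an additive functor killing `I` to the quotient ringoid. -/
def descend (I : RIdeal C) {D : Type*} [Category* D] [Preadditive D] (F : C ⥤ D) [F.Additive]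
    (h : ∀ ⦃a b : C⦄ (f : a ⟶ b), f ∈ I.hom a b → F.map f = 0) : I.Quo ⥤ D :=
  CategoryTheory.Quotient.lift I.rel F fun _ _ f g hfg => by
    have := h _ hfg
    rwa [Functor.map_sub, sub_eq_zero] at this

instance (I : RIdeal C) {D : Type*} [Category* D] [Preadditive D] (F : C ⥤ D) [F.Additive]
    (h : ∀ ⦃a b : C⦄ (f : a ⟶ b), f ∈ I.hom a b → F.map f = 0) : (I.descend F h).Additive where
  map_add := by
    rintro _ _ ⟨f⟩ ⟨g⟩
    exact F.map_add

end RIdeal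

/-- A subringoid: a wide subcategory whose morphism sets are additive subgroups. -/
@[ext]
structure Subringoid (C : Type*) [Category* C] [Preadditive C] where
  hom : ∀ a b : C, AddSubgroup (a ⟶ b)
  id_mem : ∀ a : C, 𝟙 a ∈ hom a a
  comp_mem : ∀ {a b c : C} {f : a ⟶ b} {g : b ⟶ c}, f ∈ hom a b → g ∈ hom b c → f ≫ g ∈ hom a c

namespace Subringoid

/-- The smallest subringoid containing a class of morphisms. -/
def generated (P : MorphismProperty C) : Subringoid C where
  hom a b := ⨅ S : {S : Subringoid C // ∀ ⦃x y : C⦄ (f : x ⟶ y), P f → f ∈ S.hom x y}, S.1.hom a b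
  id_mem a := by
    simp only [AddSubgroup.mem_iInf]
    exact fun S => S.1.id_mem a
  comp_mem hf hg := by
    simp only [AddSubgroup.mem_iInf] at hf hg ⊢
    exact fun S => S.1.comp_mem (hf S) (hg S)

theorem mem_generated (P : MorphismProperty C) {a b : C} {f : a ⟶ b} (hf : P f) :
    f ∈ (generated P).hom a b := by
  simp only [generated, AddSubgroup.mem_iInf]
  exact fun I => I.2 f hf

theorem generated_le (P : MorphismProperty C) (S : Subringoid C)
    (h : ∀ ⦃x y : C⦄ (f : x ⟶ y), P f → f ∈ S.hom x y) {a b : C} {f : a ⟶ b}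
    (hf : f ∈ (generated P).hom a b) : f ∈ S.hom a b := by
  simp only [generated, AddSubgroup.mem_iInf] at hf
  exact hf ⟨S, h⟩

/-- The preimage of a subringoid under an additive functor. -/
def comap {D : Type*} [Category* D] [Preadditive D] (F : C ⥤ D) [F.Additive] (S : Subringoid D) :
    Subringoid C where
  hom a b := (S.hom (F.obj a) (F.obj b)).comap F.mapAddHom
  id_mem a := by simpa using S.id_mem _
  comp_mem hf hg := by
    simp only [AddSubgroup.mem_comap, Functor.coe_mapAddHom, Functor.map_comp] at hf hg ⊢
    exact S.comp_mem hf hg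

/-- A subringoid regarded as a ringoid: its objects are those of the ambient ringoid. -/
@[ext]
structure Obj (S : Subringoid C) where
  as : C

instance (S : Subringoid C) : Category S.Obj where
  Hom X Y := S.hom X.as Y.as
  id X := ⟨𝟙 X.as, S.id_mem _⟩
  comp f g := ⟨f.1 ≫ g.1, S.comp_mem f.2 g.2⟩
  id_comp f := Subtype.ext (Category.id_comp f.1)
  comp_id f := Subtype.ext (Category.comp_id f.1)
  assoc f g h := Subtype.ext (Category.assoc f.1 g.1 h.1)

instance (S : Subringoid C) : Preadditive S.Obj where
  homGroup X Y := inferInstanceAs (AddCommGroup (S.hom X.as Y.as))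
  add_comp _ _ _ f f' g := Subtype.ext (Preadditive.add_comp _ _ _ f.1 f'.1 g.1)
  comp_add _ _ _ f g g' := Subtype.ext (Preadditive.comp_add _ _ _ f.1 g.1 g'.1)

/-- An additive functor carrying the subringoid `S` into the subringoid `T` restricts to them. -/
def restrict {D : Type*} [Category* D] [Preadditive D] (F : C ⥤ D) [F.Additive]
    (S : Subringoid C) (T : Subringoid D)
    (h : ∀ ⦃a b : C⦄ (f : a ⟶ b), f ∈ S.hom a b → F.map f ∈ T.hom (F.obj a) (F.obj b)) :
    S.Obj ⥤ T.Obj where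
  obj X := ⟨F.obj X.as⟩
  map f := ⟨F.map f.1, h f.1 f.2⟩
  map_id X := Subtype.ext (F.map_id X.as)
  map_comp f g := Subtype.ext (F.map_comp f.1 g.1)

instance {D : Type*} [Category* D] [Preadditive D] (F : C ⥤ D) [F.Additive]
    (S : Subringoid C) (T : Subringoid D)
    (h : ∀ ⦃a b : C⦄ (f : a ⟶ b), f ∈ S.hom a b → F.map f ∈ T.hom (F.obj a) (F.obj b)) :
    (restrict F S T h).Additive where
  map_add {_ _ f g} := Subtype.ext (F.map_add (f := f.1) (g := g.1))

end Subringoid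

/-! ### Adjoining a zero object to a ringoid -/

/-- The ringoid `C⁺`: the objects of `C` together with one more object `+` (here `none`), all
morphism groups from and to `+` being zero. -/
structure Plus (C : Type*) where
  as : Option C

namespace Plus

/-- The object of `C⁺` given by an object of `C`. -/
abbrev of (X : C) : Plus C := ⟨some X⟩

/-- The extra object `+`. -/
abbrev pt : Plus C := ⟨none⟩

/-- Morphisms of `C⁺`. -/
def Hom {C : Type*} [Category.{v} C] : Plus C → Plus C → Type v
  | ⟨some X⟩, ⟨some Y⟩ => X ⟶ Y
  | ⟨none⟩, _ => PUnit
  | ⟨some _⟩, ⟨none⟩ => PUnit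

/-- The identity morphisms of `C⁺`. -/
def id {C : Type*} [Category.{v} C] : ∀ X : Plus C, Hom X X
  | ⟨some X⟩ => 𝟙 X
  | ⟨none⟩ => PUnit.unit

instance homGroup {C : Type*} [Category.{v} C] [Preadditive C] :
    ∀ X Y : Plus C, AddCommGroup (Hom X Y)
  | ⟨some X⟩, ⟨some Y⟩ => inferInstanceAs (AddCommGroup (X ⟶ Y))
  | ⟨none⟩, _ => inferInstanceAs (AddCommGroup PUnit)
  | ⟨some _⟩, ⟨none⟩ => inferInstanceAs (AddCommGroup PUnit)

/-- Composition in `C⁺`: as in `C`, and zero when one of the objects is `+`. -/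
def comp {C : Type*} [Category.{v} C] [Preadditive C] :
    ∀ {X Y Z : Plus C}, Hom X Y → Hom Y Z → Hom X Z
  | ⟨some _⟩, ⟨some _⟩, ⟨some _⟩ => fun f g => CategoryStruct.comp (obj := C) f g
  | ⟨some _⟩, ⟨none⟩, _ => fun _ _ => 0
  | ⟨some _⟩, ⟨some _⟩, ⟨none⟩ => fun _ _ => 0
  | ⟨none⟩, _, _ => fun _ _ => 0

instance : Category (Plus C) where
  Hom := Hom
  id := id
  comp f g := comp f g
  id_comp := by
    rintro ⟨_ | X⟩ ⟨_ | Y⟩ f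
    · rfl
    · rfl
    · rfl
    · exact Category.id_comp (obj := C) f
  comp_id := by
    rintro ⟨_ | X⟩ ⟨_ | Y⟩ f
    · rfl
    · rfl
    · rfl
    · exact Category.comp_id (obj := C) f
  assoc := by
    rintro ⟨_ | W⟩ ⟨_ | X⟩ ⟨_ | Y⟩ ⟨_ | Z⟩ f g h
    all_goals first
      | rfl
      | exact Category.assoc (obj := C) f g h
      | exact Limits.zero_comp (C := C)
      | exact Limits.comp_zero (C := C)
      | exact (Limits.zero_comp (C := C)).symm
      | exact (Limits.comp_zero (C := C)).symm

instance : Preadditive (Plus C) where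
  homGroup := homGroup
  add_comp := by
    rintro ⟨_ | X⟩ ⟨_ | Y⟩ ⟨_ | Z⟩ f f' g
    all_goals first
      | rfl
      | exact (add_zero (0 : X ⟶ Z)).symm
      | exact Preadditive.add_comp (C := C) _ _ _ f f' g
  comp_add := by
    rintro ⟨_ | X⟩ ⟨_ | Y⟩ ⟨_ | Z⟩ f g g'
    all_goals first
      | rfl
      | exact (add_zero (0 : X ⟶ Z)).symm
      | exact Preadditive.comp_add (C := C) _ _ _ f g g'

/-- The inclusion of `C` in `C⁺`. -/
def incl (C : Type*) [Category* C] [Preadditive C] : C ⥤ Plus C where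
  obj X := of X
  map f := f
  map_id _ := rfl
  map_comp _ _ := rfl

instance : (incl C).Additive where
  map_add := rfl

/-- The subringoid `S⁺` of `C⁺` for a subringoid `S` of `C`: it has the same morphisms as `S` between
objects of `C`. -/
def sub (S : Subringoid C) : Subringoid (Plus C) where
  hom
    | ⟨some X⟩, ⟨some Y⟩ => S.hom X Y
    | ⟨none⟩, _ => ⊤
    | ⟨some _⟩, ⟨none⟩ => ⊤
  id_mem := by
    rintro ⟨_ | X⟩
    · trivial
    · exact S.id_mem X
  comp_mem := by
    rintro ⟨_ | X⟩ ⟨_ | Y⟩ ⟨_ | Z⟩ f g hf hg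
    all_goals first
      | trivial
      | exact S.comp_mem hf hg
      | exact zero_mem (S.hom _ _)

/-- The value at an object of `C⁺` of the extension of an `S`-module: zero at `+`. -/
def extendObj {S : Subringoid C} (M : S.Obj ⥤ AddCommGrpCat.{u}) :
    Plus C → AddCommGrpCat.{u}
  | ⟨some X⟩ => M.obj ⟨X⟩
  | ⟨none⟩ => AddCommGrpCat.of PUnit

/-- The action of morphisms on the extension of an `S`-module. -/
def extendMap {S : Subringoid C} (M : S.Obj ⥤ AddCommGrpCat.{u}) :
    ∀ (X Y : Plus C), (sub S).hom X Y → (extendObj M X ⟶ extendObj M Y)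
  | ⟨some X⟩, ⟨some Y⟩ => fun f => M.map (X := ⟨X⟩) (Y := ⟨Y⟩) f
  | ⟨none⟩, _ => fun _ => 0
  | ⟨some _⟩, ⟨none⟩ => fun _ => 0

/-- An additive functor on `S` regarded as an additive functor on `S⁺` vanishing at `+`. -/
def extend {S : Subringoid C} (M : S.Obj ⥤ AddCommGrpCat.{u}) [M.Additive] :
    (sub S).Obj ⥤ AddCommGrpCat.{u} where
  obj X := extendObj M X.as
  map {X Y} f := extendMap M X.as Y.as f
  map_id := by
    rintro ⟨⟨_ | X⟩⟩
    · ext x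
      rfl
    · exact M.map_id ⟨X⟩
  map_comp := by
    rintro ⟨⟨_ | X⟩⟩ ⟨⟨_ | Y⟩⟩ ⟨⟨_ | Z⟩⟩ f g
    all_goals first
      | exact Limits.zero_comp.symm
      | exact M.map_comp (X := ⟨X⟩) (Y := ⟨Y⟩) (Z := ⟨Z⟩) f g
      | exact Limits.comp_zero.symm
      | exact (M.map_zero ⟨X⟩ ⟨Z⟩).trans Limits.zero_comp.symm

instance {S : Subringoid C} (M : S.Obj ⥤ AddCommGrpCat.{u}) [M.Additive] :
    (extend M).Additive where
  map_add := by
    rintro ⟨⟨_ | X⟩⟩ ⟨⟨_ | Y⟩⟩ f g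
    all_goals first
      | exact (add_zero _).symm
      | exact M.map_add (X := ⟨X⟩) (Y := ⟨Y⟩) (f := f) (g := g)

end Plus

/-- In a preadditive category whose morphisms are killed by `2`, the morphism groups are
`𝔽₂`-vector spaces and the composition is bilinear over `𝔽₂`. -/
@[reducible]
def linearOfTwo (C : Type*) [Category* C] [Preadditive C]
    (h : ∀ (X Y : C) (f : X ⟶ Y), f + f = 0) : Linear (ZMod 2) C where
  homModule X Y := AddCommGroup.zmodModule (n := 2) fun f => by rw [two_nsmul, h]
  smul_comp X Y Z r f g := by
    let : Module (ZMod 2) (X ⟶ Y) :=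
      AddCommGroup.zmodModule (n := 2) fun f => by rw [two_nsmul, h]
    let : Module (ZMod 2) (X ⟶ Z) :=
      AddCommGroup.zmodModule (n := 2) fun f => by rw [two_nsmul, h]
    exact ZMod.map_smul (Preadditive.rightComp X g) r f
  comp_smul X Y Z f r g := by
    let : Module (ZMod 2) (Y ⟶ Z) :=
      AddCommGroup.zmodModule (n := 2) fun f => by rw [two_nsmul, h]
    let : Module (ZMod 2) (X ⟶ Z) :=
      AddCommGroup.zmodModule (n := 2) fun f => by rw [two_nsmul, h]
    exact ZMod.map_smul (Preadditive.leftComp Z f) r g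

end Ringoids

/-! ### The ringoids `R`, `Q` and `Q_k` -/

/-- The vertices of the quiver of Steenrod squares: the integers. -/
@[ext]
structure Deg where
  n : ℤ

/-- One arrow `a ⟶ b` whenever `a < b`. -/
instance : Quiver Deg where
  Hom a b := PLift (a.n < b.n)

/-- The ringoid `R`: the objects are the integers, and the morphisms `a ⟶ b` are the
`𝔽₂`-linear combinations of sequences `a = c₁ < c₂ < ⋯ < c_m = b`. -/
abbrev R := Free (ZMod 2) (Paths Deg)

/-- The object `n` of `R`. -/
def R.deg (n : ℤ) : R := (⟨n⟩ : Deg)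

/-- The morphism of `R` given by the one-step sequence `a < b`. -/
noncomputable def R.step {a b : ℤ} (h : a < b) : R.deg a ⟶ R.deg b :=
  (Free.embedding (ZMod 2) (Paths Deg)).map
    ((Paths.of Deg).map (X := ⟨a⟩) (Y := ⟨b⟩) ⟨h⟩)

open Classical in
/-- The square `Sq^{b-a} : a ⟶ b` in `R`, with the conventions `Sq^0 = 1` and `Sq^i = 0` for
`i < 0`. -/
noncomputable def R.sq (a b : ℤ) : R.deg a ⟶ R.deg b :=
  if h : a < b then R.step h else if h : a = b then eqToHom (congrArg R.deg h) else 0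

theorem R.sq_of_lt {a b : ℤ} (h : a < b) : R.sq a b = R.step h := dif_pos h

@[simp]
theorem R.sq_self (a : ℤ) : R.sq a a = 𝟙 _ := by simp [R.sq]

theorem R.sq_of_gt {a b : ℤ} (h : b < a) : R.sq a b = 0 := by
  rw [R.sq, dif_neg (by omega), dif_neg (by omega)]

/-- The Adem relator `Sq^i Sq^j - ∑_{t ≤ i/2} (j - t - 1 choose i - 2 t) Sq^{i+j-t} Sq^t` as a
morphism `a ⟶ c`, where `Sq^j` is `a ⟶ b` and `Sq^i` is `b ⟶ c`. In a product of squares the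
right hand factor acts first, that is, `Sq^i Sq^j` is the composite `a ⟶ b ⟶ c`. -/
noncomputable def R.adem (a b c : ℤ) (i j : ℕ) : R.deg a ⟶ R.deg c :=
  R.sq a b ≫ R.sq b c -
    ∑ t ∈ Finset.range (i / 2 + 1),
      (j - t - 1).choose (i - 2 * t) • (R.sq a (a + t) ≫ R.sq (a + t) c)

/-- The generators of the ideal `J` of `R`: the Adem relators for `0 < i < 2 j`, and the
squares `Sq^i : n ⟶ n + i` with `i > n`. -/
inductive JGen : MorphismProperty R
  | adem (a b c : ℤ) (i j : ℕ) (hb : b = a + j) (hc : c = b + i) (hi : 0 < i) (hij : i < 2 * j) :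
      JGen (R.adem a b c i j)
  | unstable (a b : ℤ) (hab : a ≤ b) (h : a < b - a) : JGen (R.sq a b)

/-- The ideal `J` generated by the Adem relations and the unstability conditions. -/
noncomputable def J : RIdeal R := RIdeal.generated JGen

/-- The ringoid `Q = R / J`, whose modules are the unstable modules over the Steenrod algebra. -/
abbrev Q := J.Quo

/-- The object `n` of `Q`. -/
noncomputable def Q.deg (n : ℤ) : Q := ⟨R.deg n⟩

/-- The integer underlying an object of `Q`. -/
noncomputable def Q.val (X : Q) : ℤ := Deg.n X.as

/-- The square `Sq^{b-a} : a ⟶ b` in `Q` (zero for `b < a`). -/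
noncomputable def Q.sq (a b : ℤ) : Q.deg a ⟶ Q.deg b := (Quotient.functor J.rel).map (R.sq a b)

/-- The top `k` squares: `Sq^i : n ⟶ n + i` with `i ≥ 0` and `n - i < k`. -/
inductive TopSq (k : ℕ) : MorphismProperty Q
  | mk (a b : ℤ) (hab : a ≤ b) (h : a - (b - a) < k) : TopSq k (Q.sq a b)

/-- The subringoid of `Q` generated by the top `k` squares. -/
noncomputable def topSub (k : ℕ) : Subringoid Q := Subringoid.generated (TopSq k)

/-- The ringoid `Q_k`. -/
abbrev Qk (k : ℕ) := (topSub k).Obj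

/-- The object `n` of `Q_k`. -/
noncomputable def Qk.deg (k : ℕ) (n : ℤ) : Qk k := ⟨Q.deg n⟩

/-! #### Functors out of `R` and `Q` -/

section Lift

theorem R.two (X Y : R) (f : X ⟶ Y) : f + f = 0 := by
  rw [← two_nsmul, ← Nat.cast_smul_eq_nsmul (ZMod 2)]
  exact (congrArg (· • f) (by decide : ((2 : ℕ) : ZMod 2) = 0)).trans (zero_smul _ f)

theorem Q.two (X Y : Q) (f : X ⟶ Y) : f + f = 0 := by
  obtain ⟨f, rfl⟩ := (Quotient.functor J.rel).map_surjective f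
  rw [← Functor.map_add, R.two, Functor.map_zero]

variable {D : Type} [Category.{0} D] [Preadditive D] (hD : ∀ (X Y : D) (f : X ⟶ Y), f + f = 0)
  (o : ℤ → D) (e : ∀ a b : ℤ, o a ⟶ o b)

/-- The additive functor on `R` with prescribed values on objects and one-step sequences. -/
noncomputable def R.lift : R ⥤ D :=
  letI := linearOfTwo D hD
  Free.lift (ZMod 2) (Paths.lift (V := Deg) { obj := fun a => o a.n, map := fun {a b} _ => e a.n b.n })

instance : (R.lift hD o e).Additive :=
  letI := linearOfTwo D hD
  Free.lift_additive _ _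

theorem R.lift_obj (n : ℤ) : (R.lift hD o e).obj (R.deg n) = o n := rfl

theorem R.lift_step {a b : ℤ} (h : a < b) : (R.lift hD o e).map (R.step h) = e a b := by
  let := linearOfTwo D hD
  refine (Free.lift_map_single (ZMod 2) _ _ _).trans ?_
  rw [one_smul]
  exact Category.id_comp _

/-- A class of morphisms of `R` that is closed under addition and composition with one-step
sequences and contains the identities is everything. -/
theorem R.induction (P : ∀ ⦃a b : R⦄, (a ⟶ b) → Prop) (hid : ∀ a, P (𝟙 a))
    (hzero : ∀ a b, P (0 : a ⟶ b)) (hadd : ∀ ⦃a b⦄ (f g : a ⟶ b), P f → P g → P (f + g))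
    (hcomp : ∀ ⦃a : R⦄ ⦃b c : ℤ⦄ (f : a ⟶ R.deg b) (h : b < c), P f → P (f ≫ R.step h)) :
    ∀ ⦃a b : R⦄ (f : a ⟶ b), P f := by
  have key : ∀ ⦃a b : Paths Deg⦄ (p : a ⟶ b),
      P ((Free.embedding (ZMod 2) (Paths Deg)).map p) := by
    intro a b p
    refine Paths.induction (fun {a b} p => P ((Free.embedding (ZMod 2) (Paths Deg)).map p))
      ?_ ?_ p
    · intro v
      rw [CategoryTheory.Functor.map_id]
      exact hid _
    · intro u v w p q hp
      rw [Functor.map_comp]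
      exact hcomp (b := v.n) (c := w.n) _ q.down hp
  intro a b f
  refine Finsupp.induction_linear (motive := fun f => P (a := a) (b := b) f) f
    (hzero a b) (fun f g => hadd f g) fun p r => ?_
  fin_cases r
  · have h0 : (Finsupp.single p (0 : ZMod 2) : a ⟶ b) = 0 := Finsupp.single_zero p
    change P (Finsupp.single p (0 : ZMod 2) : a ⟶ b)
    rw [h0]
    exact hzero a b
  · exact key p


theorem R.lift_sq (hid : ∀ a, e a a = 𝟙 _) (hneg : ∀ a b : ℤ, b < a → e a b = 0) (a b : ℤ) :
    (R.lift hD o e).map (R.sq a b) = e a b := by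
  rcases lt_trichotomy a b with h | rfl | h
  · rw [R.sq_of_lt h, R.lift_step]
  · rw [R.sq_self, hid]
    exact CategoryTheory.Functor.map_id _ _
  · rw [R.sq_of_gt h, hneg _ _ h, Functor.map_zero]
    rfl

theorem R.lift_kills_J (hid : ∀ a, e a a = 𝟙 _) (hneg : ∀ a b : ℤ, b < a → e a b = 0)
    (hadem : ∀ (a b c : ℤ) (i j : ℕ), b = a + j → c = b + i → 0 < i → i < 2 * j →
      e a b ≫ e b c = ∑ t ∈ Finset.range (i / 2 + 1),
        (j - t - 1).choose (i - 2 * t) • (e a (a + t) ≫ e (a + t) c))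
    (hunst : ∀ a b : ℤ, a ≤ b → a < b - a → e a b = 0) ⦃a b : R⦄ (f : a ⟶ b)
    (hf : f ∈ J.hom a b) : (R.lift hD o e).map f = 0 := by
  refine RIdeal.generated_le JGen (RIdeal.ker (R.lift hD o e)) ?_ hf
  intro x y g hg
  change (R.lift hD o e).map g = 0
  cases hg with
  | adem a b c i j hb hc hi hij =>
    rw [R.adem, Functor.map_sub, sub_eq_zero, Functor.map_sum, Functor.map_comp,
      R.lift_sq hD o e hid hneg, R.lift_sq hD o e hid hneg]
    refine (hadem a b c i j hb hc hi hij).trans (Finset.sum_congr rfl fun t _ => ?_)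
    rw [Functor.map_nsmul, Functor.map_comp, R.lift_sq hD o e hid hneg,
      R.lift_sq hD o e hid hneg]
    rfl
  | unstable a b hab h =>
    rw [R.lift_sq hD o e hid hneg]
    exact hunst a b hab h

/-- The additive functor on `Q` with prescribed values on objects and squares, provided that the
defining relations hold. -/
noncomputable def Q.lift (hid : ∀ a, e a a = 𝟙 _) (hneg : ∀ a b : ℤ, b < a → e a b = 0)
    (hadem : ∀ (a b c : ℤ) (i j : ℕ), b = a + j → c = b + i → 0 < i → i < 2 * j →
      e a b ≫ e b c = ∑ t ∈ Finset.range (i / 2 + 1),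
        (j - t - 1).choose (i - 2 * t) • (e a (a + t) ≫ e (a + t) c))
    (hunst : ∀ a b : ℤ, a ≤ b → a < b - a → e a b = 0) : Q ⥤ D :=
  J.descend (R.lift hD o e) (R.lift_kills_J hD o e hid hneg hadem hunst)

end Lift

@[simp]
theorem Q.sq_self (a : ℤ) : Q.sq a a = 𝟙 _ := by
  rw [Q.sq, R.sq_self]
  exact CategoryTheory.Functor.map_id _ _

theorem Q.sq_of_gt {a b : ℤ} (h : b < a) : Q.sq a b = 0 := by
  rw [Q.sq, R.sq_of_gt h, Functor.map_zero]
  rfl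

theorem Q.map_eq_zero {a b : R} (f : a ⟶ b) (hf : f ∈ J.hom a b) :
    (Quotient.functor J.rel).map f = 0 := by
  rw [← (Quotient.functor J.rel).map_zero, Quotient.functor_map_eq_iff]
  simpa [RIdeal.rel] using hf

theorem Q.sq_unstable {a b : ℤ} (h : a < b - a) : Q.sq a b = 0 := by
  rcases le_or_gt a b with hab | hab
  · exact Q.map_eq_zero _ (RIdeal.mem_generated _ (JGen.unstable a b hab h))
  · exact Q.sq_of_gt hab

theorem Q.sq_adem (a b c : ℤ) (i j : ℕ) (hb : b = a + j) (hc : c = b + i) (hi : 0 < i)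
    (hij : i < 2 * j) :
    Q.sq a b ≫ Q.sq b c = ∑ t ∈ Finset.range (i / 2 + 1),
      (j - t - 1).choose (i - 2 * t) • (Q.sq a (a + t) ≫ Q.sq (a + t) c) := by
  have := Q.map_eq_zero _ (RIdeal.mem_generated _ (JGen.adem a b c i j hb hc hi hij))
  rw [R.adem, Functor.map_sub, sub_eq_zero, Functor.map_sum, Functor.map_comp] at this
  refine this.trans (Finset.sum_congr rfl fun t _ => ?_)
  rw [Functor.map_nsmul, Functor.map_comp]
  rfl

/-! ### The suspension morphism -/

/-- The suspension morphism `σ : Q ⥤ Q`, with `σ(n) = n - 1` and `σ(Sq^i) = Sq^i`. -/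
noncomputable def Q.sigma : Q ⥤ Q :=
  Q.lift Q.two (fun n => Q.deg (n - 1)) (fun a b => Q.sq (a - 1) (b - 1))
    (fun _ => Q.sq_self _) (fun _ _ h => Q.sq_of_gt (by omega))
    (fun a b c i j hb hc hi hij => by
      rw [Q.sq_adem (a - 1) (b - 1) (c - 1) i j (by omega) (by omega) hi hij]
      refine Finset.sum_congr rfl fun t _ => ?_
      rw [show a - 1 + (t : ℤ) = a + t - 1 by ring])
    (fun a b _ h => Q.sq_unstable (by omega))

instance : Q.sigma.Additive := by
  unfold Q.sigma Q.lift
  infer_instance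

theorem Q.sigma_sq (a b : ℤ) : Q.sigma.map (Q.sq a b) = Q.sq (a - 1) (b - 1) :=
  R.lift_sq Q.two (fun n => Q.deg (n - 1)) (fun a b => Q.sq (a - 1) (b - 1))
    (fun _ => Q.sq_self _) (fun _ _ h => Q.sq_of_gt (by omega)) a b

theorem Q.sigma_mem (k : ℕ) ⦃a b : Q⦄ (f : a ⟶ b) (hf : f ∈ (topSub (k + 1)).hom a b) :
    Q.sigma.map f ∈ (topSub k).hom (Q.sigma.obj a) (Q.sigma.obj b) := by
  refine Subringoid.generated_le _ ((topSub k).comap Q.sigma) ?_ hf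
  rintro _ _ _ ⟨a, b, hab, h⟩
  change Q.sigma.map (Q.sq a b) ∈ (topSub k).hom (Q.deg (a - 1)) (Q.deg (b - 1))
  rw [Q.sigma_sq]
  exact Subringoid.mem_generated _ (TopSq.mk _ _ (by omega) (by push_cast at h; omega))

/-- The suspension morphism `σ_k : Q_{k+1} ⥤ Q_k`. -/
noncomputable def Qk.sigma (k : ℕ) : Qk (k + 1) ⥤ Qk k :=
  Subringoid.restrict Q.sigma (topSub (k + 1)) (topSub k) (Q.sigma_mem k)

instance (k : ℕ) : (Qk.sigma k).Additive := by
  unfold Qk.sigma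
  infer_instance

/-- The inclusion `Q_k ⥤ Q_l` for `k ≤ l`. -/
noncomputable def Qk.incl {k l : ℕ} (h : k ≤ l) : Qk k ⥤ Qk l :=
  Subringoid.restrict (𝟭 Q) (topSub k) (topSub l) (by
    intro a b f hf
    refine Subringoid.generated_le _ (topSub l) ?_ hf
    rintro _ _ _ ⟨a, b, hab, h'⟩
    exact Subringoid.mem_generated _ (TopSq.mk a b hab (by omega)))

instance {k l : ℕ} (h : k ≤ l) : (Qk.incl h).Additive := by
  unfold Qk.incl
  infer_instance

/-! ### The Frobenius morphism -/

/-- The Frobenius morphism on objects: `φ(2n) = n` and `φ(2n+1) = +`. -/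
noncomputable def Q.half (n : ℤ) : Plus Q := if Even n then Plus.of (Q.deg (n / 2)) else Plus.pt

theorem Q.half_two (n : ℤ) : Q.half (2 * n) = Plus.of (Q.deg n) := by
  rw [Q.half, if_pos (even_two_mul n), Int.mul_ediv_cancel_left _ (by norm_num)]

theorem Q.half_odd (n : ℤ) : Q.half (2 * n + 1) = Plus.pt := by
  rw [Q.half, if_neg (by simp)]

/-- The square from one object of `Q⁺` to another one (zero if one of them is `+`). -/
noncomputable def Q.psq : ∀ X Y : Plus Q, X ⟶ Y
  | ⟨some X⟩, ⟨some Y⟩ => Q.sq X.val Y.val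
  | ⟨none⟩, _ => 0
  | ⟨some _⟩, ⟨none⟩ => 0

theorem Q.psq_of (a b : ℤ) :
    Q.psq (Plus.of (Q.deg a)) (Plus.of (Q.deg b)) = (Plus.incl Q).map (Q.sq a b) := rfl

theorem Q.pt_left {X Y Z : Plus Q} (h : Y = Plus.pt) (f : X ⟶ Y) (g : Y ⟶ Z) : f ≫ g = 0 := by
  subst h
  obtain ⟨_ | X⟩ := X <;> obtain ⟨_ | Z⟩ := Z <;> rfl

theorem Plus.two_Q (X Y : Plus Q) (f : X ⟶ Y) : f + f = 0 := by
  obtain ⟨_ | X⟩ := X <;> obtain ⟨_ | Y⟩ := Y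
  · rfl
  · rfl
  · rfl
  · exact Q.two X Y f

theorem nsmul_congr_mod_two {G : Type*} [AddCommGroup G] (f : G) (hf : f + f = 0) {m n : ℕ}
    (h : m ≡ n [MOD 2]) : m • f = n • f := by
  have key : ∀ m : ℕ, m • f = (m % 2) • f := by
    intro m
    conv_lhs => rw [← Nat.div_add_mod m 2]
    rw [add_nsmul, mul_comm, mul_nsmul', two_nsmul, hf, nsmul_zero, zero_add]
  rw [key m, key n, h]

theorem choose_even_odd (m n : ℕ) : (2 * m).choose (2 * n + 1) ≡ 0 [MOD 2] := by
  have := Choose.choose_modEq_choose_mod_mul_choose_div_nat (p := 2) (n := 2 * m) (k := 2 * n + 1)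
  simpa using this

theorem choose_odd_even (m n : ℕ) : (2 * m + 1).choose (2 * n) ≡ m.choose n [MOD 2] := by
  have := Choose.choose_modEq_choose_mod_mul_choose_div_nat (p := 2) (n := 2 * m + 1) (k := 2 * n)
  have h : (2 * m + 1) / 2 = m := by omega
  simpa [h] using this

theorem Q.psq_self (X : Plus Q) : Q.psq X X = 𝟙 X := by
  obtain ⟨_ | X⟩ := X
  · rfl
  · exact Q.sq_self _

theorem Q.psq_comp_odd (X Z : Plus Q) (n : ℤ) :
    Q.psq X (Q.half (2 * n + 1)) ≫ Q.psq (Q.half (2 * n + 1)) Z = 0 :=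
  Q.pt_left (Q.half_odd n) _ _

theorem Q.psq_comp_even (a b c : ℤ) :
    Q.psq (Plus.of (Q.deg a)) (Q.half (2 * b)) ≫ Q.psq (Q.half (2 * b)) (Plus.of (Q.deg c)) =
      (Plus.incl Q).map (Q.sq a b ≫ Q.sq b c) := by
  rw [Q.half_two]
  rfl

theorem Q.frob_adem (a b c : ℤ) (i j : ℕ) (hb : b = a + j) (hc : c = b + i) (hi : 0 < i)
    (hij : i < 2 * j) :
    Q.psq (Q.half a) (Q.half b) ≫ Q.psq (Q.half b) (Q.half c) =
      ∑ t ∈ Finset.range (i / 2 + 1), (j - t - 1).choose (i - 2 * t) •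
        (Q.psq (Q.half a) (Q.half (a + t)) ≫ Q.psq (Q.half (a + t)) (Q.half c)) := by
  have ptl : ∀ {X Y Z : Plus Q} (h : X = Plus.pt) (f : X ⟶ Y) (g : Y ⟶ Z), f ≫ g = 0 := by
    intro X Y Z h f g
    subst h
    rfl
  have ptr : ∀ {X Y Z : Plus Q} (h : Z = Plus.pt) (f : X ⟶ Y) (g : Y ⟶ Z), f ≫ g = 0 := by
    intro X Y Z h f g
    subst h
    obtain ⟨_ | X⟩ := X <;> obtain ⟨_ | Y⟩ := Y <;> rfl
  obtain ⟨a', rfl | rfl⟩ := Int.even_or_odd' a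
  swap
  · rw [ptl (Q.half_odd a')]
    exact (Finset.sum_eq_zero fun t _ => by rw [ptl (Q.half_odd a'), nsmul_zero]).symm
  obtain ⟨c', hc' | hc'⟩ := Int.even_or_odd' c
  swap
  · rw [hc', ptr (Q.half_odd c')]
    exact (Finset.sum_eq_zero fun t _ => by rw [ptr (Q.half_odd c'), nsmul_zero]).symm
  rw [hc', Q.half_two, Q.half_two]
  have odd_term : ∀ s : ℕ, Q.psq (Plus.of (Q.deg a')) (Q.half (2 * a' + (2 * s + 1 : ℕ))) ≫
      Q.psq (Q.half (2 * a' + (2 * s + 1 : ℕ))) (Plus.of (Q.deg c')) = 0 := by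
    intro s
    rw [show 2 * a' + ((2 * s + 1 : ℕ) : ℤ) = 2 * (a' + s) + 1 by push_cast; ring,
      Q.psq_comp_odd]
  obtain ⟨b', hb' | hb'⟩ := Int.even_or_odd' b
  · obtain ⟨i', rfl⟩ : ∃ i', i = 2 * i' := ⟨i / 2, by omega⟩
    obtain ⟨j', rfl⟩ : ∃ j', j = 2 * j' := ⟨j / 2, by omega⟩
    rw [hb', Q.psq_comp_even, Q.sq_adem a' b' c' i' j' (by omega) (by omega) (by omega) (by omega),
      Functor.map_sum]
    refine Finset.sum_of_injOn (fun s => 2 * s) (fun x _ y _ h => by simpa using h) ?_ ?_ ?_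
    · intro s hs
      simp only [Finset.coe_range, Set.mem_Iio] at hs ⊢
      omega
    · intro t ht hts
      rcases Nat.even_or_odd' t with ⟨s, rfl | rfl⟩
      · exact absurd ⟨s, by simp only [Finset.coe_range, Set.mem_Iio, Finset.mem_range] at ht ⊢; omega, rfl⟩ hts
      · rw [odd_term, nsmul_zero]
        rfl
    · intro s hs
      simp only [Finset.mem_range] at hs
      rw [show 2 * a' + ((2 * s : ℕ) : ℤ) = 2 * (a' + s) by push_cast; ring, Q.psq_comp_even,
        Functor.map_nsmul]
      refine nsmul_congr_mod_two _ (Plus.two_Q _ _ _) ?_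
      rw [show 2 * j' - 2 * s - 1 = 2 * (j' - s - 1) + 1 by omega,
        show 2 * i' - 2 * (2 * s) = 2 * (i' - 2 * s) by omega]
      exact (choose_odd_even _ _).symm
  · rw [hb', Q.psq_comp_odd]
    refine (Finset.sum_eq_zero fun t ht => ?_).symm
    simp only [Finset.mem_range] at ht
    rcases Nat.even_or_odd' t with ⟨s, rfl | rfl⟩
    · rw [show j - 2 * s - 1 = 2 * ((j - 2 * s - 1) / 2) by omega,
        show i - 2 * (2 * s) = 2 * ((i - 2 * (2 * s)) / 2) + 1 by omega,
        nsmul_congr_mod_two _ (Plus.two_Q _ _ _) (choose_even_odd _ _), zero_nsmul]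
    · rw [odd_term, nsmul_zero]

theorem Q.psq_half_of_gt {a b : ℤ} (h : b < a) : Q.psq (Q.half a) (Q.half b) = 0 := by
  obtain ⟨a', rfl | rfl⟩ := Int.even_or_odd' a
  · obtain ⟨b', rfl | rfl⟩ := Int.even_or_odd' b
    · rw [Q.half_two, Q.half_two, Q.psq_of, Q.sq_of_gt (by omega), Functor.map_zero]
      rfl
    · rw [Q.half_two, Q.half_odd]
      rfl
  · rw [Q.half_odd]
    rfl

theorem Q.psq_half_unstable {a b : ℤ} (h : a < b - a) : Q.psq (Q.half a) (Q.half b) = 0 := by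
  obtain ⟨a', rfl | rfl⟩ := Int.even_or_odd' a
  · obtain ⟨b', rfl | rfl⟩ := Int.even_or_odd' b
    · rw [Q.half_two, Q.half_two, Q.psq_of, Q.sq_unstable (by omega), Functor.map_zero]
      rfl
    · rw [Q.half_two, Q.half_odd]
      rfl
  · rw [Q.half_odd]
    rfl

/-- The Frobenius morphism `φ : Q ⥤ Q⁺`, with `φ(2n) = n`, `φ(2n+1) = +`, and with
`φ(Sq^{2i} : 2n ⟶ 2n+2i) = (Sq^i : n ⟶ n+i)`. -/
noncomputable def Q.frob : Q ⥤ Plus Q :=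
  Q.lift Plus.two_Q Q.half (fun a b => Q.psq (Q.half a) (Q.half b)) (fun _ => Q.psq_self _)
    (fun _ _ h => Q.psq_half_of_gt h) Q.frob_adem (fun _ _ _ h => Q.psq_half_unstable h)

instance : Q.frob.Additive := by
  unfold Q.frob Q.lift
  infer_instance

theorem Q.frob_sq (a b : ℤ) : Q.frob.map (Q.sq a b) = Q.psq (Q.half a) (Q.half b) :=
  R.lift_sq Plus.two_Q Q.half (fun a b => Q.psq (Q.half a) (Q.half b)) (fun _ => Q.psq_self _)
    (fun _ _ h => Q.psq_half_of_gt h) a b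

theorem Q.psq_half_mem (k : ℕ) (a b : ℤ) (hab : a ≤ b) (h : a - (b - a) < (2 * k : ℕ)) :
    Q.psq (Q.half a) (Q.half b) ∈ (Plus.sub (topSub k)).hom (Q.half a) (Q.half b) := by
  obtain ⟨a', rfl | rfl⟩ := Int.even_or_odd' a
  · obtain ⟨b', rfl | rfl⟩ := Int.even_or_odd' b
    · rw [Q.half_two, Q.half_two]
      exact Subringoid.mem_generated _
        (TopSq.mk a' b' (by omega) (by push_cast at h; omega))
    · rw [Q.half_two, Q.half_odd]
      trivial
  · rw [Q.half_odd]
    trivial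

theorem Q.frob_mem (k : ℕ) ⦃a b : Q⦄ (f : a ⟶ b) (hf : f ∈ (topSub (2 * k)).hom a b) :
    Q.frob.map f ∈ (Plus.sub (topSub k)).hom (Q.frob.obj a) (Q.frob.obj b) := by
  refine Subringoid.generated_le _ ((Plus.sub (topSub k)).comap Q.frob) ?_ hf
  rintro _ _ _ ⟨a, b, hab, h⟩
  change Q.frob.map (Q.sq a b) ∈ (Plus.sub (topSub k)).hom (Q.half a) (Q.half b)
  rw [Q.frob_sq]
  exact Q.psq_half_mem k a b hab h

/-- The Frobenius morphism `Q_{2k} ⥤ Q_k⁺`. -/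
noncomputable def Qk.frob (k : ℕ) : Qk (2 * k) ⥤ (Plus.sub (topSub k)).Obj :=
  Subringoid.restrict Q.frob (topSub (2 * k)) (Plus.sub (topSub k)) (Q.frob_mem k)

instance (k : ℕ) : (Qk.frob k).Additive := by
  unfold Qk.frob
  infer_instance

/-- In `Q`, the operation `Sq_0` (that is, `Sq^n` on degree `n`) satisfies
`Sq^{2i} Sq_0 = Sq_0 Sq^i` and `Sq^{2i+1} Sq_0 = 0`. -/
theorem Q.psq_naturality {b c : ℤ} (h : b < c) :
    Q.psq (Q.half b) (Plus.of (Q.deg b)) ≫ (Plus.incl Q).map (Q.sq b c) =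
      Q.psq (Q.half b) (Q.half c) ≫ Q.psq (Q.half c) (Plus.of (Q.deg c)) := by
  obtain ⟨m, rfl | rfl⟩ := Int.even_or_odd' b
  swap
  · rw [Q.half_odd]
    rfl
  rw [Q.half_two]
  change (Plus.incl Q).map (Q.sq m (2 * m) ≫ Q.sq (2 * m) c) = _
  have key : ∀ p : ℤ, c = 2 * p →
      Q.sq m (2 * m) ≫ Q.sq (2 * m) c = Q.sq m p ≫ Q.sq p c := by
    rintro p rfl
    rcases lt_trichotomy (2 * p - 2 * m) (2 * m) with hlt | heq | hgt
    · rw [Q.sq_adem m (2 * m) (2 * p) (2 * p - 2 * m).toNat m.toNat (by omega) (by omega)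
        (by omega) (by omega), Finset.sum_eq_single (p - m).toNat]
      · rw [show (2 * p - 2 * m).toNat - 2 * (p - m).toNat = 0 by omega, Nat.choose_zero_right,
          one_nsmul, show m + ((p - m).toNat : ℤ) = p by omega]
      · intro t ht hne
        simp only [Finset.mem_range] at ht
        rw [Q.sq_unstable (a := m + t) (b := 2 * p) (by omega), comp_zero, nsmul_zero]
      · intro hn
        exact absurd (Finset.mem_range.mpr (by omega)) hn
    · obtain rfl : p = 2 * m := by omega
      rfl
    · rw [Q.sq_unstable (a := 2 * m) (b := 2 * p) (by omega),
        Q.sq_unstable (a := m) (b := p) (by omega), comp_zero, zero_comp]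
  obtain ⟨p, rfl | rfl⟩ := Int.even_or_odd' c
  · rw [key p rfl, Q.half_two]
    rfl
  · rw [Q.pt_left (Q.half_odd p)]
    suffices hs : Q.sq m (2 * m) ≫ Q.sq (2 * m) (2 * p + 1) = 0 by
      rw [hs, Functor.map_zero]
      rfl
    rcases lt_or_ge (2 * p + 1 - 2 * m) (2 * m) with hlt | hge
    · rw [Q.sq_adem m (2 * m) (2 * p + 1) (2 * p + 1 - 2 * m).toNat m.toNat (by omega) (by omega)
        (by omega) (by omega)]
      refine Finset.sum_eq_zero fun t ht => ?_
      simp only [Finset.mem_range] at ht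
      rw [Q.sq_unstable (a := m + t) (b := 2 * p + 1) (by omega), comp_zero, nsmul_zero]
    · rw [Q.sq_unstable (a := 2 * m) (b := 2 * p + 1) (by omega), comp_zero]

/-- The morphism `Sq_0 : φ(2n) = n ⟶ 2n` of `Q⁺`, and the zero morphism `φ(2n+1) = + ⟶ 2n+1`. -/
noncomputable def Q.sqZero (X : Q) : Q.frob.obj X ⟶ (Plus.incl Q).obj X :=
  Q.psq (Q.half X.val) (Plus.of X)

theorem Q.sqZero_natural ⦃X Y : Q⦄ (f : X ⟶ Y) :
    Q.frob.map f ≫ Q.sqZero Y = Q.sqZero X ≫ (Plus.incl Q).map f := by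
  have key : ∀ ⦃a b : R⦄ (f : a ⟶ b),
      Q.frob.map ((Quotient.functor J.rel).map f) ≫ Q.sqZero ((Quotient.functor J.rel).obj b) =
        Q.sqZero ((Quotient.functor J.rel).obj a) ≫
          (Plus.incl Q).map ((Quotient.functor J.rel).map f) := by
    refine R.induction _ ?_ ?_ ?_ ?_
    · intro a
      simp only [CategoryTheory.Functor.map_id, Category.id_comp, Category.comp_id]
    · intro a b
      simp only [Functor.map_zero, zero_comp, comp_zero]
    · intro a b f g hf hg
      simp only [Functor.map_add, Preadditive.add_comp, Preadditive.comp_add, hf, hg]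
    · intro a b c f h hf
      have hs : (Quotient.functor J.rel).map (R.step h) = Q.sq b c := by
        rw [Q.sq, R.sq_of_lt h]
      have h2 : Q.frob.map ((Quotient.functor J.rel).map (R.step h)) ≫
          Q.sqZero ((Quotient.functor J.rel).obj (R.deg c)) =
          Q.sqZero ((Quotient.functor J.rel).obj (R.deg b)) ≫
            (Plus.incl Q).map ((Quotient.functor J.rel).map (R.step h)) := by
        rw [hs]
        refine Eq.trans ?_ (Q.psq_naturality h).symm
        exact congrArg (· ≫ Q.psq (Q.half c) (Plus.of (Q.deg c))) (Q.frob_sq b c)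
      simp only [Functor.map_comp, Category.assoc, h2]
      rw [← Category.assoc, hf, Category.assoc]
  obtain ⟨f, rfl⟩ := (Quotient.functor J.rel).map_surjective f
  exact key f

theorem Q.sqZero_mem (k : ℕ) (X : Q) : Q.sqZero X ∈
    (Plus.sub (topSub (k + 1))).hom (Q.frob.obj X) ((Plus.incl Q).obj X) := by
  have key : ∀ n : ℤ, Q.psq (Q.half n) (Plus.of (Q.deg n)) ∈
      (Plus.sub (topSub (k + 1))).hom (Q.half n) (Plus.of (Q.deg n)) := by
    intro n
    obtain ⟨m, rfl | rfl⟩ := Int.even_or_odd' n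
    · rw [Q.half_two]
      rcases le_or_gt 0 m with hm | hm
      · exact Subringoid.mem_generated _ (TopSq.mk m (2 * m) (by omega) (by push_cast; omega))
      · rw [Q.psq_of, Q.sq_of_gt (by omega)]
        exact zero_mem ((topSub (k + 1)).hom _ _)
    · rw [Q.half_odd]
      trivial
  exact key X.val

/-- The inclusion `Q_k ⥤ Q_k⁺`. -/
noncomputable def Qk.inclPlus (k : ℕ) : Qk k ⥤ (Plus.sub (topSub k)).Obj :=
  Subringoid.restrict (Plus.incl Q) (topSub k) (Plus.sub (topSub k)) fun _ _ _ hf => hf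

theorem two_mul_ge (k : ℕ) : k + 1 ≤ 2 * (k + 1) := by omega

/-- The natural transformation `φu ⟶ id` of morphisms of ringoids given by `Sq_0 : n ⟶ 2n` at `2n`
and by zero at odd integers. -/
noncomputable def Qk.sqZero (k : ℕ) :
    Qk.incl (two_mul_ge k) ⋙ Qk.frob (k + 1) ⟶ Qk.inclPlus (k + 1) where
  app X := ⟨Q.sqZero X.as, Q.sqZero_mem k X.as⟩
  naturality _ _ f := Subtype.ext (Q.sqZero_natural f.1)

/-! ### The category `U_k` and its abelian structure -/

section Abelian

variable (C : Type*) [Category* C] [Preadditive C] (D : Type*) [Category* D] [Abelian D]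

instance : (additiveFunctor C D).IsClosedUnderSubobjects where
  prop_of_mono {F G} i _ hG := by
    have : G.Additive := hG
    refine ⟨fun {X Y f g} => ?_⟩
    rw [← cancel_mono (i.app Y), Preadditive.add_comp]
    simp only [NatTrans.naturality, Functor.map_add, Preadditive.comp_add]

instance : (additiveFunctor C D).IsClosedUnderQuotients where
  prop_of_epi {F G} p _ hF := by
    have : F.Additive := hF
    refine ⟨fun {X Y f g} => ?_⟩
    rw [← cancel_epi (p.app X), Preadditive.comp_add]
    simp only [← NatTrans.naturality, Functor.map_add, Preadditive.add_comp]

instance : (additiveFunctor C D).ContainsZero where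
  exists_zero := by
    obtain ⟨Z, hZ⟩ := HasZeroObject.zero (C := C ⥤ D)
    exact ⟨Z, hZ, ⟨fun {_ _ _ _} => (hZ.obj _).eq_of_src _ _⟩⟩

instance : (additiveFunctor C D).IsClosedUnderFiniteProducts where
  isClosedUnderLimitsOfShape T _ := ⟨by
    rintro F ⟨p⟩
    refine ⟨fun {X Y f g} => ?_⟩
    refine (isLimitOfPreserves ((evaluation C D).obj Y) p.isLimit).hom_ext fun j => ?_
    have : (p.diag.obj j).Additive := p.prop_diag_obj j
    change F.map (f + g) ≫ (p.π.app j).app Y = (F.map f + F.map g) ≫ (p.π.app j).app Y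
    rw [Preadditive.add_comp]
    simp only [NatTrans.naturality, Functor.map_add, Preadditive.comp_add]⟩

end Abelian

/-- The category `U_k` of unstable modules with only the top `k` squares: additive functors from
`Q_k` to abelian groups. -/
abbrev U (k : ℕ) := Qk k ⥤+ AddCommGrpCat.{u}

instance (k : ℕ) : HasExt.{u + 1} (U.{u} k) := HasExt.standard _

theorem U.two {k : ℕ} (M N : U.{u} k) (f : M ⟶ N) : f + f = 0 := by
  apply ObjectProperty.hom_ext
  apply NatTrans.ext
  funext X
  have h : (𝟙 X : X ⟶ X) + 𝟙 X = 0 := Subtype.ext (Q.two _ _ (𝟙 X.as))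
  have h' : (𝟙 (M.obj.obj X)) + 𝟙 (M.obj.obj X) = 0 := by
    rw [← CategoryTheory.Functor.map_id, ← Functor.map_add, h, Functor.map_zero]
  change f.hom.app X + f.hom.app X = 0
  rw [← Category.id_comp (f.hom.app X), ← Preadditive.add_comp, h', zero_comp]

/-- Morphisms in `U_k`, and hence the `Ext` groups, are vector spaces over `𝔽₂`. -/
noncomputable instance (k : ℕ) : Linear (ZMod 2) (U.{u} k) := linearOfTwo _ U.two

/-- Restriction of modules along an additive functor of ringoids. -/
def pullback {C D : Type*} [Category* C] [Preadditive C] [Category* D] [Preadditive D]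
    (F : C ⥤ D) [F.Additive] : (D ⥤+ AddCommGrpCat.{u}) ⥤ (C ⥤+ AddCommGrpCat.{u}) where
  obj M := AdditiveFunctor.of (F ⋙ M.obj)
  map f := ⟨Functor.whiskerLeft F f.hom⟩

/-- The suspension functor `Σ : U_k ⥤ U_{k+1}`: `(ΣM)^{n+1} = M^n`, with `Sq^i (Σx) = Σ (Sq^i x)`. -/
noncomputable def susp (k : ℕ) : U.{u} k ⥤ U.{u} (k + 1) := pullback (Qk.sigma k)

/-- The forgetful functor `u : U_l ⥤ U_k` for `k ≤ l`. -/
noncomputable def forgetTop {k l : ℕ} (h : k ≤ l) : U.{u} l ⥤ U.{u} k := pullback (Qk.incl h)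

/-- The extension of `M` to `Q_k⁺` restricts to `M` on `Q_k`. -/
noncomputable def Plus.inclExtend {k : ℕ} (M : Qk k ⥤ AddCommGrpCat.{u}) [M.Additive] :
    Qk.inclPlus k ⋙ Plus.extend M ⟶ M where
  app X := 𝟙 (M.obj X)
  naturality _ _ f := (Category.comp_id _).trans (Category.id_comp (M.map f)).symm

/-- The Frobenius functor `Φ : U_k ⥤ U_{2k}` on objects: `(ΦM)^{2n} = M^n`, `(ΦM)^{odd} = 0`, with
`Sq^{2i} (Φx) = Φ (Sq^i x)`. -/
noncomputable def frobenius {k : ℕ} (M : U.{u} k) : U.{u} (2 * k) :=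
  AdditiveFunctor.of (Qk.frob k ⋙ Plus.extend M.obj)

/-- The map `λ_M : uΦM ⟶ M`, sending `Φx` to `Sq_0 x`. -/
noncomputable def lam {k : ℕ} (M : U.{u} (k + 1)) :
    (forgetTop (two_mul_ge k)).obj (frobenius M) ⟶ M :=
  ⟨Functor.whiskerRight (Qk.sqZero k) (Plus.extend M.obj) ≫ Plus.inclExtend M.obj⟩

section Coinduction

variable {C : Type} [Category.{0} C] [Preadditive C] {D : Type} [Category.{0} D] [Preadditive D]
  (F : C ⥤ D)

/-- The group of `C`-linear maps from `D(Y, F(-))` to the `C`-module `M`. -/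
def coindGroup (M : C ⥤ AddCommGrpCat.{u}) (Y : D) :
    AddSubgroup (∀ X : C, (Y ⟶ F.obj X) →+ M.obj X) where
  carrier := {η | ∀ ⦃X X' : C⦄ (f : X ⟶ X') (g : Y ⟶ F.obj X),
    η X' (g ≫ F.map f) = M.map f (η X g)}
  zero_mem' _ _ f _ := (map_zero (M.map f).hom).symm
  add_mem' hη hθ _ _ f g :=
    (congrArg₂ (· + ·) (hη f g) (hθ f g)).trans (map_add (M.map f).hom _ _).symm
  neg_mem' hη _ _ f g :=
    (congrArg (- ·) (hη f g)).trans (map_neg (M.map f).hom _).symm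

/-- Coextension of scalars along `F`: the right adjoint of restriction along `F`. -/
def coind (M : C ⥤ AddCommGrpCat.{u}) : D ⥤ AddCommGrpCat.{u} where
  obj Y := AddCommGrpCat.of (coindGroup F M Y)
  map {Y Y'} h := AddCommGrpCat.ofHom
    { toFun η := ⟨fun X => (η.1 X).comp (Preadditive.leftComp (F.obj X) h), fun X X' f g => by
        change η.1 X' (h ≫ g ≫ F.map f) = M.map f (η.1 X (h ≫ g))
        rw [← Category.assoc, η.2]⟩
      map_zero' := rfl
      map_add' _ _ := rfl }
  map_id Y := AddCommGrpCat.hom_ext <| AddMonoidHom.ext fun η =>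
    Subtype.ext <| funext fun X => AddMonoidHom.ext fun g =>
      congrArg (η.1 X) (Category.id_comp g)
  map_comp h h' := AddCommGrpCat.hom_ext <| AddMonoidHom.ext fun η =>
    Subtype.ext <| funext fun X => AddMonoidHom.ext fun g =>
      congrArg (η.1 X) (Category.assoc h h' g)

instance (M : C ⥤ AddCommGrpCat.{u}) : (coind F M).Additive where
  map_add {_ _ h h'} := AddCommGrpCat.hom_ext <| AddMonoidHom.ext fun η =>
    Subtype.ext <| funext fun X => AddMonoidHom.ext fun g =>
      (congrArg (η.1 X) (Preadditive.add_comp _ _ _ h h' g)).trans (map_add (η.1 X) _ _)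

end Coinduction

/-- Desuspension of a module over `Q_{k+1}`: coextension of scalars along `σ_k`, that is, the right
adjoint of `Σ`. Since `σ_k` is full and bijective on objects, its value at `n` is the group of those
elements of `M^{n+1}` that are annihilated by every morphism `f` of `Q_{k+1}` with `σ_k(f) = 0`. If
`Sq_0 = 0` on `M`, this is all of `M^{n+1}`, and the desuspension is the inverse of `Σ`. -/
noncomputable def desusp {k : ℕ} (M : U.{u} (k + 1)) : U.{u} k :=
  AdditiveFunctor.of (coind (Qk.sigma k) M.obj)

/-- The loop functor `Ω : U_{k+1} ⥤ U_k` on objects: `ΣΩM` is the cokernel of `λ_M`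
(on which `Sq_0 = 0`). -/
noncomputable def loop {k : ℕ} (M : U.{u} (k + 1)) : U.{u} k := desusp (cokernel (lam M))

/-- The functor `Ω₁ : U_{k+1} ⥤ U_k` on objects: `ΣΩ₁M` is the kernel of `λ_M`
(on which `Sq_0 = 0`). -/
noncomputable def loopOne {k : ℕ} (M : U.{u} (k + 1)) : U.{u} k := desusp (kernel (lam M))

end TopSquares

namespace TopSquares

/-! ### Presentations of subringoids of `R` -/

/-! The suspension Σ is restriction along σ : Q_{k+1} ⟶ Q_k. Since σ is full and surjective on
objects, Σ is exact and fully faithful. Everything rests on two facts about Sq_0.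

(a) A morphism of Q_{k+1} killed by σ is zero or of the form g ≫ Sq_0 with g again in Q_{k+1}
(`topSub_eq_comp_sqZero`). Hence a module on which Sq_0 vanishes is a suspension. This applies to
the kernel and the cokernel of λ, and since λ vanishes on suspensions, Ω is left adjoint to Σ.

(b) Sq_0 is injective on the representable modules Q(n, -) (`Q.sqZero_injective`), so λ is a
monomorphism on free modules (`lam_free_mono`).

Given these, the snake lemma for λ on 0 ⟶ K ⟶ P ⟶ M ⟶ 0 with P free yields 0 ⟶ Ω₁M ⟶ ΩK ⟶ ΩP ⟶ ΩM ⟶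
0. So Ω₁ is the first derived functor of Ω, and the higher ones vanish because λ is also mono on K.
The composite functor spectral sequence would have two rows. It is replaced by dimension shifting:
Ext^s(ΩK, N) ≅ Ext^s(K, ΣN) whenever λ_K is mono (`exists_extEquiv`), and splicing gives the long
exact sequence (`exists_long_exact`).

No basis of admissible monomials is used for (a) and (b). In R, raising degrees by one carries Adem
relations to Adem relations, and carries the unstable squares to unstable squares or to some Sq_0.
Because Sq^i Sq_0 is, modulo relations, Sq_0 Sq^{i/2} or zero, the multiples of Sq_0 form an ideal;
this gives (a) for Q. For (b), induct on n using the map Q(n, -) ⟶ Q(n-1, -)[[x]] that sends the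
generator to x times the generator, where x has degree one and the Cartan formula defines the
operations (`isAdem_psSq`). On series Sq_0 squares the powers of x, so its injectivity passes from
n-1 to series, and a degree induction with (a) for Q shows that the map is injective. Finally (a)
for Q_{k+1} needs every relation among the top k squares to follow from the defining relations among
them (`mem_relHom_of_mem_J`). That is a double induction on k and on degree, using (b) to cancel
Sq_0. -/

/-- The squares `Sq_x : n ⟶ 2 n - x` whose lower index `x` satisfies `B`. -/
inductive LowerSq (B : ℤ → Prop) : MorphismProperty R
  | mk (a b : ℤ) (hab : a ≤ b) (h : B (a - (b - a))) : LowerSq B (R.sq a b)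

/-- The subringoid of `R` generated by the squares whose lower index satisfies `B`. -/
noncomputable def lowerSub (B : ℤ → Prop) : Subringoid R := Subringoid.generated (LowerSq B)

/-- The defining relations of `Q` that only involve squares whose lower index satisfies `B`. -/
inductive LowerRel (B : ℤ → Prop) : MorphismProperty R
  | adem (a b c : ℤ) (i j : ℕ) (hb : b = a + j) (hc : c = b + i) (hi : 0 < i) (hij : i < 2 * j)
      (h₁ : B (a - (b - a))) (h₂ : B (b - (c - b))) : LowerRel B (R.adem a b c i j)
  | unstable (a b : ℤ) (hab : a ≤ b) (h : a < b - a) (hB : B (a - (b - a))) :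
      LowerRel B (R.sq a b)

/-- The morphisms of `lowerSub B` that are consequences of the relations `LowerRel B`. -/
noncomputable def relHom (B : ℤ → Prop) (a b : R) : AddSubgroup (a ⟶ b) :=
  AddSubgroup.closure {f | ∃ (x y : R) (u : a ⟶ x) (r : x ⟶ y) (v : y ⟶ b),
    u ∈ (lowerSub B).hom a x ∧ LowerRel B r ∧ v ∈ (lowerSub B).hom y b ∧ f = u ≫ r ≫ v}

section Lower

variable {B : ℤ → Prop}

theorem sq_mem_lowerSub {a b : ℤ} (h : B (a - (b - a))) :
    R.sq a b ∈ (lowerSub B).hom (R.deg a) (R.deg b) := by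
  rcases le_or_gt a b with hab | hab
  · exact Subringoid.mem_generated _ (LowerSq.mk a b hab h)
  · rw [R.sq_of_gt hab]
    exact zero_mem _

theorem relHom_of_rel {a b : R} {r : a ⟶ b} (h : LowerRel B r) : r ∈ relHom B a b :=
  AddSubgroup.subset_closure
    ⟨a, b, 𝟙 _, r, 𝟙 _, (lowerSub B).id_mem _, h, (lowerSub B).id_mem _, by simp⟩

theorem relHom_comp_left {a b c : R} {f : a ⟶ b} (hf : f ∈ (lowerSub B).hom a b) {g : b ⟶ c}
    (hg : g ∈ relHom B b c) : f ≫ g ∈ relHom B a c := by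
  induction hg using AddSubgroup.closure_induction with
  | mem g hg =>
    obtain ⟨x, y, u, r, v, hu, hr, hv, rfl⟩ := hg
    exact AddSubgroup.subset_closure
      ⟨x, y, f ≫ u, r, v, (lowerSub B).comp_mem hf hu, hr, hv, by simp⟩
  | zero => simp
  | add g h _ _ hg hh => rw [Preadditive.comp_add]; exact add_mem hg hh
  | neg g _ hg => rw [Preadditive.comp_neg]; exact neg_mem hg

theorem relHom_comp_right {a b c : R} {f : a ⟶ b} (hf : f ∈ relHom B a b) {g : b ⟶ c}
    (hg : g ∈ (lowerSub B).hom b c) : f ≫ g ∈ relHom B a c := by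
  induction hf using AddSubgroup.closure_induction with
  | mem f hf =>
    obtain ⟨x, y, u, r, v, hu, hr, hv, rfl⟩ := hf
    exact AddSubgroup.subset_closure
      ⟨x, y, u, r, v ≫ g, hu, hr, (lowerSub B).comp_mem hv hg, by simp⟩
  | zero => simp
  | add g h _ _ hg hh => rw [Preadditive.add_comp]; exact add_mem hg hh
  | neg g _ hg => rw [Preadditive.neg_comp]; exact neg_mem hg

theorem relHom_le_J {a b : R} {f : a ⟶ b} (hf : f ∈ relHom B a b) : f ∈ J.hom a b := by
  induction hf using AddSubgroup.closure_induction with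
  | mem f hf =>
    obtain ⟨x, y, u, r, v, hu, hr, hv, rfl⟩ := hf
    refine J.comp_left _ (J.comp_right _ (RIdeal.mem_generated _ ?_))
    cases hr with
    | adem a b c i j hb hc hi hij => exact JGen.adem a b c i j hb hc hi hij
    | unstable a b hab h => exact JGen.unstable a b hab h
  | zero => exact zero_mem _
  | add g h _ _ hg hh => exact add_mem hg hh
  | neg g _ hg => exact neg_mem hg

theorem lowerSub_true {a b : R} (f : a ⟶ b) : f ∈ (lowerSub fun _ => True).hom a b := by
  refine R.induction (fun a b f => f ∈ (lowerSub fun _ => True).hom a b) (Subringoid.id_mem _)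
    (fun _ _ => zero_mem _) (fun _ _ _ _ => add_mem) ?_ f
  intro a b c f h hf
  refine Subringoid.comp_mem _ hf ?_
  rw [← R.sq_of_lt h]
  exact sq_mem_lowerSub trivial

theorem J_le_relHom_true {a b : R} {f : a ⟶ b} (hf : f ∈ J.hom a b) :
    f ∈ relHom (fun _ => True) a b := by
  let I : RIdeal R :=
    { hom := relHom fun _ => True
      comp_left := fun f _ hg => relHom_comp_left (lowerSub_true f) hg
      comp_right := fun g hf => relHom_comp_right hf (lowerSub_true g) }
  refine RIdeal.generated_le JGen I ?_ hf
  intro x y g hg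
  refine relHom_of_rel ?_
  cases hg with
  | adem a b c i j hb hc hi hij => exact LowerRel.adem a b c i j hb hc hi hij trivial trivial
  | unstable a b hab h => exact LowerRel.unstable a b hab h trivial

theorem mem_J_iff {a b : R} (f : a ⟶ b) :
    f ∈ J.hom a b ↔ (Quotient.functor J.rel).map f = 0 := by
  refine ⟨Q.map_eq_zero f, fun h => ?_⟩
  rw [← (Quotient.functor J.rel).map_zero, Quotient.functor_map_eq_iff] at h
  simpa [RIdeal.rel] using h

theorem eqToHom_mem_lowerSub {a b : R} (h : a = b) : eqToHom h ∈ (lowerSub B).hom a b := by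
  subst h
  exact (lowerSub B).id_mem _

/-! #### Shifting degrees in `R` -/

/-- The functor `R ⥤ R` raising all degrees by `d`. -/
noncomputable def R.shift (d : ℤ) : R ⥤ R :=
  R.lift R.two (fun n => R.deg (n + d)) (fun a b => R.sq (a + d) (b + d))

instance (d : ℤ) : (R.shift d).Additive := by
  unfold R.shift
  infer_instance

theorem R.shift_sq (d a b : ℤ) : (R.shift d).map (R.sq a b) = R.sq (a + d) (b + d) :=
  R.lift_sq R.two (fun n => R.deg (n + d)) (fun a b => R.sq (a + d) (b + d))
    (fun _ => R.sq_self _) (fun _ _ h => R.sq_of_gt (by omega)) a b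

theorem R.sq_comp_congr {a b b' c : ℤ} (h : b = b') :
    R.sq a b ≫ R.sq b c = R.sq a b' ≫ R.sq b' c := by
  subst h
  rfl

theorem R.shift_adem (d a b c : ℤ) (i j : ℕ) :
    (R.shift d).map (R.adem a b c i j) = R.adem (a + d) (b + d) (c + d) i j := by
  rw [R.adem, Functor.map_sub, Functor.map_sum, Functor.map_comp, R.shift_sq, R.shift_sq]
  refine congrArg₂ (· - ·) rfl (Finset.sum_congr rfl fun t _ => ?_)
  rw [Functor.map_nsmul, Functor.map_comp, R.shift_sq, R.shift_sq]
  exact congrArg _ (R.sq_comp_congr (show a + (t : ℤ) + d = a + d + t by ring))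

theorem R.shift_mem_lowerSub (d : ℤ) {B' : ℤ → Prop} (hB : ∀ x, B' x → B (x + d)) {a b : R}
    {f : a ⟶ b} (hf : f ∈ (lowerSub B').hom a b) :
    (R.shift d).map f ∈ (lowerSub B).hom ((R.shift d).obj a) ((R.shift d).obj b) := by
  refine Subringoid.generated_le _ ((lowerSub B).comap (R.shift d)) ?_ hf
  rintro _ _ _ ⟨a, b, hab, h⟩
  change (R.shift d).map (R.sq a b) ∈ (lowerSub B).hom (R.deg (a + d)) (R.deg (b + d))
  rw [R.shift_sq]
  refine sq_mem_lowerSub ?_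
  have := hB _ h
  rwa [show a - (b - a) + d = a + d - (b + d - (a + d)) by ring] at this

theorem R.shift_comp_obj {d e : ℤ} (h : d + e = 0) (a : R) :
    (R.shift e).obj ((R.shift d).obj a) = a := by
  change R.deg (a.n + d + e) = a
  rw [add_assoc, h, add_zero]
  rfl

theorem R.sq_eqToHom {a b a' b' : ℤ} (ha : a' = a) (hb : b = b') :
    R.sq a' b' = eqToHom (congrArg R.deg ha) ≫ R.sq a b ≫ eqToHom (congrArg R.deg hb) := by
  subst ha hb
  simp

theorem eqToHom_conj_comp {C : Type*} [Category* C] {a a' b b' c c' : C} (ha : a' = a)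
    (hb : b = b') (hb' : b' = b) (hc : c = c') (f : a ⟶ b) (g : b ⟶ c) :
    (eqToHom ha ≫ f ≫ eqToHom hb) ≫ eqToHom hb' ≫ g ≫ eqToHom hc =
      eqToHom ha ≫ (f ≫ g) ≫ eqToHom hc := by
  subst ha hb hc
  simp

theorem R.shift_comp_map {d e : ℤ} (h : d + e = 0) {a b : R} (f : a ⟶ b) :
    (R.shift e).map ((R.shift d).map f) = eqToHom (R.shift_comp_obj h a) ≫ f ≫
      eqToHom (R.shift_comp_obj h b).symm := by
  refine R.induction (fun a b f => (R.shift e).map ((R.shift d).map f) =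
    eqToHom (R.shift_comp_obj h a) ≫ f ≫ eqToHom (R.shift_comp_obj h b).symm)
    ?_ ?_ ?_ ?_ f
  · intro a
    simp
  · intro a b
    simp
  · intro a b f g hf hg
    simp [hf, hg]
  · intro a b c f h' hf
    have h1 : (R.shift e).map ((R.shift d).map (R.step h')) = R.sq (b + d + e) (c + d + e) := by
      rw [← R.sq_of_lt h', R.shift_sq]
      exact R.shift_sq e _ _
    rw [Functor.map_comp, Functor.map_comp, hf, h1, ← R.sq_of_lt h',
      R.sq_eqToHom (a := b) (b := c) (show b + d + e = b by omega) (show c = c + d + e by omega)]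
    exact eqToHom_conj_comp _ _ _ _ f (R.sq b c)

end Lower

/-! #### Morphisms that become trivial after suspension -/

section SqZero

variable {B : ℤ → Prop}

/-- The square `Sq^{b-h} : h ⟶ b` for an object `b` of `R`. -/
noncomputable def R.sqTo (h : ℤ) (b : R) : R.deg h ⟶ b := R.sq h (Deg.n b)

/-- Morphisms of `R` that are congruent modulo the relations to multiples of some `Sq_0`. -/
noncomputable def sqZeroHom (B : ℤ → Prop) (a b : R) : AddSubgroup (a ⟶ b) :=
  AddSubgroup.closure {f | f ∈ relHom B a b ∨ ∃ (h : ℤ) (g : a ⟶ R.deg h), Deg.n b = 2 * h ∧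
    g ∈ (lowerSub B).hom a (R.deg h) ∧ f = g ≫ R.sqTo h b}

theorem relHom_le_sqZeroHom {a b : R} {f : a ⟶ b} (hf : f ∈ relHom B a b) :
    f ∈ sqZeroHom B a b :=
  AddSubgroup.subset_closure (Or.inl hf)

theorem comp_sq_mem_sqZeroHom {a : R} {h m : ℤ} (hm : m = 2 * h) {g : a ⟶ R.deg h}
    (hg : g ∈ (lowerSub B).hom a (R.deg h)) : g ≫ R.sq h m ∈ sqZeroHom B a (R.deg m) :=
  AddSubgroup.subset_closure (Or.inr ⟨h, g, hm, hg, rfl⟩)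

theorem sqZeroHom_comp_left {a b c : R} {f : a ⟶ b} (hf : f ∈ (lowerSub B).hom a b) {g : b ⟶ c}
    (hg : g ∈ sqZeroHom B b c) : f ≫ g ∈ sqZeroHom B a c := by
  induction hg using AddSubgroup.closure_induction with
  | mem g hg =>
    refine AddSubgroup.subset_closure ?_
    rcases hg with hg | ⟨h, g, hc, hg, rfl⟩
    · exact Or.inl (relHom_comp_left hf hg)
    · exact Or.inr ⟨h, f ≫ g, hc, (lowerSub B).comp_mem hf hg, by simp⟩
  | zero => simp
  | add g h _ _ hg hh => rw [Preadditive.comp_add]; exact add_mem hg hh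
  | neg g _ hg => rw [Preadditive.comp_neg]; exact neg_mem hg

/-- In the Adem expansion of Sq^i Sq_0 on degree h, the term Sq^{i+h-t} Sq^t has 2t ≤ i, so its left
factor is unstable unless 2t = i, when it is Sq_0. The downward closure of B keeps all squares that
occur inside the subringoid. -/
theorem sqZero_comp_sq_mem (hB : ∀ x y, x ≤ y → B y → B x) (hB0 : B 0) {h q : ℤ}
    (hq : 2 * h ≤ q) (hs : B (2 * h - (q - 2 * h))) :
    R.sq h (2 * h) ≫ R.sq (2 * h) q ∈ sqZeroHom B (R.deg h) (R.deg q) := by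
  have h0 : R.sq h (2 * h) ∈ (lowerSub B).hom (R.deg h) (R.deg (2 * h)) :=
    sq_mem_lowerSub (by convert hB0 using 1; ring)
  rcases eq_or_lt_of_le hq with rfl | hq
  · rw [R.sq_self, Category.comp_id, ← Category.id_comp (R.sq h (2 * h))]
    exact comp_sq_mem_sqZeroHom rfl ((lowerSub B).id_mem _)
  rcases lt_trichotomy (q - 2 * h) (2 * h) with hlt | heq | hgt
  · have ha : R.adem h (2 * h) q (q - 2 * h).toNat h.toNat ∈ sqZeroHom B (R.deg h) (R.deg q) :=
      relHom_le_sqZeroHom (relHom_of_rel (LowerRel.adem h (2 * h) q _ _ (by omega) (by omega)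
        (by omega) (by omega) (by convert hB0 using 1; ring) hs))
    rw [R.adem] at ha
    rw [← sub_add_cancel (R.sq h (2 * h) ≫ R.sq (2 * h) q)]
    refine add_mem ha (sum_mem fun t ht => ?_)
    simp only [Finset.mem_range] at ht
    -- A nonzero binomial coefficient forces t > i - h, so the lower index h - t of Sq^t is below
    -- that of Sq^i, for which B is known.
    rcases Nat.lt_or_ge (h.toNat - t - 1) ((q - 2 * h).toNat - 2 * t) with hc | hc
    · rw [Nat.choose_eq_zero_of_lt hc, zero_nsmul]
      exact zero_mem _
    refine nsmul_mem ?_ _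
    have hm : R.sq h (h + t) ∈ (lowerSub B).hom (R.deg h) (R.deg (h + t)) :=
      sq_mem_lowerSub (hB _ _ (by omega) hs)
    by_cases he : q = 2 * (h + t)
    · exact comp_sq_mem_sqZeroHom he hm
    · exact relHom_le_sqZeroHom (relHom_comp_left hm (relHom_of_rel
        (LowerRel.unstable _ _ (by omega) (by omega) (hB _ _ (by omega) hB0))))
  · exact comp_sq_mem_sqZeroHom (by omega) h0
  · exact relHom_le_sqZeroHom (relHom_comp_left h0 (relHom_of_rel
      (LowerRel.unstable _ _ (by omega) (by omega) hs)))

/-- Moving a square past Sq_0 (`sqZero_comp_sq_mem`) makes the left ideal of multiples of Sq_0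
two-sided. -/
theorem sqZeroHom_comp_right (hB : ∀ x y, x ≤ y → B y → B x) (hB0 : B 0) {a b c : R} {f : a ⟶ b}
    (hf : f ∈ sqZeroHom B a b) {g : b ⟶ c} (hg : g ∈ (lowerSub B).hom b c) :
    f ≫ g ∈ sqZeroHom B a c := by
  -- The morphisms that preserve `sqZeroHom` under right composition form a subringoid, so only the
  -- generating squares have to be tested.
  let S : Subringoid R :=
    { hom := fun b c =>
        { carrier := {g | ∀ ⦃a : R⦄ ⦃f : a ⟶ b⦄, f ∈ sqZeroHom B a b → f ≫ g ∈ sqZeroHom B a c}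
          zero_mem' := fun a f _ => by simp
          add_mem' := fun {g g'} hg hg' a f hf => by
            rw [Preadditive.comp_add]; exact add_mem (hg hf) (hg' hf)
          neg_mem' := fun {g} hg a f hf => by
            rw [Preadditive.comp_neg]; exact neg_mem (hg hf) }
      id_mem := fun a a' f hf => by simpa using hf
      comp_mem := fun {a b c f g} hf hg a' f' hf' => by
        rw [← Category.assoc]; exact hg (hf hf') }
  refine Subringoid.generated_le _ S ?_ hg hf
  rintro _ _ _ ⟨p, q, hpq, hs⟩ a f hf
  have hm : R.sq p q ∈ (lowerSub B).hom (R.deg p) (R.deg q) := sq_mem_lowerSub hs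
  induction hf using AddSubgroup.closure_induction with
  | mem f hf =>
    rcases hf with hf | ⟨h, g, hc, hg, rfl⟩
    · exact relHom_le_sqZeroHom (relHom_comp_right hf hm)
    · obtain rfl : p = 2 * h := hc
      rw [Category.assoc g (R.sqTo h _)]
      exact sqZeroHom_comp_left hg (sqZero_comp_sq_mem hB hB0 hpq hs)
  | zero => simp
  | add g h _ _ hg hh => rw [Preadditive.add_comp]; exact add_mem hg hh
  | neg g _ hg => rw [Preadditive.neg_comp]; exact neg_mem hg

/-- Adem relations do not depend on the degree of the source. Only instability does, and after
raising the degree by one it fails in the single borderline case Sq_0. -/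
theorem shift_relHom (hB : ∀ x y, x ≤ y → B y → B x) (hB0 : B 0) {a b : R} {f : a ⟶ b}
    (hf : f ∈ relHom (fun x => B (x + 1)) a b) :
    (R.shift 1).map f ∈ sqZeroHom B ((R.shift 1).obj a) ((R.shift 1).obj b) := by
  induction hf using AddSubgroup.closure_induction with
  | mem f hf =>
    obtain ⟨x, y, u, r, v, hu, hr, hv, rfl⟩ := hf
    rw [Functor.map_comp, Functor.map_comp]
    refine sqZeroHom_comp_left (R.shift_mem_lowerSub 1 (fun _ h => h) hu)
      (sqZeroHom_comp_right hB hB0 ?_ (R.shift_mem_lowerSub 1 (fun _ h => h) hv))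
    cases hr with
    | adem a b c i j hb hc hi hij h₁ h₂ =>
      rw [R.shift_adem]
      exact relHom_le_sqZeroHom (relHom_of_rel (LowerRel.adem _ _ _ i j (by omega) (by omega) hi hij
        (by convert h₁ using 1; ring) (by convert h₂ using 1; ring)))
    | unstable a b hab h hb =>
      rw [R.shift_sq]
      -- The inequality a < b - a becomes a + 1 ≤ b - a: equality is Sq_0 on degree a + 1, and
      -- strict inequality is again an unstable square.
      rcases eq_or_lt_of_le (show a + 1 ≤ b + 1 - (a + 1) by omega) with he | hl
      · have := comp_sq_mem_sqZeroHom (B := B) (show b + 1 = 2 * (a + 1) by omega)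
          ((lowerSub B).id_mem (R.deg (a + 1)))
        rwa [Category.id_comp] at this
      · exact relHom_le_sqZeroHom (relHom_of_rel (LowerRel.unstable _ _ (by omega) hl
          (by convert hb using 1; ring)))
  | zero => simp
  | add g h _ _ hg hh => rw [Functor.map_add]; exact add_mem hg hh
  | neg g _ hg => rw [Functor.map_neg]; exact neg_mem hg

/-- Shift back up with `shift_relHom`; the two shifts cancel up to `eqToHom`. This computes the
kernel of σ at the level of R. -/
theorem mem_sqZeroHom_of_shift (hB : ∀ x y, x ≤ y → B y → B x) (hB0 : B 0) {a b : R} {f : a ⟶ b}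
    (hf : (R.shift (-1)).map f ∈ relHom (fun x => B (x + 1)) _ _) : f ∈ sqZeroHom B a b := by
  have h := shift_relHom hB hB0 hf
  rw [R.shift_comp_map (by omega)] at h
  have h' := sqZeroHom_comp_left (eqToHom_mem_lowerSub (R.shift_comp_obj (d := -1) (e := 1)
    (by omega) a).symm) (sqZeroHom_comp_right hB hB0 h
    (eqToHom_mem_lowerSub (R.shift_comp_obj (d := -1) (e := 1) (by omega) b)))
  simpa using h'

/-- The target degree 2h determines h, so all multiples of Sq_0 in a sum share the same factor and
combine into one. -/
theorem exists_of_mem_sqZeroHom {a b : R} {f : a ⟶ b} (hf : f ∈ sqZeroHom B a b) :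
    f ∈ relHom B a b ∨ ∃ (h : ℤ) (g : a ⟶ R.deg h), Deg.n b = 2 * h ∧
      g ∈ (lowerSub B).hom a (R.deg h) ∧ f - g ≫ R.sqTo h b ∈ relHom B a b := by
  induction hf using AddSubgroup.closure_induction with
  | mem f hf =>
    rcases hf with hf | ⟨h, g, hc, hg, rfl⟩
    · exact Or.inl hf
    · exact Or.inr ⟨h, g, hc, hg, by simp⟩
  | zero => exact Or.inl (zero_mem _)
  | add f f' _ _ hf hf' =>
    rcases hf with hf | ⟨h, g, hc, hg, hf⟩ <;> rcases hf' with hf' | ⟨h', g', hc', hg', hf'⟩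
    · exact Or.inl (add_mem hf hf')
    · exact Or.inr ⟨h', g', hc', hg', by rw [add_sub_assoc]; exact add_mem hf hf'⟩
    · exact Or.inr ⟨h, g, hc, hg, by rw [add_sub_right_comm]; exact add_mem hf hf'⟩
    · obtain rfl : h = h' := by omega
      exact Or.inr ⟨h, g + g', hc, add_mem hg hg', by
        rw [Preadditive.add_comp, add_sub_add_comm]; exact add_mem hf hf'⟩
  | neg f _ hf =>
    rcases hf with hf | ⟨h, g, hc, hg, hf⟩
    · exact Or.inl (neg_mem hf)
    · refine Or.inr ⟨h, -g, hc, neg_mem hg, ?_⟩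
      rw [Preadditive.neg_comp, sub_neg_eq_add, neg_add_eq_sub, ← neg_sub]
      exact neg_mem hf

end SqZero

/-! #### Suspension in `R` and in `Q` -/

theorem Q.sigma_map {a b : R} (f : a ⟶ b) : Q.sigma.map ((Quotient.functor J.rel).map f) =
    (Quotient.functor J.rel).map ((R.shift (-1)).map f) := by
  refine R.induction (fun a b f => Q.sigma.map ((Quotient.functor J.rel).map f) =
    (Quotient.functor J.rel).map ((R.shift (-1)).map f)) ?_ ?_ ?_ ?_ f
  · intro a
    simp only [CategoryTheory.Functor.map_id]
    rfl
  · intro a b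
    simp only [Functor.map_zero]
    rfl
  · intro a b f g hf hg
    simp only [Functor.map_add, hf, hg]
    rfl
  · intro a b c f h hf
    simp only [Functor.map_comp, hf, ← R.sq_of_lt h, R.shift_sq]
    exact congrArg (_ ≫ ·) (Q.sigma_sq b c)

/-- A morphism of `Q` killed by `σ` is a multiple of `Sq_0`. -/
theorem Q.eq_comp_sqZero_of_sigma {a m : ℤ} (f : Q.deg a ⟶ Q.deg m) (hf : Q.sigma.map f = 0) :
    f = 0 ∨ ∃ (h : ℤ) (g : Q.deg a ⟶ Q.deg h), m = 2 * h ∧ f = g ≫ Q.sq h m := by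
  obtain ⟨f, rfl⟩ := (Quotient.functor J.rel).map_surjective f
  have h1 := J_le_relHom_true ((mem_J_iff _).2 ((Q.sigma_map f).symm.trans hf))
  rcases exists_of_mem_sqZeroHom (mem_sqZeroHom_of_shift (B := fun _ => True)
    (fun _ _ _ _ => trivial) trivial h1) with h | ⟨h, g, hm, -, hf⟩
  · exact Or.inl (Q.map_eq_zero _ (relHom_le_J h))
  · refine Or.inr ⟨h, (Quotient.functor J.rel).map g, hm, ?_⟩
    have := Q.map_eq_zero _ (relHom_le_J hf)
    rw [Functor.map_sub, sub_eq_zero, Functor.map_comp] at this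
    exact this


/-! ### Formal power series over a module with Steenrod operations -/

/-- The coefficient of `Sq^{i+j-t} Sq^t` in the Adem relation for `Sq^i Sq^j`. -/
def ademCoeff (i j t : ℕ) : ℕ := if 2 * t ≤ i then (j - t - 1).choose (i - 2 * t) else 0

theorem sum_adem_eq {G : Type*} [AddCommGroup G] (i j N : ℕ) (hN : i / 2 < N) (F : ℕ → G) :
    ∑ t ∈ Finset.range (i / 2 + 1), (j - t - 1).choose (i - 2 * t) • F t =
      ∑ t ∈ Finset.range N, ademCoeff i j t • F t := by
  rw [← Finset.sum_subset (Finset.range_mono (show i / 2 + 1 ≤ N by omega))]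
  · refine Finset.sum_congr rfl fun t ht => ?_
    rw [Finset.mem_range] at ht
    rw [ademCoeff, if_pos (by omega)]
  · intro t _ ht
    rw [Finset.mem_range] at ht
    rw [ademCoeff, if_neg (by omega), zero_nsmul]

/-- With n = j - t - 1 and k = i - 2t, Pascal's rule applied to C(n, k) and C(n, k-1) turns both
sides into C(n-1, k) + C(n-1, k-1) + C(n-1, k-2). The bound i + 2 ≤ 2j leaves only k = 0 when n = 0,
where truncated subtraction gives the right value. -/
theorem ademCoeff_add (i j t : ℕ) (hi : 0 < i) (hij : i + 2 ≤ 2 * j) :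
    ademCoeff i j t + ademCoeff i j (t + 1) = ademCoeff (i - 1) j t + ademCoeff i (j - 1) t := by
  by_cases h : 2 * t ≤ i
  swap
  · simp only [ademCoeff]
    rw [if_neg h, if_neg (by omega), if_neg (by omega), if_neg h]
  obtain ⟨k, rfl⟩ := Nat.exists_eq_add_of_le h
  obtain ⟨n, rfl⟩ := Nat.exists_eq_add_of_le (show t + 1 ≤ j by omega)
  simp only [ademCoeff]
  rw [if_pos h, show t + 1 + n - t - 1 = n by omega, show 2 * t + k - 2 * t = k by omega,
    show t + 1 + n - (t + 1) - 1 = n - 1 by omega, show t + 1 + n - 1 - t - 1 = n - 1 by omega,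
    show 2 * t + k - 2 * (t + 1) = k - 2 by omega, show 2 * t + k - 1 - 2 * t = k - 1 by omega]
  rcases n with _ | m
  · obtain rfl : k = 0 := by omega
    simpa using hi
  rcases k with _ | _ | l
  · rw [if_neg (by omega), if_neg (by omega)]
    simp
  · rw [if_neg (by omega), if_pos (by omega)]
    simp [add_comm]
  · rw [if_pos (by omega), if_pos (by omega), if_pos (by omega)]
    simp only [Nat.add_sub_cancel, show l + 1 + 1 - 1 = l + 1 by omega,
      show l + 1 + 1 - 2 = l by omega]
    rw [Nat.choose_succ_succ m (l + 1), Nat.choose_succ_succ m l]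
    simp only [Nat.succ_eq_add_one]
    omega

theorem ademCoeff_succ (i j t : ℕ) : ademCoeff (i + 2) (j + 1) (t + 1) = ademCoeff i j t := by
  simp only [ademCoeff]
  congr 1
  · simp only [eq_iff_iff]; omega
  · congr 1 <;> omega

theorem ademCoeff_top (j t : ℕ) (h : 0 < j) : ademCoeff (2 * j - 1) j t = 0 := by
  rw [ademCoeff]
  split_ifs with h
  · exact Nat.choose_eq_zero_of_lt (by omega)
  · rfl

/-- A family of operations on an abelian group of exponent two that satisfies the Adem relations. -/
structure IsAdem {V : Type*} [AddCommGroup V] (sq : ℤ → V →+ V) : Prop where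
  two : ∀ v : V, v + v = 0
  neg : ∀ i < 0, ∀ v, sq i v = 0
  zero : ∀ v, sq 0 v = v
  adem : ∀ i j : ℕ, 0 < i → i < 2 * j → ∀ v, sq i (sq j v) =
    ∑ t ∈ Finset.range (i / 2 + 1), (j - t - 1).choose (i - 2 * t) • sq (i + j - t) (sq t v)

section PowerSeries

variable {V : Type*} [AddCommGroup V]

/-- Removing the constant coefficient of a power series and dividing by `x`. -/
def psTail : (ℕ → V) →+ (ℕ → V) where
  toFun f r := f (r + 1)
  map_zero' := rfl
  map_add' _ _ := rfl

/-- Multiplication of a power series by `x`. -/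
def psShift : (ℕ → V) →+ (ℕ → V) where
  toFun f r := r.casesOn 0 f
  map_zero' := by ext r; cases r <;> rfl
  map_add' f g := by
    ext r
    cases r
    · exact (add_zero _).symm
    · rfl

/-- The coefficient of `x ^ r` in `Sq^i f`, where `Sq^i (x v) = x Sq^i v + x² Sq^{i-1} v`. -/
def psSqCoeff (sq : ℤ → V →+ V) : ℕ → ℤ → (ℕ → V) →+ V
  | 0, i => (sq i).comp (Pi.evalAddMonoidHom (fun _ => V) 0)
  | 1, i => (psSqCoeff sq 0 i).comp psTail
  | r + 2, i => (psSqCoeff sq (r + 1) i + psSqCoeff sq r (i - 1)).comp psTail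

/-- The Steenrod operations on power series in a variable `x` of degree one. -/
def psSq (sq : ℤ → V →+ V) (i : ℤ) : (ℕ → V) →+ (ℕ → V) where
  toFun f r := psSqCoeff sq r i f
  map_zero' := by ext r; exact map_zero _
  map_add' f g := by ext r; exact map_add _ f g

/-- The constant power series. -/
def psConst : V →+ (ℕ → V) := AddMonoidHom.single (fun _ => V) 0

variable (sq : ℤ → V →+ V)


theorem eq_const_add_shift (f : ℕ → V) : f = psConst (f 0) + psShift (psTail f) := by
  ext r
  cases r <;> simp [psConst, psShift, psTail]

theorem psSq_shift (i : ℤ) (f : ℕ → V) :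
    psSq sq i (psShift f) = psShift (psSq sq i f) + psShift (psShift (psSq sq (i - 1) f)) := by
  ext r
  rcases r with _ | _ | r
  · exact (map_zero (sq i)).trans (add_zero 0).symm
  · exact (add_zero _).symm
  · rfl

theorem psSq_const (i : ℤ) (v : V) : psSq sq i (psConst v) = psConst (sq i v) := by
  have ht : psTail (psConst v) = 0 := by
    ext r
    simp [psConst, psTail]
  ext r
  rcases r with _ | _ | r
  · simp [psSq, psSqCoeff, psConst]
  · change psSqCoeff sq 0 i (psTail (psConst v)) = _
    rw [ht, map_zero]
    simp [psConst]
  · change (psSqCoeff sq (r + 1) i + psSqCoeff sq r (i - 1)) (psTail (psConst v)) = _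
    rw [ht, map_zero]
    simp [psConst]

theorem psSqCoeff_neg (h : IsAdem sq) (r : ℕ) :
    ∀ i < 0, ∀ f, psSqCoeff sq r i f = 0 := by
  induction r using Nat.strong_induction_on with
  | _ r ih =>
    intro i hi f
    rcases r with _ | _ | r
    · exact h.neg i hi _
    · exact ih 0 (by omega) i hi _
    · change psSqCoeff sq (r + 1) i _ + psSqCoeff sq r (i - 1) _ = 0
      rw [ih (r + 1) (by omega) i hi, ih r (by omega) (i - 1) (by omega), add_zero]

theorem psSqCoeff_zero (h : IsAdem sq) (r : ℕ) : ∀ f, psSqCoeff sq r 0 f = f r := by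
  induction r using Nat.strong_induction_on with
  | _ r ih =>
    intro f
    rcases r with _ | _ | r
    · exact h.zero _
    · exact ih 0 (by omega) _
    · change psSqCoeff sq (r + 1) 0 _ + psSqCoeff sq r (0 - 1) _ = _
      rw [ih (r + 1) (by omega), psSqCoeff_neg sq h r (0 - 1) (by omega), add_zero]
      rfl

/-- The deviation from the Adem relation. -/
def psAdem (i j : ℕ) (f : ℕ → V) : ℕ → V :=
  psSq sq i (psSq sq j f) - ∑ t ∈ Finset.range (i + j + 1),
    ademCoeff i j t • psSq sq (i + j - t) (psSq sq t f)

theorem psAdem_eq (i j N : ℕ) (hN : i / 2 < N) (f : ℕ → V) :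
    psAdem sq i j f = psSq sq i (psSq sq j f) - ∑ t ∈ Finset.range N,
      ademCoeff i j t • psSq sq (i + j - t) (psSq sq t f) := by
  rw [psAdem, ← sum_adem_eq i j _ (by omega) (fun t => psSq sq (i + j - t) (psSq sq t f)),
    sum_adem_eq i j N hN]

/-- Apply the Cartan formula for x twice; the two equal terms in x³ cancel because V has exponent
two. -/
theorem psSq_psSq_shift (hV : ∀ v : V, v + v = 0) (i j : ℤ) (g : ℕ → V) :
    psSq sq i (psSq sq j (psShift g)) = psShift (psSq sq i (psSq sq j g)) +
      psShift (psShift (psSq sq (i - 1) (psSq sq j g) + psSq sq i (psSq sq (j - 1) g))) +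
      psShift (psShift (psShift (psShift (psSq sq (i - 2) (psSq sq (j - 1) g))))) := by
  have h2 : ∀ w : ℕ → V, w + w = 0 := fun w => funext fun r => hV (w r)
  simp only [psSq_shift, map_add, show i - 1 - 1 = i - 2 by ring]
  have := h2 (psShift (psShift (psShift (psSq sq (i - 1) (psSq sq (j - 1) g)))))
  rw [← sub_eq_zero]
  convert this using 1
  abel

theorem sum_shift_index {G : Type*} [AddCommGroup G] (N : ℕ) (c : ℕ → ℕ) (hc : c N = 0)
    (F : ℤ → G) (h0 : F 0 = 0) :
    ∑ t ∈ Finset.range N, c t • F t = ∑ t ∈ Finset.range N, c (t + 1) • F ((t : ℤ) + 1) := by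
  have h := Finset.sum_range_succ' (fun t => c t • F t) N
  rw [Finset.sum_range_succ] at h
  simpa [hc, h0] using h

theorem psSq_eq_zero_of_neg (h : IsAdem sq) {i : ℤ} (hi : i < 0) (f : ℕ → V) :
    psSq sq i f = 0 :=
  funext fun r => psSqCoeff_neg sq h r i hi f

theorem psSq_zero (h : IsAdem sq) (f : ℕ → V) : psSq sq 0 f = f :=
  funext fun r => psSqCoeff_zero sq h r f

theorem psAdem_shift (h : IsAdem sq) (i j : ℕ) (g : ℕ → V) :
    psAdem sq i j (psShift g) = psShift (psAdem sq i j g) +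
      psShift (psShift (psSq sq (i - 1) (psSq sq j g) + psSq sq i (psSq sq (j - 1) g) -
        ∑ t ∈ Finset.range (i + j + 1), (ademCoeff i j t + ademCoeff i j (t + 1)) •
          psSq sq (i + j - 1 - t) (psSq sq t g))) +
      psShift (psShift (psShift (psShift (psSq sq (i - 2) (psSq sq (j - 1) g) -
        ∑ t ∈ Finset.range (i + j + 1), ademCoeff i j (t + 1) •
          psSq sq (i + j - 3 - t) (psSq sq t g))))) := by
  have hN : ademCoeff i j (i + j + 1) = 0 := by rw [ademCoeff, if_neg (by omega)]
  -- Expanding Sq^t (x g) produces sums over Sq^{t-1} g. Reindexing by t + 1 costs nothing, since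
  -- Sq^{-1} = 0 and the coefficient past the end is zero.
  have e1 := sum_shift_index (i + j + 1) (ademCoeff i j) hN
    (fun t => psSq sq (i + j - t) (psSq sq (t - 1) g))
    (by simp [psSq_eq_zero_of_neg sq h (show (-1 : ℤ) < 0 by omega)])
  have e2 := sum_shift_index (i + j + 1) (ademCoeff i j) hN
    (fun t => psSq sq (i + j - t - 2) (psSq sq (t - 1) g))
    (by simp [psSq_eq_zero_of_neg sq h (show (-1 : ℤ) < 0 by omega)])
  simp only [add_sub_cancel_right, ← sub_sub] at e1 e2
  simp only [show ∀ t : ℤ, (i : ℤ) + j - t - 1 = i + j - 1 - t from fun t => by ring] at e1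
  simp only [show ∀ t : ℤ, (i : ℤ) + j - t - 1 - 2 = i + j - 3 - t from fun t => by ring] at e2
  simp only [psAdem, psSq_psSq_shift sq h.two, add_nsmul, smul_add, Finset.sum_add_distrib,
    map_add, map_sub, map_sum, map_nsmul, ← e1, ← e2]
  simp only [← map_nsmul, ← map_sum,
    show ∀ t : ℤ, (i : ℤ) + j - t - 1 = i + j - 1 - t from fun t => by ring]
  abel

/-- The x² part regroups by the Pascal identity `ademCoeff_add`, the x⁴ part by `ademCoeff_succ`.
Deviations for x g thus reduce to deviations for g. -/
theorem psAdem_shift_of_lt (h : IsAdem sq) (i j : ℕ) (hi : 0 < i) (hij : i + 2 ≤ 2 * j)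
    (g : ℕ → V) :
    psAdem sq i j (psShift g) = psShift (psAdem sq i j g) +
      psShift (psShift (psAdem sq (i - 1) j g + psAdem sq i (j - 1) g)) +
      psShift (psShift (psShift (psShift (if 2 ≤ i then psAdem sq (i - 2) (j - 1) g else 0)))) := by
  rw [psAdem_shift sq h]
  have e1 : psSq sq (i - 1) (psSq sq j g) + psSq sq i (psSq sq (j - 1) g) -
        ∑ t ∈ Finset.range (i + j + 1), (ademCoeff i j t + ademCoeff i j (t + 1)) •
          psSq sq (i + j - 1 - t) (psSq sq t g) = psAdem sq (i - 1) j g + psAdem sq i (j - 1) g := by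
    rw [psAdem_eq sq (i - 1) j (i + j + 1) (by omega), psAdem_eq sq i (j - 1) (i + j + 1) (by omega)]
    simp only [ademCoeff_add i j _ hi hij, add_nsmul, Finset.sum_add_distrib,
      Nat.cast_sub (show 1 ≤ i by omega), Nat.cast_sub (show 1 ≤ j by omega), Nat.cast_one,
      show ∀ t : ℤ, (i : ℤ) - 1 + j - t = i + j - 1 - t from fun t => by ring,
      show ∀ t : ℤ, (i : ℤ) + (j - 1) - t = i + j - 1 - t from fun t => by ring]
    abel
  have e2 : psSq sq (i - 2) (psSq sq (j - 1) g) -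
        ∑ t ∈ Finset.range (i + j + 1), ademCoeff i j (t + 1) •
          psSq sq (i + j - 3 - t) (psSq sq t g) =
      if 2 ≤ i then psAdem sq (i - 2) (j - 1) g else 0 := by
    split_ifs with hi2
    · rw [psAdem_eq sq (i - 2) (j - 1) (i + j + 1) (by omega)]
      obtain ⟨i, rfl⟩ := Nat.exists_eq_add_of_le' hi2
      obtain ⟨j, rfl⟩ := Nat.exists_eq_add_of_le' (show 1 ≤ j by omega)
      simp only [ademCoeff_succ, Nat.add_sub_cancel, Nat.cast_add, Nat.cast_one, Nat.cast_ofNat,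
        add_sub_cancel_right,
        show ∀ t : ℤ, (i : ℤ) + 2 + (j + 1) - 3 - t = i + j - t from fun t => by ring]
    · rw [psSq_eq_zero_of_neg sq h (by omega), Finset.sum_eq_zero, sub_zero]
      intro t _
      rw [ademCoeff, if_neg (by omega), zero_nsmul]
  rw [e1, e2]

/-- At i = 2j - 1 all Adem coefficients vanish and the Pascal identity is not available. Instead,
the extra term Sq^i Sq^{j-1} g is exactly the Adem expansion of Sq^{i-1} Sq^j g. -/
theorem psAdem_shift_top (h : IsAdem sq) (i j : ℕ) (hi : 0 < i) (hij : i + 1 = 2 * j)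
    (g : ℕ → V) :
    psAdem sq i j (psShift g) = psShift (psAdem sq i j g) +
      psShift (psShift (psAdem sq (i - 1) j g)) +
      psShift (psShift (psShift (psShift (if 2 ≤ i then psAdem sq (i - 2) (j - 1) g else 0)))) := by
  have h2 : ∀ w : ℕ → V, w + w = 0 := fun w => funext fun r => h.two (w r)
  rw [psAdem_shift sq h]
  have hz : ∀ t, ademCoeff i j t = 0 := fun t => by
    obtain rfl : i = 2 * j - 1 := by omega
    exact ademCoeff_top j t (by omega)
  have e1 : psSq sq (i - 1) (psSq sq j g) + psSq sq i (psSq sq (j - 1) g) -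
        ∑ t ∈ Finset.range (i + j + 1), (ademCoeff i j t + ademCoeff i j (t + 1)) •
          psSq sq (i + j - 1 - t) (psSq sq t g) = psAdem sq (i - 1) j g := by
    simp only [hz, add_zero, zero_nsmul, Finset.sum_const_zero, sub_zero]
    -- For (2j-2, j) the coefficient C(j-t-1, 2(j-1-t)) is nonzero only at t = j - 1, where it is 1.
    rw [psAdem, Finset.sum_eq_single (j - 1)]
    · rw [ademCoeff, if_pos (by omega), show i - 1 - 2 * (j - 1) = 0 by omega,
        Nat.choose_zero_right, one_nsmul, Nat.cast_sub (show 1 ≤ j by omega),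
        Nat.cast_sub (show 1 ≤ i by omega), Nat.cast_one,
        show (i : ℤ) - 1 + j - (j - 1) = i by ring, eq_sub_iff_add_eq, add_assoc, h2, add_zero]
    · intro t _ ht
      rw [ademCoeff]
      split_ifs with h3
      · rw [Nat.choose_eq_zero_of_lt (by omega), zero_nsmul]
      · exact zero_nsmul _
    · intro ht
      exact absurd (Finset.mem_range.2 (by omega)) ht
  have e2 : psSq sq (i - 2) (psSq sq (j - 1) g) -
        ∑ t ∈ Finset.range (i + j + 1), ademCoeff i j (t + 1) •
          psSq sq (i + j - 3 - t) (psSq sq t g) =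
      if 2 ≤ i then psAdem sq (i - 2) (j - 1) g else 0 := by
    simp only [hz, zero_nsmul, Finset.sum_const_zero, sub_zero]
    split_ifs with hi2
    · rw [psAdem, Finset.sum_eq_zero, sub_zero, Nat.cast_sub hi2,
        Nat.cast_sub (show 1 ≤ j by omega)]
      · rfl
      · intro t _
        rw [show i - 2 = 2 * (j - 1) - 1 by omega, ademCoeff_top _ _ (by omega), zero_nsmul]
    · exact psSq_eq_zero_of_neg sq h (by omega) _
  rw [e1, e2]

theorem psAdem_const (h : IsAdem sq) (i j : ℕ) (hi : 0 < i) (hij : i < 2 * j) (v : V) :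
    psAdem sq i j (psConst v) = 0 := by
  have e : psAdem sq i j (psConst v) = psConst (sq i (sq j v) - ∑ t ∈ Finset.range (i + j + 1),
      ademCoeff i j t • sq (i + j - t) (sq t v)) := by
    simp only [psAdem, psSq_const, map_sub, map_sum, map_nsmul]
  rw [e, h.adem i j hi hij, sum_adem_eq i j (i + j + 1) (by omega)
    (fun t => sq (i + j - t) (sq t v)), sub_self, map_zero]

theorem psAdem_zero_left (h : IsAdem sq) (j : ℕ) (f : ℕ → V) : psAdem sq 0 j f = 0 := by
  rw [psAdem_eq sq 0 j 1 (by omega)]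
  simp [psSq_zero sq h, ademCoeff]

/-- Outside the Adem range the formula becomes a tautology at i = 2j: only t = j survives, and it
gives back Sq^{2j} Sq^j. The induction meets this case when (i, j) is lowered to (i, j-1) with i =
2j - 2. -/
theorem psAdem_double (j : ℕ) (f : ℕ → V) : psAdem sq (2 * j) j f = 0 := by
  rw [psAdem, Finset.sum_eq_single j]
  · rw [ademCoeff, if_pos le_rfl, Nat.sub_self (2 * j), Nat.choose_zero_right, one_nsmul,
      show ((2 * j : ℕ) : ℤ) + j - j = (2 * j : ℕ) by ring, sub_self]
  · intro t _ ht
    rw [ademCoeff]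
    split_ifs with h3
    · rw [Nat.choose_eq_zero_of_lt (by omega), zero_nsmul]
    · exact zero_nsmul _
  · intro ht
    exact absurd (Finset.mem_range.2 (by omega)) ht

theorem psAdem_add (i j : ℕ) (f g : ℕ → V) :
    psAdem sq i j (f + g) = psAdem sq i j f + psAdem sq i j g := by
  simp only [psAdem, map_add, smul_add, Finset.sum_add_distrib]
  abel

theorem psShift_coeff_eq_zero {n : ℕ} {w : ℕ → V} (hw : ∀ s, s + 1 ≤ n → w s = 0) :
    ∀ s ≤ n, psShift w s = 0 := by
  rintro (_ | s) hs
  · rfl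
  · exact hw s hs

/-- Write f = f₀ + x g. Constants satisfy the relations because V does, and the deviation of x g
consists of deviations of g multiplied by x, x² and x⁴, so its coefficients are controlled by
earlier ones. -/
theorem psAdem_coeff_eq_zero (h : IsAdem sq) (n : ℕ) :
    ∀ r < n, ∀ i j : ℕ, i ≤ 2 * j → ∀ f, psAdem sq i j f r = 0 := by
  induction n with
  | zero => exact fun r hr => absurd hr (by omega)
  | succ n ih =>
    intro r hr i j hij f
    rcases Nat.eq_zero_or_pos i with rfl | hi
    · rw [psAdem_zero_left sq h]
      rfl
    rcases hij.eq_or_lt with rfl | hij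
    · rw [psAdem_double sq]
      rfl
    have key : ∀ a b : ℕ, a ≤ 2 * b → ∀ s, s + 1 ≤ n → psAdem sq a b (psTail f) s = 0 :=
      fun a b hab s hs => ih s (by omega) a b hab _
    have key4 : ∀ w : ℕ → V, (∀ s, s + 1 ≤ n → w s = 0) → ∀ s ≤ n,
        psShift (psShift w) s = 0 := fun w hw =>
      psShift_coeff_eq_zero fun s hs => psShift_coeff_eq_zero hw s (by omega)
    have hrn : r ≤ n := by omega
    have hZ : psShift (psShift (psShift (psShift
        (if 2 ≤ i then psAdem sq (i - 2) (j - 1) (psTail f) else 0)))) r = 0 := by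
      refine key4 _ (fun s hs => key4 _ (fun s hs => ?_) s (by omega)) r hrn
      split_ifs with hi2
      · exact key _ _ (by omega) s hs
      · rfl
    rw [eq_const_add_shift f, psAdem_add, psAdem_const sq h i j hi hij, zero_add]
    rcases Nat.lt_or_ge (i + 1) (2 * j) with hlt | hge
    · rw [psAdem_shift_of_lt sq h i j hi (by omega), Pi.add_apply, Pi.add_apply, hZ,
        psShift_coeff_eq_zero (key i j (by omega)) r hrn, key4 _ (fun s hs => ?_) r hrn]
      · simp
      · rw [Pi.add_apply, key _ _ (by omega) s hs, key _ _ (by omega) s hs, add_zero]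
    · rw [psAdem_shift_top sq h i j hi (by omega), Pi.add_apply, Pi.add_apply, hZ,
        psShift_coeff_eq_zero (key i j (by omega)) r hrn,
        key4 _ (key _ _ (by omega)) r hrn]
      simp

theorem isAdem_psSq (h : IsAdem sq) : IsAdem (psSq sq) where
  two w := funext fun r => h.two (w r)
  neg _ hi f := psSq_eq_zero_of_neg sq h hi f
  zero f := psSq_zero sq h f
  adem i j _ hij f := by
    have : psAdem sq i j f = 0 :=
      funext fun r => psAdem_coeff_eq_zero sq h (r + 1) r (by omega) i j hij.le f
    rw [psAdem, sub_eq_zero] at this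
    rw [this, sum_adem_eq i j (i + j + 1) (by omega) (fun t => psSq sq (i + j - t) (psSq sq t f))]

end PowerSeries

/-! ### Unstable modules as functors on `Q` -/

/-- Operations satisfying the Adem relations and the unstability condition with respect to
a grading. -/
structure IsUnstable {V : Type*} [AddCommGroup V] (sq : ℤ → V →+ V) (W : ℤ → AddSubgroup V) :
    Prop extends IsAdem sq where
  map_mem : ∀ a i v, v ∈ W a → sq i v ∈ W (a + i)
  unstable : ∀ a i, a < i → ∀ v ∈ W a, sq i v = 0

/-- The category with the integers as objects and the homomorphisms between the pieces of
a grading as morphisms. -/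
structure Pieces {V : Type} [AddCommGroup V] (W : ℤ → AddSubgroup V) where
  n : ℤ

section Pieces

variable {V : Type} [AddCommGroup V] {W : ℤ → AddSubgroup V}

instance : Category (Pieces W) where
  Hom X Y := W X.n →+ W Y.n
  id X := AddMonoidHom.id _
  comp f g := g.comp f

instance : Preadditive (Pieces W) where
  homGroup X Y := inferInstanceAs (AddCommGroup (W X.n →+ W Y.n))
  add_comp X Y Z (f : W X.n →+ W Y.n) (f' : W X.n →+ W Y.n) (g : W Y.n →+ W Z.n) :=
    AddMonoidHom.ext fun x => map_add g (f x) (f' x)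
  comp_add _ _ _ _ _ _ := rfl

/-- The homomorphism underlying a morphism of pieces. -/
def Pieces.toHom {X Y : Pieces W} (f : X ⟶ Y) : W X.n →+ W Y.n := f

theorem Pieces.hom_ext {X Y : Pieces W} {f g : X ⟶ Y}
    (hfg : ∀ v, (Pieces.toHom f v : V) = Pieces.toHom g v) : f = g :=
  AddMonoidHom.ext (f := Pieces.toHom f) fun v => Subtype.ext (hfg v)

theorem Pieces.toHom_add {X Y : Pieces W} (f g : X ⟶ Y) (v : W X.n) :
    Pieces.toHom (f + g) v = Pieces.toHom f v + Pieces.toHom g v := rfl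

theorem Pieces.toHom_zero {X Y : Pieces W} (v : W X.n) :
    Pieces.toHom (0 : X ⟶ Y) v = 0 := rfl

theorem Pieces.toHom_comp {X Y Z : Pieces W} (f : X ⟶ Y) (g : Y ⟶ Z) (v : W X.n) :
    Pieces.toHom (f ≫ g) v = Pieces.toHom g (Pieces.toHom f v) := rfl

theorem Pieces.toHom_nsmul {X Y : Pieces W} (n : ℕ) (f : X ⟶ Y) (v : W X.n) :
    Pieces.toHom (n • f) v = n • Pieces.toHom f v := by
  induction n with
  | zero => rw [zero_nsmul, zero_nsmul, Pieces.toHom_zero]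
  | succ n ih => rw [succ_nsmul, succ_nsmul, Pieces.toHom_add, ih]

theorem Pieces.toHom_sum {X Y : Pieces W} {ι : Type*} (s : Finset ι) (f : ι → (X ⟶ Y))
    (v : W X.n) : Pieces.toHom (∑ i ∈ s, f i) v = ∑ i ∈ s, Pieces.toHom (f i) v := by
  classical
  induction s using Finset.induction_on with
  | empty => simp [Pieces.toHom_zero]
  | insert a s ha ih => rw [Finset.sum_insert ha, Finset.sum_insert ha, Pieces.toHom_add, ih]

variable {sq : ℤ → V →+ V}

/-- The operation between two pieces of an unstable module. -/
def IsUnstable.op (h : IsUnstable sq W) (a b : ℤ) : (⟨a⟩ : Pieces W) ⟶ ⟨b⟩ :=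
  (((sq (b - a)).comp (W a).subtype).codRestrict (W b) fun v => by
    have := h.map_mem a (b - a) v v.2
    rwa [add_sub_cancel] at this : W a →+ W b)

theorem IsUnstable.op_apply (h : IsUnstable sq W) (a b : ℤ) (v : W a) :
    (Pieces.toHom (h.op a b) v : V) = sq (b - a) v := rfl

/-- The functor on `Q` given by an unstable module. -/
noncomputable def IsUnstable.functor (h : IsUnstable sq W) : Q ⥤ Pieces W :=
  Q.lift (fun X Y f => Pieces.hom_ext fun v => by
      rw [Pieces.toHom_add, Pieces.toHom_zero, AddSubgroup.coe_add, h.two]; rfl)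
    (fun n => ⟨n⟩) h.op
    (fun a => Pieces.hom_ext fun v => by
      rw [h.op_apply, sub_self, h.zero]; rfl)
    (fun a b hab => Pieces.hom_ext fun v => by
      rw [h.op_apply, h.neg _ (by omega)]; rfl)
    (fun a b c i j hb hc hi hij => Pieces.hom_ext fun v => by
      rw [Pieces.toHom_comp, Pieces.toHom_sum, h.op_apply, h.op_apply, AddSubgroup.val_finsetSum]
      rw [show c - b = i by omega, show b - a = j by omega, h.adem i j hi hij]
      refine Finset.sum_congr rfl fun t _ => ?_
      rw [Pieces.toHom_nsmul, AddSubgroup.coe_nsmul, Pieces.toHom_comp, h.op_apply, h.op_apply,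
        show a + (t : ℤ) - a = t by ring, show c - (a + t) = i + j - t by omega])
    (fun a b _ hab => Pieces.hom_ext fun v => by
      rw [h.op_apply, h.unstable a (b - a) hab v v.2]; rfl)

instance (h : IsUnstable sq W) : h.functor.Additive := by
  unfold IsUnstable.functor Q.lift
  infer_instance

/-- The action of a morphism of `Q` on an unstable module. -/
noncomputable def IsUnstable.act (h : IsUnstable sq W) {a b : ℤ} (f : Q.deg a ⟶ Q.deg b) :
    W a →+ W b := Pieces.toHom (h.functor.map f)

theorem IsUnstable.act_sq (h : IsUnstable sq W) (a b : ℤ) (v : W a) :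
    (h.act (Q.sq a b) v : V) = sq (b - a) v := by
  have : h.functor.map (Q.sq a b) = h.op a b :=
    R.lift_sq _ (fun n => (⟨n⟩ : Pieces W)) h.op (fun a => Pieces.hom_ext fun v => by
      rw [h.op_apply, sub_self, h.zero]; rfl)
    (fun a b hab => Pieces.hom_ext fun v => by
      rw [h.op_apply, h.neg _ (by omega)]; rfl) a b
  rw [IsUnstable.act, this, h.op_apply]

theorem IsUnstable.act_id (h : IsUnstable sq W) (a : ℤ) (v : W a) :
    h.act (𝟙 (Q.deg a)) v = v := by
  rw [IsUnstable.act, CategoryTheory.Functor.map_id]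
  rfl

theorem IsUnstable.act_comp (h : IsUnstable sq W) {a b c : ℤ} (f : Q.deg a ⟶ Q.deg b)
    (g : Q.deg b ⟶ Q.deg c) (v : W a) : h.act (f ≫ g) v = h.act g (h.act f v) := by
  rw [IsUnstable.act, Functor.map_comp]
  rfl

theorem IsUnstable.act_zero (h : IsUnstable sq W) {a b : ℤ} (v : W a) :
    h.act (0 : Q.deg a ⟶ Q.deg b) v = 0 := by
  rw [IsUnstable.act, Functor.map_zero]
  rfl

theorem IsUnstable.act_add (h : IsUnstable sq W) {a b : ℤ} (f g : Q.deg a ⟶ Q.deg b) (v : W a) :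
    h.act (f + g) v = h.act f v + h.act g v := by
  rw [IsUnstable.act, Functor.map_add]
  rfl

end Pieces

/-- Induction for morphisms of `Q`. -/
theorem Q.induction (P : ∀ ⦃a b : ℤ⦄, (Q.deg a ⟶ Q.deg b) → Prop) (hid : ∀ a, P (𝟙 (Q.deg a)))
    (hzero : ∀ a b, P (0 : Q.deg a ⟶ Q.deg b))
    (hadd : ∀ ⦃a b⦄ (f g : Q.deg a ⟶ Q.deg b), P f → P g → P (f + g))
    (hcomp : ∀ ⦃a b c : ℤ⦄ (f : Q.deg a ⟶ Q.deg b), b < c → P f → P (f ≫ Q.sq b c))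
    ⦃a b : ℤ⦄ (f : Q.deg a ⟶ Q.deg b) : P f := by
  have tr : ∀ {a b : ℤ} {f g : Q.deg a ⟶ Q.deg b}, f = g → P g → P f := fun h hg => h ▸ hg
  have key := R.induction
    (fun a b f => P (a := Deg.n a) (b := Deg.n b) ((Quotient.functor J.rel).map f))
    (fun a => tr ((Quotient.functor J.rel).map_id a) (hid _))
    (fun a b => tr ((Quotient.functor J.rel).map_zero a b) (hzero _ _))
    (fun a b f g hf hg => tr ((Quotient.functor J.rel).map_add) (hadd _ _ hf hg))
    (fun a b c f h hf => tr ((Quotient.functor J.rel).map_comp f (R.step h)) (by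
      rw [← R.sq_of_lt h]
      exact hcomp _ h hf))
  obtain ⟨f, rfl⟩ := (Quotient.functor J.rel).map_surjective f
  exact key f

/-- A morphism of `Q` lowering the degree is zero, and one preserving it is zero or the
identity. -/
theorem Q.hom_eq {a b : ℤ} (f : Q.deg a ⟶ Q.deg b) :
    (b < a → f = 0) ∧ ∀ h : b = a, f = 0 ∨ f = eqToHom (congrArg Q.deg h.symm) := by
  refine Q.induction (fun a b f => (b < a → f = 0) ∧
    ∀ h : b = a, f = 0 ∨ f = eqToHom (congrArg Q.deg h.symm)) ?_ ?_ ?_ ?_ f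
  · exact fun a => ⟨fun h => absurd h (by omega), fun _ => Or.inr rfl⟩
  · exact fun a b => ⟨fun _ => rfl, fun _ => Or.inl rfl⟩
  · intro a b f g hf hg
    refine ⟨fun h => by rw [hf.1 h, hg.1 h, add_zero], ?_⟩
    rintro h
    rcases hf.2 h with rfl | hf <;> rcases hg.2 h with rfl | hg
    · exact Or.inl (add_zero _)
    · exact Or.inr (by rw [zero_add, hg])
    · exact Or.inr (by rw [add_zero, hf])
    · exact Or.inl (by rw [hf, hg, Q.two])
  · intro a b c f h hf
    have : c ≤ a → f ≫ Q.sq b c = 0 := fun hca => by rw [hf.1 (by omega), zero_comp]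
    exact ⟨fun h => this h.le, fun h => Or.inl (this h.le)⟩

/-- The identity of a negative object is Sq^0 with 0 > n, an unstable square. -/
theorem Q.hom_eq_zero_of_neg {a b : ℤ} (f : Q.deg a ⟶ Q.deg b) (h : a < 0 ∨ b < 0) : f = 0 := by
  rcases h with h | h
  · rw [← Category.id_comp f, ← Q.sq_self, Q.sq_unstable (by omega), zero_comp]
  · rw [← Category.comp_id f, ← Q.sq_self, Q.sq_unstable (by omega), comp_zero]

/-! #### The identities of nonnegative degree -/

/-- The one-dimensional module in degree n detects the identity of n. Nonnegativity of n is what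
keeps Sq^0 from being unstable. -/
theorem isUnstable_trivial (n : ℤ) (hn : 0 ≤ n) :
    IsUnstable (V := ZMod 2) (fun i => if i = 0 then AddMonoidHom.id _ else 0)
      (fun m => if m = n then ⊤ else ⊥) where
  two v := by revert v; decide
  neg i hi v := by rw [if_neg (by omega)]; rfl
  zero v := by simp
  adem i j hi hij v := by
    rw [if_neg (by omega)]
    refine (Finset.sum_eq_zero fun t ht => ?_).symm
    rw [Finset.mem_range] at ht
    rw [if_neg (by omega), AddMonoidHom.zero_apply, nsmul_zero]
  map_mem a i v hv := by
    by_cases h : i = 0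
    · subst h
      simpa using hv
    · rw [if_neg h]
      exact zero_mem _
  unstable a i hai v hv := by
    by_cases h : i = 0
    · rw [if_neg (by omega), AddSubgroup.mem_bot] at hv
      rw [hv, map_zero]
    · rw [if_neg h]
      rfl

theorem Q.id_ne_zero {n : ℤ} (hn : 0 ≤ n) : 𝟙 (Q.deg n) ≠ 0 := by
  intro h
  have hu := isUnstable_trivial n hn
  have := hu.act_id n ⟨1, by simp⟩
  rw [h, hu.act_zero] at this
  exact zero_ne_one (congrArg Subtype.val this)

/-! #### The free unstable modules -/

/-- The squares acting on the product of all morphism groups with source `n`. -/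
noncomputable def freeSq (n i : ℤ) :
    (∀ m, Q.deg n ⟶ Q.deg m) →+ (∀ m, Q.deg n ⟶ Q.deg m) where
  toFun v m := v (m - i) ≫ Q.sq (m - i) m
  map_zero' := funext fun _ => zero_comp
  map_add' _ _ := funext fun _ => Preadditive.add_comp _ _ _ _ _ _

theorem freeSq_apply (n i : ℤ) (v : ∀ m, Q.deg n ⟶ Q.deg m) {p m : ℤ} (h : p = m - i) :
    freeSq n i v m = v p ≫ Q.sq p m := by
  subst h
  rfl

theorem isAdem_freeSq (n : ℤ) : IsAdem (freeSq n) where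
  two v := funext fun m => Q.two _ _ _
  neg i hi v := funext fun m => by
    rw [freeSq_apply n i v rfl, Q.sq_of_gt (by omega), comp_zero]
    rfl
  zero v := funext fun m => by
    rw [freeSq_apply n 0 v (sub_zero m).symm, Q.sq_self, Category.comp_id]
  adem i j hi hij v := funext fun m => by
    rw [freeSq_apply n i _ rfl, freeSq_apply n j v (p := m - i - j) rfl, Category.assoc,
      Q.sq_adem (m - i - j) (m - i) m i j (by omega) (by omega) hi hij, Preadditive.comp_sum,
      Finset.sum_apply]
    refine Finset.sum_congr rfl fun t _ => ?_
    rw [Pi.smul_apply, freeSq_apply n (i + j - t) _ (p := m - i - j + t) (by omega),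
      freeSq_apply n t v (p := m - i - j) (by omega), Category.assoc]
    exact map_nsmul (Preadditive.leftComp (Q.deg m) (v (m - i - j))) _ _

/-- The series `∑ x^r v_r` that are homogeneous of degree `m`. -/
noncomputable def psPiece (n m : ℤ) : AddSubgroup (ℕ → ∀ p, Q.deg n ⟶ Q.deg p) where
  carrier := {w | ∀ (r : ℕ) (p : ℤ), p ≠ m - r → w r p = 0}
  zero_mem' _ _ _ := rfl
  add_mem' hv hw r p hp := by
    rw [Pi.add_apply, Pi.add_apply, hv r p hp, hw r p hp, add_zero]
  neg_mem' hv r p hp := by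
    rw [Pi.neg_apply, Pi.neg_apply, hv r p hp, neg_zero]

theorem psTail_mem {n m : ℤ} {w : ℕ → ∀ p, Q.deg n ⟶ Q.deg p} (hw : w ∈ psPiece n m) :
    psTail w ∈ psPiece n (m - 1) :=
  fun r p hp => hw (r + 1) p (by push_cast; omega)

theorem psSqCoeff_mem (n : ℤ) (r : ℕ) : ∀ m i w, w ∈ psPiece n m → ∀ p, p ≠ m + i - r →
    psSqCoeff (freeSq n) r i w p = 0 := by
  induction r using Nat.strong_induction_on with
  | _ r ih =>
    intro m i w hw p hp
    rcases r with _ | _ | r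
    · change freeSq n i (w 0) p = 0
      rw [freeSq_apply n i _ rfl, hw 0 _ (by push_cast at hp ⊢; omega), zero_comp]
    · exact ih 0 (by omega) (m - 1) i _ (psTail_mem hw) p (by push_cast at hp ⊢; omega)
    · change psSqCoeff (freeSq n) (r + 1) i _ p + psSqCoeff (freeSq n) r (i - 1) _ p = 0
      rw [ih (r + 1) (by omega) (m - 1) i _ (psTail_mem hw) p (by push_cast at hp ⊢; omega),
        ih r (by omega) (m - 1) (i - 1) _ (psTail_mem hw) p (by push_cast at hp ⊢; omega), add_zero]

/-- In the recursion the tail has degree m - 1 and receives Sq^i and Sq^{i-1}; both exponents still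
exceed m - 1. -/
theorem psSqCoeff_unstable (n : ℤ) (r : ℕ) : ∀ m i, m < i → ∀ w ∈ psPiece n m,
    psSqCoeff (freeSq n) r i w = 0 := by
  induction r using Nat.strong_induction_on with
  | _ r ih =>
    intro m i hi w hw
    rcases r with _ | _ | r
    · change freeSq n i (w 0) = 0
      funext p
      rw [freeSq_apply n i _ rfl]
      by_cases hp : p - i = m - (0 : ℕ)
      · rw [Q.sq_unstable (by push_cast at hp; omega), comp_zero]
        rfl
      · rw [hw 0 _ hp, zero_comp]
        rfl
    · exact ih 0 (by omega) (m - 1) i (by omega) _ (psTail_mem hw)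
    · change psSqCoeff (freeSq n) (r + 1) i _ + psSqCoeff (freeSq n) r (i - 1) _ = 0
      rw [ih (r + 1) (by omega) (m - 1) i (by omega) _ (psTail_mem hw),
        ih r (by omega) (m - 1) (i - 1) (by omega) _ (psTail_mem hw), add_zero]

theorem isUnstable_psSq (n : ℤ) : IsUnstable (psSq (freeSq n)) (psPiece n) where
  toIsAdem := isAdem_psSq _ (isAdem_freeSq n)
  map_mem m i w hw r p hp := psSqCoeff_mem n r m i w hw p hp
  unstable m i hi w hw := funext fun r => psSqCoeff_unstable n r m i hi w hw

/-- This is Sq_0 (x^r v) = x^{2r} Sq_0 v, read off coefficientwise. It makes Sq_0 on series as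
injective as on the coefficients. -/
theorem psSqCoeff_sqZero (n : ℤ) (r : ℕ) : ∀ m, ∀ w ∈ psPiece n m,
    psSqCoeff (freeSq n) (2 * r) m w = freeSq n (m - r) (w r) := by
  induction r with
  | zero =>
    intro m w _
    change freeSq n m (w 0) = _
    simp
  | succ r ih =>
    intro m w hw
    change psSqCoeff (freeSq n) (2 * r + 1) m (psTail w) +
      psSqCoeff (freeSq n) (2 * r) (m - 1) (psTail w) = _
    -- The tail has degree m - 1, so Sq^m kills it and only the Sq^{m-1} summand remains.
    rw [psSqCoeff_unstable n _ (m - 1) m (by omega) _ (psTail_mem hw), zero_add,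
      ih _ _ (psTail_mem hw)]
    push_cast
    rw [show m - 1 - r = m - (r + 1) by ring]
    rfl

/-- If `Sq_0` is injective on the free module on a class of degree `n`, then it is injective on
the series over that module. -/
theorem psSq_injective (n : ℤ)
    (hn : ∀ (m : ℤ) (f : Q.deg n ⟶ Q.deg m), f ≫ Q.sq m (2 * m) = 0 → f = 0) (m : ℤ)
    (w : ℕ → ∀ p, Q.deg n ⟶ Q.deg p) (hw : w ∈ psPiece n m)
    (h : psSq (freeSq n) m w = 0) : w = 0 := by
  funext r p
  by_cases hp : p = m - r
  · subst hp
    refine hn _ _ ?_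
    have h1 := congrFun (congrFun h (2 * r)) (2 * (m - r))
    change psSqCoeff (freeSq n) (2 * r) m w (2 * (m - r)) = 0 at h1
    rwa [psSqCoeff_sqZero n r m w hw, freeSq_apply n (m - r) _ (p := m - r) (by ring)] at h1
  · exact hw r p hp

/-- The suspension morphism on morphisms between integers. -/
noncomputable def Q.desuspMap {a b : ℤ} (f : Q.deg a ⟶ Q.deg b) :
    Q.deg (a - 1) ⟶ Q.deg (b - 1) := Q.sigma.map f

/-- Constants produce only constants, and Sq^i (x v) = x Sq^i v modulo x². So the coefficient of x
transforms by the same squares in degrees lower by one, which is the action through σ. -/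
theorem psSq_act_one (n : ℤ) {a m : ℤ} (f : Q.deg a ⟶ Q.deg m) (w : psPiece n a) :
    ((isUnstable_psSq n).act f w).1 1 (m - 1) = w.1 1 (a - 1) ≫ Q.desuspMap f := by
  refine Q.induction (fun a m f => ∀ w : psPiece n a,
    ((isUnstable_psSq n).act f w).1 1 (m - 1) = w.1 1 (a - 1) ≫ Q.desuspMap f) ?_ ?_ ?_ ?_ f w
  · intro a w
    rw [IsUnstable.act_id, show Q.desuspMap (𝟙 (Q.deg a)) = 𝟙 _ from Q.sigma.map_id _,
      Category.comp_id]
  · intro a m w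
    rw [IsUnstable.act_zero, show Q.desuspMap (0 : Q.deg a ⟶ Q.deg m) = 0 from Q.sigma.map_zero _ _,
      comp_zero]
    rfl
  · intro a m f g hf hg w
    rw [IsUnstable.act_add, show Q.desuspMap (f + g) = Q.desuspMap f + Q.desuspMap g from
      Q.sigma.map_add, Preadditive.comp_add, ← hf, ← hg]
    rfl
  · intro a b c f h hf w
    rw [IsUnstable.act_comp, IsUnstable.act_sq,
      show Q.desuspMap (f ≫ Q.sq b c) = Q.desuspMap f ≫ Q.sq (b - 1) (c - 1) from
        (Q.sigma.map_comp _ _).trans (congrArg (_ ≫ ·) (Q.sigma_sq b c)),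
      ← Category.assoc, ← hf w]
    exact freeSq_apply n (c - b) _ (by ring)

/-- The map `Q(n, m) ⟶ x Q(n-1, -)[[x]]` sending the identity to `x`. -/
noncomputable def diagonal (n : ℤ) : psPiece (n - 1) n :=
  ⟨psShift (psConst (Pi.single (n - 1) (𝟙 _))), by
    rintro (_ | _ | r) p hp
    · rfl
    · change (psConst (Pi.single (n - 1) (𝟙 _)) : ℕ → ∀ p, Q.deg (n - 1) ⟶ Q.deg p) 0 p = 0
      simp only [psConst, AddMonoidHom.single_apply, Pi.single_eq_same]
      exact Pi.single_eq_of_ne (by simpa using hp) _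
    · rfl⟩

theorem act_diagonal_one (n : ℤ) {m : ℤ} (f : Q.deg n ⟶ Q.deg m) :
    ((isUnstable_psSq (n - 1)).act f (diagonal n)).1 1 (m - 1) = Q.desuspMap f := by
  rw [psSq_act_one]
  have : (diagonal n).1 1 (n - 1) = 𝟙 _ := by
    simp [diagonal, psShift, psConst]
  rw [this, Category.id_comp]

/-- Suppose that `Sq_0` is injective on `Q(n-1, -)`. Then it is injective on `Q(n, -)`. -/
theorem Q.sqZero_injective_succ (n n' : ℤ) (hn' : n' = n - 1)
    (hn : ∀ (m : ℤ) (f : Q.deg n' ⟶ Q.deg m), f ≫ Q.sq m (2 * m) = 0 → f = 0)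
    (hn0 : 0 < n) {m : ℤ} (f : Q.deg n ⟶ Q.deg m) (hf : f ≫ Q.sq m (2 * m) = 0) : f = 0 := by
  subst hn'
  -- Injectivity of Sq_0 on series over Q(n-1, -) allows a final Sq_0 to be cancelled.
  have hS : ∀ (h : ℤ) (g : Q.deg n ⟶ Q.deg h),
      (isUnstable_psSq (n - 1)).act (g ≫ Q.sq h (2 * h)) (diagonal n) = 0 →
      (isUnstable_psSq (n - 1)).act g (diagonal n) = 0 := by
    intro h g hg
    rw [IsUnstable.act_comp] at hg
    have h1 := congrArg Subtype.val hg
    rw [IsUnstable.act_sq, show 2 * h - h = h by ring] at h1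
    exact Subtype.ext (psSq_injective (n - 1) hn h _ (Subtype.prop _) h1)
  -- The map Q(n, -) ⟶ Q(n-1, -)[[x]] is injective. If f goes to zero, the coefficient of x gives
  -- σ(f) = 0, so f is zero or g ≫ Sq_0; then g also goes to zero and has half the target degree.
  have hinj : ∀ (N : ℕ) (m : ℤ), m ≤ N → ∀ f : Q.deg n ⟶ Q.deg m,
      (isUnstable_psSq (n - 1)).act f (diagonal n) = 0 → f = 0 := by
    intro N
    induction N with
    | zero =>
      intro m hm f _
      exact (Q.hom_eq f).1 (by push_cast at hm; omega)
    | succ N ih =>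
      intro m hm f hf
      have h1 := act_diagonal_one n f
      rw [hf] at h1
      rcases Q.eq_comp_sqZero_of_sigma f h1.symm with h | ⟨h, g, rfl, rfl⟩
      · exact h
      -- For h ≤ 0 the target degree 2h is below the source degree n > 0; for h > 0 the degree
      -- really drops from 2h to h.
      · rcases le_or_gt h 0 with h0 | h0
        · exact (Q.hom_eq _).1 (by omega)
        · rw [ih h (by omega) g (hS h g hf), zero_comp]
  refine hinj m.toNat m (by omega) f (hS m f ?_)
  rw [hf, IsUnstable.act_zero]

/-- `Sq_0` is injective on the free unstable modules. -/
theorem Q.sqZero_injective {n m : ℤ} (f : Q.deg n ⟶ Q.deg m) (hf : f ≫ Q.sq m (2 * m) = 0) :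
    f = 0 := by
  rcases lt_or_ge n 0 with h | h
  · exact Q.hom_eq_zero_of_neg f (Or.inl h)
  obtain ⟨n, rfl⟩ := Int.eq_ofNat_of_zero_le h
  clear h
  induction n generalizing m with
  | zero =>
    -- Q(0, -) vanishes in positive degrees: σ(f) starts at -1 and is zero, so f is zero or ends in
    -- Sq_0, and halving the degree gives the induction.
    have key : ∀ (N : ℕ) (m : ℤ), m ≤ N → 0 < m → ∀ f : Q.deg (0 : ℕ) ⟶ Q.deg m, f = 0 := by
      intro N
      induction N with
      | zero => exact fun m h1 h2 => absurd h1 (by push_cast; omega)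
      | succ N ih =>
        intro m hm hm0 f
        have h1 : Q.sigma.map f = 0 :=
          Q.hom_eq_zero_of_neg (a := (0 : ℕ) - 1) (b := m - 1) _ (Or.inl (by norm_num))
        rcases Q.eq_comp_sqZero_of_sigma f h1 with h | ⟨h, g, rfl, rfl⟩
        · exact h
        · rw [ih h (by omega) (by omega) g, zero_comp]
    rcases lt_trichotomy m 0 with h | rfl | h
    · exact Q.hom_eq_zero_of_neg f (Or.inr h)
    -- On degree zero Sq_0 is Sq^0, the identity.
    · rw [← hf]
      exact (Category.comp_id f).symm.trans (congrArg (f ≫ ·) (Q.sq_self 0).symm)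
    · exact key m.toNat m (by omega) h f
  | succ n ih =>
    exact Q.sqZero_injective_succ _ n (by push_cast; ring) (fun m g hg => ih g hg)
      (by positivity) f hf


/-! ### A presentation of `Q_k` -/

theorem shift_mem_J {a b : R} {f : a ⟶ b} (hf : f ∈ J.hom a b) :
    (R.shift (-1)).map f ∈ J.hom _ _ := by
  rw [mem_J_iff] at hf ⊢
  rw [← Q.sigma_map, hf, Functor.map_zero]
  rfl

theorem R.neg_eq {a b : R} (f : a ⟶ b) : -f = f :=
  neg_eq_of_add_eq_zero_left (R.two _ _ f)

/-- Squares of negative lower index are unstable, so modulo relations only identities remain. This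
is the case k = 0 of the presentation of Q_k. -/
theorem lowerSub_neg {a b : R} {f : a ⟶ b} (hf : f ∈ (lowerSub (· < 0)).hom a b) :
    f ∈ relHom (· < 0) a b ∨ ∃ h : a = b, f - eqToHom h ∈ relHom (· < 0) a b := by
  let S : Subringoid R :=
    { hom := fun a b =>
        { carrier := {f | f ∈ (lowerSub (· < 0)).hom a b ∧ (f ∈ relHom (· < 0) a b ∨
            ∃ h : a = b, f - eqToHom h ∈ relHom (· < 0) a b)}
          zero_mem' := ⟨zero_mem _, Or.inl (zero_mem _)⟩
          add_mem' := by
            rintro f g ⟨hf, hf'⟩ ⟨hg, hg'⟩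
            refine ⟨add_mem hf hg, ?_⟩
            rcases hf' with hf' | ⟨h, hf'⟩ <;> rcases hg' with hg' | ⟨h', hg'⟩
            · exact Or.inl (add_mem hf' hg')
            · exact Or.inr ⟨h', by rw [add_sub_assoc]; exact add_mem hf' hg'⟩
            · exact Or.inr ⟨h, by rw [add_sub_right_comm]; exact add_mem hf' hg'⟩
            · refine Or.inl ?_
              have := add_mem hf' hg'
              rwa [← add_sub_add_comm, R.two, sub_zero] at this
          neg_mem' := fun {f} hf => by
            rw [R.neg_eq f]
            exact hf }
      id_mem := fun a => ⟨Subringoid.id_mem _ _, Or.inr ⟨rfl, by simp⟩⟩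
      comp_mem := by
        rintro a b c f g ⟨hf, hf'⟩ ⟨hg, hg'⟩
        refine ⟨Subringoid.comp_mem _ hf hg, ?_⟩
        rcases hf' with hf' | ⟨rfl, hf'⟩
        · exact Or.inl (relHom_comp_right hf' hg)
        rcases hg' with hg' | ⟨rfl, hg'⟩
        · exact Or.inl (relHom_comp_left hf hg')
        refine Or.inr ⟨rfl, ?_⟩
        have := add_mem (relHom_comp_right hf' hg) hg'
        simpa using this }
  refine (Subringoid.generated_le _ S ?_ hf).2
  rintro _ _ _ ⟨a, b, hab, h⟩
  exact ⟨sq_mem_lowerSub h, Or.inl (relHom_of_rel (LowerRel.unstable a b hab (by omega) h))⟩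

theorem id_mem_relHom {B : ℤ → Prop} {n : ℤ} (hn : n < 0) (hB : B n) :
    𝟙 (R.deg n) ∈ relHom B (R.deg n) (R.deg n) := by
  rw [← R.sq_self]
  exact relHom_of_rel (LowerRel.unstable n n le_rfl (by omega) (by simpa using hB))

/-- Morphisms of `R` lowering the degree are zero. -/
theorem R.hom_eq_zero {a b : R} (f : a ⟶ b) (h : Deg.n b < Deg.n a) : f = 0 := by
  have := R.induction (fun a b f => Deg.n b < Deg.n a → f = 0)
    (fun a h => absurd h (lt_irrefl _)) (fun _ _ _ => rfl)
    (fun a b f g hf hg h => by rw [hf h, hg h, add_zero])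
    (fun a b c f h hf h' => by
      rw [hf (show b < Deg.n a from h.trans h'), zero_comp])
  exact this f h

/-- Endomorphisms in `R` are zero or the identity. -/
theorem R.end_eq {a b : R} (f : a ⟶ b) : ∀ h : b = a, f = 0 ∨ f = eqToHom h.symm := by
  refine R.induction (fun a b f => ∀ h : b = a, f = 0 ∨ f = eqToHom h.symm) ?_ ?_ ?_ ?_ f
  · exact fun a _ => Or.inr rfl
  · exact fun a b _ => Or.inl rfl
  · intro a b f g hf hg h
    rcases hf h with rfl | hf <;> rcases hg h with rfl | hg
    · exact Or.inl (add_zero _)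
    · exact Or.inr (by rw [zero_add, hg])
    · exact Or.inr (by rw [add_zero, hf])
    · exact Or.inl (by rw [hf, hg, R.two])
  · rintro a b c f h hf rfl
    exact Or.inl (by rw [R.hom_eq_zero f h, zero_comp])

theorem id_not_mem_J {n : ℤ} (hn : 0 ≤ n) : 𝟙 (R.deg n) ∉ J.hom (R.deg n) (R.deg n) := by
  rw [mem_J_iff]
  exact fun h => Q.id_ne_zero hn (((Quotient.functor J.rel).map_id _).symm.trans h)

/-- Every relation between the top `k` squares in `Q` follows from the Adem and unstability
relations between the top `k` squares. -/
theorem mem_relHom_of_mem_J (k : ℕ) : ∀ {a b : R} {f : a ⟶ b},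
    f ∈ (lowerSub (· < (k : ℤ))).hom a b → f ∈ J.hom a b → f ∈ relHom (· < (k : ℤ)) a b := by
  induction k with
  | zero =>
    intro a b f hf hJ
    rcases lowerSub_neg hf with h | ⟨rfl, h⟩
    · exact h
    · have hid : 𝟙 a ∈ J.hom a a := by
        have := sub_mem hJ (relHom_le_J h)
        simpa using this
      rcases lt_or_ge (Deg.n a) 0 with hn | hn
      · have := relHom_comp_left hf (id_mem_relHom (B := (· < ((0 : ℕ) : ℤ))) hn hn)
        exact (Category.comp_id f) ▸ this
      · exact absurd hid (id_not_mem_J hn)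
  | succ k ih =>
    have hB : ∀ x y : ℤ, x ≤ y → y < ((k + 1 : ℕ) : ℤ) → x < ((k + 1 : ℕ) : ℤ) :=
      fun x y h h' => h.trans_lt h'
    have hB0 : (0 : ℤ) < ((k + 1 : ℕ) : ℤ) := by positivity
    have hs : (fun x : ℤ => x + 1 < ((k + 1 : ℕ) : ℤ)) = (· < (k : ℤ)) := by
      funext x
      simp
    -- An inner induction on the target degree is needed because f will be replaced by a factor g of
    -- half the degree.
    have key : ∀ (N : ℕ) (a b : R), Deg.n b ≤ N → ∀ f : a ⟶ b,
        f ∈ (lowerSub (· < ((k + 1 : ℕ) : ℤ))).hom a b → f ∈ J.hom a b →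
        f ∈ relHom (· < ((k + 1 : ℕ) : ℤ)) a b := by
      intro N
      induction N with
      | zero =>
        intro a b hb f hf hJ
        rcases lt_or_ge (Deg.n a) 0 with hn | hn
        · have := relHom_comp_right
            (id_mem_relHom (B := (· < ((k + 1 : ℕ) : ℤ))) hn (by omega)) hf
          exact (Category.id_comp f) ▸ this
        rcases lt_or_ge (Deg.n b) (Deg.n a) with h | h
        · rw [R.hom_eq_zero f h]
          exact zero_mem _
        · have hab : b = a := by
            change (⟨Deg.n b⟩ : Deg) = ⟨Deg.n a⟩
            congr 1
            push_cast at hb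
            omega
          subst hab
          rcases R.end_eq f rfl with rfl | rfl
          · exact zero_mem _
          · exact absurd hJ (id_not_mem_J hn)
      | succ N ihN =>
        intro a b hb f hf hJ
        -- Lowering degrees by one lowers every lower index by one and preserves J, so the
        -- hypothesis for k applies. Shifting back puts f in `relHom` or makes it congruent to some
        -- g ≫ Sq_0.
        have h1 : (R.shift (-1)).map f ∈ relHom (fun x : ℤ => x + 1 < ((k + 1 : ℕ) : ℤ)) _ _ := by
          rw [hs]
          refine ih (R.shift_mem_lowerSub (-1) ?_ hf) (shift_mem_J hJ)
          intro x hx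
          push_cast at hx
          omega
        rcases exists_of_mem_sqZeroHom (mem_sqZeroHom_of_shift hB hB0 h1) with h | ⟨h, g, hm, hg, h2⟩
        · exact h
        -- If h ≤ 0, the target degree 2h is already covered and the inner hypothesis applies to f
        -- itself; otherwise h < 2h.
        rcases le_or_gt h 0 with h0 | h0
        · exact ihN a b (by omega) f hf hJ
        have hg0 : g ∈ J.hom a (R.deg h) := by
          have h3 := sub_mem hJ (relHom_le_J h2)
          rw [sub_sub_cancel, mem_J_iff, Functor.map_comp] at h3
          rw [mem_J_iff]
          -- Both f and f - g ≫ Sq_0 lie in J, hence so does g ≫ Sq_0, and Sq_0 can be cancelled in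
          -- Q.
          refine Q.sqZero_injective (n := Deg.n a) (m := h) ((Quotient.functor J.rel).map g) ?_
          rw [← hm]
          exact h3
        have h4 := add_mem h2 (relHom_comp_right (ihN a (R.deg h) (show h ≤ N by omega) g hg hg0)
          (sq_mem_lowerSub (B := (· < ((k + 1 : ℕ) : ℤ))) (a := h) (b := Deg.n b) (by omega)))
        exact (sub_add_cancel f (g ≫ R.sqTo h b)) ▸ h4
    intro a b f hf hJ
    exact key (Deg.n b).toNat a b (by omega) f hf hJ

/-! ### The kernel and the image of the suspension morphism -/

theorem exists_lowerSub_of_topSub {k : ℕ} {a b : R}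
    {f : (Quotient.functor J.rel).obj a ⟶ (Quotient.functor J.rel).obj b}
    (hf : f ∈ (topSub k).hom _ _) :
    ∃ g ∈ (lowerSub (· < (k : ℤ))).hom a b, (Quotient.functor J.rel).map g = f := by
  let S : Subringoid Q :=
    { hom := fun a b => ((lowerSub (· < (k : ℤ))).hom a.as b.as).map
        (Quotient.functor J.rel).mapAddHom
      id_mem := fun a => ⟨𝟙 _, Subringoid.id_mem _ _, (Quotient.functor J.rel).map_id _⟩
      comp_mem := by
        rintro a b c _ _ ⟨f, hf, rfl⟩ ⟨g, hg, rfl⟩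
        exact ⟨f ≫ g, Subringoid.comp_mem _ hf hg, (Quotient.functor J.rel).map_comp _ _⟩ }
  refine Subringoid.generated_le _ S ?_ hf
  rintro _ _ _ ⟨a, b, hab, h⟩
  exact ⟨R.sq a b, sq_mem_lowerSub h, rfl⟩

theorem topSub_of_lowerSub {k : ℕ} {a b : R} {f : a ⟶ b}
    (hf : f ∈ (lowerSub (· < (k : ℤ))).hom a b) :
    (Quotient.functor J.rel).map f ∈ (topSub k).hom
      ((Quotient.functor J.rel).obj a) ((Quotient.functor J.rel).obj b) := by
  refine Subringoid.generated_le _ ((topSub k).comap (Quotient.functor J.rel)) ?_ hf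
  rintro _ _ _ ⟨a, b, hab, h⟩
  exact Subringoid.mem_generated _ (TopSq.mk a b hab h)

/-- A morphism of `Q_{k+1}` killed by `σ` is a multiple of `Sq_0`. -/
theorem topSub_eq_comp_sqZero {k : ℕ} {a m : ℤ} {f : Q.deg a ⟶ Q.deg m}
    (hk : f ∈ (topSub (k + 1)).hom _ _) (hf : Q.sigma.map f = 0) :
    f = 0 ∨ ∃ (h : ℤ) (g : Q.deg a ⟶ Q.deg h), m = 2 * h ∧ g ∈ (topSub (k + 1)).hom _ _ ∧
      f = g ≫ Q.sq h m := by
  obtain ⟨f, hk', rfl⟩ := exists_lowerSub_of_topSub (a := R.deg a) (b := R.deg m) hk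
  -- The presentation of Q_k writes σ(f) = 0 as a consequence of relations among the top k squares
  -- alone. Lifting these relations keeps the factor g inside the top k + 1 squares.
  have h1 : (R.shift (-1)).map f ∈ relHom (fun x : ℤ => x + 1 < ((k + 1 : ℕ) : ℤ)) _ _ := by
    have hs : (fun x : ℤ => x + 1 < ((k + 1 : ℕ) : ℤ)) = (· < (k : ℤ)) := by
      funext x
      simp
    rw [hs]
    refine mem_relHom_of_mem_J k (R.shift_mem_lowerSub (-1) ?_ hk')
      ((mem_J_iff _).2 ((Q.sigma_map f).symm.trans hf))
    intro x hx
    push_cast at hx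
    omega
  rcases exists_of_mem_sqZeroHom (mem_sqZeroHom_of_shift
    (fun x y h h' => h.trans_lt h') (by positivity) h1) with h | ⟨h, g, hm, hg, h2⟩
  · exact Or.inl (Q.map_eq_zero _ (relHom_le_J h))
  · refine Or.inr ⟨h, (Quotient.functor J.rel).map g, hm, topSub_of_lowerSub hg, ?_⟩
    have := Q.map_eq_zero _ (relHom_le_J h2)
    rw [Functor.map_sub, sub_eq_zero, Functor.map_comp] at this
    exact this

/-- The suspension morphism `Q_{k+1} ⥤ Q_k` is surjective on morphisms. -/
theorem exists_sigma_eq {k : ℕ} {X Y : Q} (g : Q.sigma.obj X ⟶ Q.sigma.obj Y)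
    (hg : g ∈ (topSub k).hom _ _) : ∃ f ∈ (topSub (k + 1)).hom X Y, Q.sigma.map f = g := by
  obtain ⟨g, hg', rfl⟩ := exists_lowerSub_of_topSub (a := (R.shift (-1)).obj X.as)
    (b := (R.shift (-1)).obj Y.as) hg
  have hX := R.shift_comp_obj (d := -1) (e := 1) (by omega) X.as
  have hY := R.shift_comp_obj (d := -1) (e := 1) (by omega) Y.as
  -- The preimage is a representative of g shifted up by one: its lower indices rise from below k to
  -- below k + 1.
  refine ⟨(Quotient.functor J.rel).map (eqToHom hX.symm ≫ (R.shift 1).map g ≫ eqToHom hY), ?_, ?_⟩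
  · refine topSub_of_lowerSub (Subringoid.comp_mem _ (eqToHom_mem_lowerSub _)
      (Subringoid.comp_mem _ (R.shift_mem_lowerSub 1 ?_ hg') (eqToHom_mem_lowerSub _)))
    intro x hx
    push_cast
    omega
  · rw [Q.sigma_map]
    simp only [Functor.map_comp, R.shift_comp_map (d := 1) (e := -1) (by omega) g, eqToHom_map]
    simp
    rfl

instance (k : ℕ) : (Qk.sigma k).Full where
  map_surjective {X Y} g := by
    obtain ⟨f, hf, hfg⟩ := exists_sigma_eq g.1 g.2
    exact ⟨⟨f, hf⟩, Subtype.ext hfg⟩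

theorem Qk.sigma_obj_surjective (k : ℕ) (Y : Qk k) : ∃ X, (Qk.sigma k).obj X = Y := by
  refine ⟨⟨Q.deg (Q.val Y.as + 1)⟩, ?_⟩
  change (⟨Q.deg (Q.val Y.as + 1 - 1)⟩ : Qk k) = Y
  rw [add_sub_cancel_right]
  rfl


/-! ### Long exact sequences from dimension shifting -/

section ExtSequences

open Abelian

theorem exists_factor {A B C : Type*} [AddCommGroup A] [AddCommGroup B] [AddCommGroup C]
    (d : A →+ B) (hd : Function.Surjective d) (f : A →+ C) (h : ∀ a, d a = 0 → f a = 0) :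
    ∃ g : B →+ C, ∀ a, g (d a) = f a :=
  ⟨AddMonoidHom.liftOfSurjective d hd ⟨f, h⟩,
    fun a => AddMonoidHom.liftOfRightInverse_comp_apply _ _ (Function.rightInverse_surjInv hd) ⟨f, h⟩ a⟩

universe w v₁ u₁ v₂ u₂

variable {A : Type u₁} [Category.{v₁} A] [Abelian A] [HasExt.{w} A]
variable {B : Type u₂} [Category.{v₂} B] [Abelian B] [HasExt.{w} B]

/-- The map on `Ext` groups given by a morphism of the first variable. -/
noncomputable def extPre {X Y : A} (f : X ⟶ Y) (N : A) (s : ℕ) : Ext Y N s →+ Ext X N s :=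
  (Ext.mk₀ f).precomp N (zero_add s)

/-- The connecting homomorphism for the first variable of `Ext`. -/
noncomputable def extConn {S : ShortComplex A} (hS : S.ShortExact) (N : A) (s : ℕ) :
    Ext S.X₁ N s →+ Ext S.X₃ N (s + 1) :=
  hS.extClass.precomp N (add_comm 1 s)

theorem extPre_comp {X Y Z : A} (f : X ⟶ Y) (g : Y ⟶ Z) {N : A} {s : ℕ} (x : Ext Z N s) :
    extPre f N s (extPre g N s x) = extPre (f ≫ g) N s x := by
  simp [extPre]

theorem extPre_zero {X Y : A} {N : A} {s : ℕ} (x : Ext Y N s) :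
    extPre (0 : X ⟶ Y) N s x = 0 := by
  simp [extPre]

theorem extConn_pre {S : ShortComplex A} (hS : S.ShortExact) {N : A} {s : ℕ} (x : Ext S.X₂ N s) :
    extConn hS N s (extPre S.f N s x) = 0 := by
  simp [extPre, extConn]

theorem extPre_conn {S : ShortComplex A} (hS : S.ShortExact) {N : A} {s : ℕ} (x : Ext S.X₁ N s) :
    extPre S.g N (s + 1) (extConn hS N s x) = 0 := by
  simp [extPre, extConn]

theorem exists_extPre_f {S : ShortComplex A} (hS : S.ShortExact) {N : A} {s : ℕ}
    (x : Ext S.X₁ N s) (hx : extConn hS N s x = 0) : ∃ y, extPre S.f N s y = x :=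
  Ext.contravariant_sequence_exact₁ hS N x (add_comm 1 s) hx

theorem exists_extPre_g {S : ShortComplex A} (hS : S.ShortExact) {N : A} {s : ℕ}
    (x : Ext S.X₂ N s) (hx : extPre S.f N s x = 0) : ∃ y, extPre S.g N s y = x :=
  Ext.contravariant_sequence_exact₂ hS N x hx

theorem exists_extConn {S : ShortComplex A} (hS : S.ShortExact) {N : A} {s : ℕ}
    (x : Ext S.X₃ N (s + 1)) (hx : extPre S.g N (s + 1) x = 0) : ∃ y, extConn hS N s y = x :=
  Ext.contravariant_sequence_exact₃ hS N x hx (add_comm 1 s)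

theorem extConn_surjective {S : ShortComplex A} (hS : S.ShortExact) [Projective S.X₂] (N : A)
    (s : ℕ) : Function.Surjective (extConn hS N s) :=
  fun x => exists_extConn hS x (Ext.eq_zero_of_projective _)

theorem exists_extPre_f_of_conn {S : ShortComplex A} (hS : S.ShortExact) [Projective S.X₂] {N : A}
    {s : ℕ} (x : Ext S.X₁ N (s + 1)) (hx : extConn hS N (s + 1) x = 0) : x = 0 := by
  obtain ⟨y, rfl⟩ := exists_extPre_f hS x hx
  rw [Ext.eq_zero_of_projective y, map_zero]

/-- Dimension shifting in two categories at once. -/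
theorem exists_equiv_succ {S : ShortComplex A} (hS : S.ShortExact) [Projective S.X₂]
    {T : ShortComplex B} (hT : T.ShortExact) [Projective T.X₂] {Y : A} {N : B} {s : ℕ}
    (θ : Ext T.X₁ N s ≃+ Ext S.X₁ Y s)
    (h₁ : ∀ x, ∃ y, θ (extPre T.f N s x) = extPre S.f Y s y)
    (h₂ : ∀ y, ∃ x, θ (extPre T.f N s x) = extPre S.f Y s y) :
    Nonempty (Ext T.X₃ N (s + 1) ≃+ Ext S.X₃ Y (s + 1)) := by
  -- With projective middle terms, Ext^{s+1} of the third term is the cokernel of Ext^s(X₂) ⟶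
  -- Ext^s(X₁), also for s = 0. The hypotheses `h₁` and `h₂` say that θ matches the two images,
  -- which is all that is needed.
  obtain ⟨g, hg⟩ := exists_factor (extConn hT N s) (extConn_surjective hT N s)
    ((extConn hS Y s).comp θ.toAddMonoidHom) (by
      intro x hx
      obtain ⟨x, rfl⟩ := exists_extPre_f hT x hx
      obtain ⟨y, hy⟩ := h₁ x
      change extConn hS Y s (θ _) = 0
      rw [hy, extConn_pre])
  refine ⟨AddEquiv.ofBijective g ⟨?_, ?_⟩⟩
  · rw [injective_iff_map_eq_zero]
    intro z hz
    obtain ⟨x, rfl⟩ := extConn_surjective hT N s z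
    rw [hg] at hz
    obtain ⟨y, hy⟩ := exists_extPre_f hS _ hz
    obtain ⟨x', hx'⟩ := h₂ y
    obtain rfl : extPre T.f N s x' = x := θ.injective (hx'.trans hy)
    exact extConn_pre hT x'
  · intro z
    obtain ⟨y, rfl⟩ := extConn_surjective hS Y s z
    refine ⟨extConn hT N s (θ.symm y), ?_⟩
    rw [hg]
    change extConn hS Y s (θ (θ.symm y)) = _
    rw [AddEquiv.apply_symm_apply]

/-- The long exact sequence obtained from a short exact sequence `0 ⟶ K ⟶ P ⟶ M ⟶ 0` in `A`, an
exact sequence `0 ⟶ W ⟶ K' ⟶ P' ⟶ C ⟶ 0` in `B` with image `I` in the middle, and compatible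
isomorphisms between the `Ext` groups of `K` and `K'`. -/
theorem exists_long_exact {S : ShortComplex A} (hS : S.ShortExact) [Projective S.X₂]
    {W K' I P' C : B} {w : W ⟶ K'} {q : K' ⟶ I} {p : I ⟶ P'} {c : P' ⟶ C} {hwq : w ≫ q = 0}
    {hpc : p ≫ c = 0} (hT₁ : (ShortComplex.mk w q hwq).ShortExact)
    (hT₂ : (ShortComplex.mk p c hpc).ShortExact) [Projective P'] {Y : A} {N : B}
    (θ : ∀ s, Ext K' N s ≃+ Ext S.X₁ Y s)
    (h₁ : ∀ s x, ∃ y, θ s (extPre (q ≫ p) N s x) = extPre S.f Y s y)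
    (h₂ : ∀ s y, ∃ x, θ s (extPre (q ≫ p) N s x) = extPre S.f Y s y)
    (E₀ : Ext C N 0 →+ Ext S.X₃ Y 0) :
    ∃ (E : ∀ s : ℕ, Ext C N s →+ Ext S.X₃ Y s)
      (H : ∀ s : ℕ, Ext S.X₃ Y (s + 1) →+ Ext W N s)
      (P : ∀ s : ℕ, Ext W N s →+ Ext C N (s + 2)),
      E 0 = E₀ ∧ Function.Injective (E 1) ∧
      ∀ s : ℕ, Function.Exact (E (s + 1)) (H s) ∧ Function.Exact (H s) (P s) ∧
        Function.Exact (P s) (E (s + 2)) := by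
  have : Projective (ShortComplex.mk p c hpc).X₂ := ‹Projective P'›
  -- Ext^{s+1}(C, N) is the cokernel of restriction along p, and restriction along q followed by θ
  -- carries it to the cokernel that is Ext^{s+1}(S.X₃, Y).
  have hE : ∀ s, ∃ g : Ext C N (s + 1) →+ Ext S.X₃ Y (s + 1),
      ∀ z, g (extConn hT₂ N s z) = extConn hS Y s (θ s (extPre q N s z)) := fun s =>
    exists_factor (extConn hT₂ N s) (extConn_surjective hT₂ N s)
      ((extConn hS Y s).comp ((θ s).toAddMonoidHom.comp (extPre q N s))) (by
        intro z hz
        obtain ⟨x, rfl⟩ := exists_extPre_f hT₂ z hz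
        obtain ⟨y, hy⟩ := h₁ s x
        change extConn hS Y s (θ s (extPre q N s (extPre p N s x))) = 0
        rw [extPre_comp, hy, extConn_pre])
  -- Restriction along w after θ⁻¹ descends: the image of Ext^s(S.X₂, Y) corresponds under θ to
  -- classes restricted along q ≫ p, and w ≫ q = 0.
  have hH : ∀ s, ∃ g : Ext S.X₃ Y (s + 1) →+ Ext W N s,
      ∀ y, g (extConn hS Y s y) = extPre w N s ((θ s).symm y) := fun s =>
    exists_factor (extConn hS Y s) (extConn_surjective hS Y s)
      ((extPre w N s).comp (θ s).symm.toAddMonoidHom) (by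
        intro y hy
        obtain ⟨y, rfl⟩ := exists_extPre_f hS y hy
        obtain ⟨x, hx⟩ := h₂ s y
        change extPre w N s ((θ s).symm (extPre S.f Y s y)) = 0
        rw [← hx, AddEquiv.symm_apply_apply, extPre_comp, ← Category.assoc, hwq, zero_comp,
          extPre_zero])
  choose E hE using hE
  choose H hH using hH
  -- The descended map `E s` lives in degree s + 1, whence the shift by one; the third map is the
  -- composite of the two connecting homomorphisms.
  refine ⟨fun s => Nat.casesOn s E₀ E, H,
    fun s => (extConn hT₂ N (s + 1)).comp (extConn hT₁ N s), rfl, ?_, fun s => ⟨?_, ?_, ?_⟩⟩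
  · change Function.Injective (E 0)
    rw [injective_iff_map_eq_zero]
    intro z hz
    obtain ⟨z, rfl⟩ := extConn_surjective hT₂ N 0 z
    rw [hE] at hz
    obtain ⟨y, hy⟩ := exists_extPre_f hS _ hz
    obtain ⟨x, hx⟩ := h₂ 0 y
    have h3 := (θ 0).injective (hx.trans hy)
    rw [← extPre_comp] at h3
    -- In degree zero, restriction along an epimorphism is injective; this is what makes the degree
    -- one map injective.
    have : Epi q := hT₁.epi_g
    obtain rfl := Ext.precomp_mk₀_injective_of_epi N q h3
    exact extConn_pre hT₂ x
  · change Function.Exact (E s) (H s)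
    intro d
    constructor
    · intro hd
      obtain ⟨y, rfl⟩ := extConn_surjective hS Y s d
      rw [hH] at hd
      obtain ⟨z, hz⟩ := exists_extPre_g hT₁ _ hd
      refine ⟨extConn hT₂ N s z, ?_⟩
      rw [hE]
      rw [show extPre q N s z = _ from hz, AddEquiv.apply_symm_apply]
    · rintro ⟨z, rfl⟩
      obtain ⟨z, rfl⟩ := extConn_surjective hT₂ N s z
      rw [hE, hH, AddEquiv.symm_apply_apply, extPre_comp, hwq, extPre_zero]
  · intro x
    constructor
    · intro hx
      obtain ⟨k, hk⟩ := exists_extPre_f hT₁ x (exists_extPre_f_of_conn hT₂ _ hx)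
      refine ⟨extConn hS Y s (θ s k), ?_⟩
      rw [hH, AddEquiv.symm_apply_apply]
      exact hk
    · rintro ⟨d, rfl⟩
      obtain ⟨y, rfl⟩ := extConn_surjective hS Y s d
      rw [hH]
      change extConn hT₂ N (s + 1) (extConn hT₁ N s _) = 0
      rw [extConn_pre hT₁, map_zero]
  · change Function.Exact _ (E (s + 1))
    intro d
    constructor
    · intro hd
      obtain ⟨z, rfl⟩ := extConn_surjective hT₂ N (s + 1) d
      rw [hE] at hd
      have h3 := exists_extPre_f_of_conn hS _ hd
      rw [map_eq_zero_iff _ (θ (s + 1)).injective] at h3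
      obtain ⟨x, hx⟩ := exists_extConn hT₁ z h3
      exact ⟨x, congrArg (extConn hT₂ N (s + 1)) hx⟩
    · rintro ⟨x, rfl⟩
      change E (s + 1) (extConn hT₂ N (s + 1) (extConn hT₁ N s x)) = 0
      rw [hE]
      rw [extPre_conn hT₁, map_zero, map_zero]

end ExtSequences

/-! ### Abstract suspension functors: the loop adjunction, the snake lemma for λ, and comparison of
Ext. -/

section LoopSequence

open Abelian

universe w v₁ u₁ v₂ u₂

variable {A : Type u₁} [Category.{v₁} A] [Abelian A] {B : Type u₂} [Category.{v₂} B] [Abelian B]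

/-- An exact sequence `0 ⟶ W ⟶ K ⟶ P ⟶ C ⟶ 0` is spliced from two short exact sequences. -/
theorem exists_splice {W K P C : B} (w : W ⟶ K) (j : K ⟶ P) (c : P ⟶ C) (hwj : w ≫ j = 0)
    (hjc : j ≫ c = 0) (hw : Mono w) (hc : Epi c) (e₁ : (ShortComplex.mk w j hwj).Exact)
    (e₂ : (ShortComplex.mk j c hjc).Exact) :
    ∃ (I : B) (q : K ⟶ I) (p : I ⟶ P) (hwq : w ≫ q = 0) (hpc : p ≫ c = 0), q ≫ p = j ∧
      (ShortComplex.mk w q hwq).ShortExact ∧ (ShortComplex.mk p c hpc).ShortExact := by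
  have hq : kernel.lift c j hjc ≫ kernel.ι c = j := kernel.lift_ι _ _ _
  have hwq : w ≫ kernel.lift c j hjc = 0 := by
    rw [← cancel_mono (kernel.ι c), Category.assoc, hq, hwj, zero_comp]
  have hepi : Epi (kernel.lift c j hjc) := e₂.epi_kernelLift
  let φ : ShortComplex.mk w (kernel.lift c j hjc) hwq ⟶ ShortComplex.mk w j hwj :=
    { τ₁ := 𝟙 _
      τ₂ := 𝟙 _
      τ₃ := kernel.ι c
      comm₁₂ := by simp
      comm₂₃ := by simp }
  have : Epi φ.τ₁ := inferInstanceAs (Epi (𝟙 W))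
  have : IsIso φ.τ₂ := inferInstanceAs (IsIso (𝟙 K))
  have : Mono φ.τ₃ := inferInstanceAs (Mono (kernel.ι c))
  exact ⟨kernel c, kernel.lift c j hjc, kernel.ι c, hwq, kernel.condition c, hq,
    { exact := (ShortComplex.exact_iff_of_epi_of_isIso_of_mono φ).2 e₁
      mono_f := hw
      epi_g := hepi },
    { exact := ShortComplex.exact_kernel c
      mono_f := inferInstance
      epi_g := hc }⟩

/-- A suspension functor `F` together with a natural map `Φ M ⟶ M` whose kernel and cokernel are
suspensions. -/
structure SuspensionData (F : B ⥤ A) [F.Additive] where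
  exact_of_map : ∀ S : ShortComplex B, (S.map F).Exact → S.Exact
  epi_map : ∀ {X Y : B} (f : X ⟶ Y), Epi f → Epi (F.map f)
  Φ : A ⥤ A
  [additive : Φ.Additive]
  exact_Φ : ∀ S : ShortComplex A, S.Exact → (S.map Φ).Exact
  epi_Φ : ∀ {X Y : A} (f : X ⟶ Y), Epi f → Epi (Φ.map f)
  mono_Φ : ∀ {X Y : A} (f : X ⟶ Y), Mono f → Mono (Φ.map f)
  lam : Φ ⟶ 𝟭 A
  lam_susp : ∀ N : B, lam.app (F.obj N) = 0
  loop : A → B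
  loopOne : A → B
  loopIso : ∀ X, F.obj (loop X) ≅ cokernel (lam.app X)
  loopOneIso : ∀ X, F.obj (loopOne X) ≅ kernel (lam.app X)
  resolve : ∀ X, ∃ (P : A) (g : P ⟶ X), Projective P ∧ Mono (lam.app P) ∧ Epi g

namespace SuspensionData

variable {F : B ⥤ A} [F.Additive] (D : SuspensionData F)

instance : D.Φ.Additive := D.additive

/-- The unit `X ⟶ ΣΩX`. -/
noncomputable def unit (X : A) : X ⟶ F.obj (D.loop X) :=
  cokernel.π (D.lam.app X) ≫ (D.loopIso X).inv

instance (X : A) : Epi (D.unit X) := by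
  unfold unit
  infer_instance

theorem lam_unit (X : A) : D.lam.app X ≫ D.unit X = 0 := by
  rw [unit, cokernel.condition_assoc, zero_comp]

/-- The unit is a cokernel of `λ`. -/
noncomputable def unitIsColimit (X : A) :
    IsColimit (CokernelCofork.ofπ (D.unit X) (D.lam_unit X)) :=
  cokernel.cokernelIso _ _ (D.loopIso X).symm rfl

/-- Naturality of λ at f, together with λ = 0 on suspensions, shows that f kills the image of λ_X,
so f factors through its cokernel. -/
theorem exists_desc {X : A} {N : B} (f : X ⟶ F.obj N) :
    ∃ g : F.obj (D.loop X) ⟶ F.obj N, D.unit X ≫ g = f := by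
  have h : D.lam.app X ≫ f = 0 := by
    have := D.lam.naturality f
    rw [D.lam_susp, comp_zero] at this
    exact this.symm
  exact ⟨(D.unitIsColimit X).desc (CokernelCofork.ofπ f h),
    (D.unitIsColimit X).fac (CokernelCofork.ofπ f h) WalkingParallelPair.one⟩

/-- A projective presentation with `λ` a monomorphism. -/
theorem exists_presentation (X : A) : ∃ (S : ShortComplex A), S.X₃ = X ∧ S.ShortExact ∧
    Projective S.X₂ ∧ Mono (D.lam.app S.X₁) ∧ Mono (D.lam.app S.X₂) := by
  obtain ⟨P, g, hP, hm, hg⟩ := D.resolve X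
  refine ⟨ShortComplex.mk (kernel.ι g) g (kernel.condition g), rfl,
    { exact := ShortComplex.exact_kernel g
      mono_f := inferInstance
      epi_g := hg }, hP, ?_, hm⟩
  -- λ on the kernel followed by the inclusion equals Φ of the inclusion followed by λ_P, a
  -- composite of monomorphisms. So λ is mono on the syzygy too.
  have h := D.lam.naturality (kernel.ι g)
  have := D.mono_Φ (kernel.ι g) inferInstance
  have : Mono (D.lam.app (kernel g) ≫ (𝟭 A).map (kernel.ι g)) := by
    rw [← h]
    exact mono_comp _ _
  exact mono_of_mono _ ((𝟭 A).map (kernel.ι g))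

variable [F.Full] [F.Faithful]

/-- `Ω` is left adjoint to the suspension. -/
noncomputable def homEquiv (X : A) (N : B) : (D.loop X ⟶ N) ≃+ (X ⟶ F.obj N) :=
  AddEquiv.ofBijective
    ({ toFun g := D.unit X ≫ F.map g
       map_zero' := by simp
       map_add' := by simp } : (D.loop X ⟶ N) →+ (X ⟶ F.obj N)) (by
    constructor
    · intro g g' h
      exact F.map_injective ((cancel_epi (D.unit X)).1 h)
    · intro f
      obtain ⟨g, rfl⟩ := D.exists_desc f
      exact ⟨F.preimage g, congrArg (D.unit X ≫ ·) (F.map_preimage g)⟩)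

theorem homEquiv_apply {X : A} {N : B} (g : D.loop X ⟶ N) :
    D.homEquiv X N g = D.unit X ≫ F.map g := rfl

/-- The functoriality of `Ω`. -/
noncomputable def loopMap {X Y : A} (f : X ⟶ Y) : D.loop X ⟶ D.loop Y :=
  (D.homEquiv X (D.loop Y)).symm (f ≫ D.unit Y)

theorem unit_loopMap {X Y : A} (f : X ⟶ Y) :
    D.unit X ≫ F.map (D.loopMap f) = f ≫ D.unit Y := by
  rw [← homEquiv_apply, loopMap, AddEquiv.apply_symm_apply]

theorem loopMap_comp_zero {X Y Z : A} (f : X ⟶ Y) (g : Y ⟶ Z) (h : f ≫ g = 0) :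
    D.loopMap f ≫ D.loopMap g = 0 := by
  apply (D.homEquiv _ _).injective
  rw [homEquiv_apply, Functor.map_comp, ← Category.assoc, D.unit_loopMap, Category.assoc,
    D.unit_loopMap, ← Category.assoc, h, zero_comp, map_zero]

/-- A left adjoint of a functor that preserves epimorphisms preserves projectives. -/
theorem projective_loop (P : A) [Projective P] : Projective (D.loop P) where
  factors {E X} f e he := by
    have := D.epi_map e he
    refine ⟨(D.homEquiv _ _).symm (Projective.factorThru (D.unit P ≫ F.map f) (F.map e)), ?_⟩
    apply (D.homEquiv _ _).injective
    rw [homEquiv_apply, Functor.map_comp, ← Category.assoc, ← homEquiv_apply,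
      AddEquiv.apply_symm_apply, Projective.factorThru_comp, homEquiv_apply]

/-- The morphism of short complexes given by `λ`. -/
noncomputable def lamComplex (S : ShortComplex A) : S.map D.Φ ⟶ S where
  τ₁ := D.lam.app _
  τ₂ := D.lam.app _
  τ₃ := D.lam.app _
  comm₁₂ := (D.lam.naturality _).symm
  comm₂₃ := (D.lam.naturality _).symm

/-- The complex of the suspended loop objects. -/
noncomputable def loopComplex (S : ShortComplex A) : ShortComplex B :=
  ShortComplex.mk (D.loopMap S.f) (D.loopMap S.g) (D.loopMap_comp_zero _ _ S.zero)

/-- The units of the objects of a complex. -/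
noncomputable def unitComplex (S : ShortComplex A) : S ⟶ (D.loopComplex S).map F where
  τ₁ := D.unit _
  τ₂ := D.unit _
  τ₃ := D.unit _
  comm₁₂ := D.unit_loopMap _
  comm₂₃ := D.unit_loopMap _

/-- The snake diagram of `λ`. -/
noncomputable def snake {S : ShortComplex A} (hS : S.ShortExact) :
    ShortComplex.SnakeInput A where
  L₀ := kernel (D.lamComplex S)
  L₁ := S.map D.Φ
  L₂ := S
  L₃ := (D.loopComplex S).map F
  v₀₁ := kernel.ι _
  v₁₂ := D.lamComplex S
  v₂₃ := D.unitComplex S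
  w₀₂ := kernel.condition _
  w₁₃ := by
    ext
    · exact D.lam_unit _
    · exact D.lam_unit _
    · exact D.lam_unit _
  h₀ := kernelIsKernel _
  h₃ := ShortComplex.isColimitOfIsColimitπ _
    ((isColimitMapCoconeCoforkEquiv' ShortComplex.π₁ _).symm (D.unitIsColimit S.X₁))
    ((isColimitMapCoconeCoforkEquiv' ShortComplex.π₂ _).symm (D.unitIsColimit S.X₂))
    ((isColimitMapCoconeCoforkEquiv' ShortComplex.π₃ _).symm (D.unitIsColimit S.X₃))
  L₁_exact := D.exact_Φ S hS.exact
  epi_L₁_g := D.epi_Φ S.g hS.epi_g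
  L₂_exact := hS.exact
  mono_L₂_f := hS.mono_f

/-- The exact sequence `0 ⟶ Ω₁ S.X₃ ⟶ Ω S.X₁ ⟶ Ω S.X₂ ⟶ Ω S.X₃ ⟶ 0` if `λ` is a monomorphism
on `S.X₂`. -/
theorem exists_loop_exact {S : ShortComplex A} (hS : S.ShortExact) (hm : Mono (D.lam.app S.X₂)) :
    ∃ (w : D.loopOne S.X₃ ⟶ D.loop S.X₁) (hw : w ≫ D.loopMap S.f = 0), Mono w ∧
      Epi (D.loopMap S.g) ∧ (ShortComplex.mk w (D.loopMap S.f) hw).Exact ∧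
      (D.loopComplex S).Exact := by
  let T := D.snake hS
  -- λ is mono on the middle object, so the middle kernel vanishes and the connecting map embeds ker
  -- λ at `S.X₃`, the suspension of Ω₁.
  have hz : IsZero T.L₀.X₂ := by
    have h1 : T.v₀₁.τ₂ = 0 := (cancel_mono (D.lam.app S.X₂)).1 (T.w₀₂_τ₂.trans zero_comp.symm)
    have h2 : Mono T.v₀₁.τ₂ := mono_of_isLimit_fork T.h₀τ₂
    rw [IsZero.iff_id_eq_zero, ← cancel_mono T.v₀₁.τ₂, h1, comp_zero, comp_zero]
  obtain ⟨δ, hδ, hδf, hex⟩ : ∃ (δ : T.L₀.X₃ ⟶ F.obj (D.loop S.X₁)) (_ : Mono δ)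
      (hδf : δ ≫ F.map (D.loopMap S.f) = 0),
      (ShortComplex.mk δ (F.map (D.loopMap S.f)) hδf).Exact :=
    ⟨T.δ, T.mono_δ hz, T.δ_L₃_f, T.L₂'_exact⟩
  let e : F.obj (D.loopOne S.X₃) ≅ T.L₀.X₃ :=
    D.loopOneIso S.X₃ ≪≫ (limit.isLimit _).conePointUniqueUpToIso T.h₀τ₃
  have hw : F.map (F.preimage (e.hom ≫ δ)) = e.hom ≫ δ := F.map_preimage _
  have h0 : F.preimage (e.hom ≫ δ) ≫ D.loopMap S.f = 0 := by
    apply F.map_injective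
    rw [Functor.map_comp, hw, Category.assoc, hδf, comp_zero, Functor.map_zero]
  refine ⟨F.preimage (e.hom ≫ δ), h0, ?_, ?_, ?_, D.exact_of_map _ T.L₃_exact⟩
  · apply F.mono_of_mono_map
    rw [hw]
    exact mono_comp _ _
  · apply F.epi_of_epi_map
    have := hS.epi_g
    have h : Epi (D.unit S.X₂ ≫ F.map (D.loopMap S.g)) := by
      rw [D.unit_loopMap]
      exact epi_comp _ _
    exact epi_of_epi (D.unit S.X₂) _
  · apply D.exact_of_map
    refine ShortComplex.exact_of_iso ?_ hex
    exact ShortComplex.isoMk e.symm (Iso.refl _) (Iso.refl _)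
      (by
        change e.inv ≫ F.map (F.preimage (e.hom ≫ δ)) = δ ≫ 𝟙 _
        rw [hw, e.inv_hom_id_assoc, Category.comp_id])
      ((Category.id_comp _).trans (Category.comp_id _).symm)

/-! ### Comparison of Ext groups along the loop adjunction. -/

variable [HasExt.{w} A] [HasExt.{w} B]

/-- The adjunction isomorphism on `Ext` groups of degree zero. -/
noncomputable def extZeroEquiv (X : A) (N : B) :
    Ext (D.loop X) N 0 ≃+ Ext X (F.obj N) 0 :=
  Ext.addEquiv₀.trans ((D.homEquiv X N).trans Ext.addEquiv₀.symm)

theorem extZeroEquiv_mk₀ {X : A} {N : B} (g : D.loop X ⟶ N) :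
    D.extZeroEquiv X N (Ext.mk₀ g) = Ext.mk₀ (D.unit X ≫ F.map g) := by
  have h : Ext.addEquiv₀ (Ext.mk₀ g) = g := Ext.addEquiv₀.apply_symm_apply g
  change Ext.addEquiv₀.symm (D.homEquiv X N (Ext.addEquiv₀ (Ext.mk₀ g))) = _
  rw [h, homEquiv_apply]
  rfl

theorem extZeroEquiv_natural {X Y : A} (f : X ⟶ Y) {N : B} (x : Ext (D.loop Y) N 0) :
    D.extZeroEquiv X N (extPre (D.loopMap f) N 0 x) =
      extPre f (F.obj N) 0 (D.extZeroEquiv Y N x) := by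
  obtain ⟨g, rfl⟩ := (Ext.mk₀_bijective _ _).2 x
  rw [extZeroEquiv_mk₀]
  simp only [extPre, Ext.bilinearComp_apply_apply, Ext.mk₀_comp_mk₀]
  rw [extZeroEquiv_mk₀, Functor.map_comp, ← Category.assoc, D.unit_loopMap, Category.assoc]

/-- If `λ_X` is a monomorphism, then the adjunction isomorphism extends to all `Ext` groups. -/
theorem exists_extEquiv (N : B) (s : ℕ) : ∀ X : A, Mono (D.lam.app X) →
    ∃ θ : Ext (D.loop X) N s ≃+ Ext X (F.obj N) s, ∀ (P : A), Projective P → ∀ f : X ⟶ P,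
      (∀ x, ∃ y, θ (extPre (D.loopMap f) N s x) = extPre f (F.obj N) s y) ∧
      (∀ y, ∃ x, θ (extPre (D.loopMap f) N s x) = extPre f (F.obj N) s y) := by
  -- The compatibility carried along concerns only images of restriction maps from projectives. This
  -- is exactly what `exists_equiv_succ` and `exists_long_exact` consume, so no naturality of θ in
  -- positive degrees has to be shown.
  induction s with
  | zero =>
    intro X _
    refine ⟨D.extZeroEquiv X N, fun P _ f => ⟨fun x => ⟨_, D.extZeroEquiv_natural f x⟩, fun y =>
      ⟨(D.extZeroEquiv P N).symm y, ?_⟩⟩⟩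
    rw [D.extZeroEquiv_natural, AddEquiv.apply_symm_apply]
  | succ s ih =>
    intro X hX
    obtain ⟨S, rfl, hS, hP, hm₁, hm₂⟩ := D.exists_presentation X
    obtain ⟨θ, hθ⟩ := ih S.X₁ hm₁
    obtain ⟨w, hw, _, hepi, he₁, he₂⟩ := D.exists_loop_exact hS hm₂
    -- Since λ is mono on `S.X₃`, its Ω₁ vanishes, and Ω keeps the presentation short exact.
    have hw0 : w = 0 := by
      have h : IsZero (kernel (D.lam.app S.X₃)) := isZero_kernel_of_mono _
      exact F.map_injective ((h.of_iso (D.loopOneIso S.X₃)).eq_of_src _ _)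
    have hT : (D.loopComplex S).ShortExact :=
      { exact := he₂
        mono_f := ((ShortComplex.mk w (D.loopMap S.f) hw).exact_iff_mono hw0).1 he₁
        epi_g := hepi }
    have : Projective (D.loopComplex S).X₂ := D.projective_loop S.X₂
    obtain ⟨θ'⟩ : Nonempty (Ext (D.loop S.X₃) N (s + 1) ≃+ Ext S.X₃ (F.obj N) (s + 1)) :=
      exists_equiv_succ hS hT θ (hθ S.X₂ hP S.f).1 (hθ S.X₂ hP S.f).2
    -- In positive degrees the Ext groups of P and of ΩP vanish, so both images are zero.
    refine ⟨θ', fun P hP f => ⟨fun x => ⟨0, ?_⟩, fun y => ⟨0, ?_⟩⟩⟩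
    · have := D.projective_loop P
      rw [Ext.eq_zero_of_projective x, map_zero, map_zero, map_zero]
    · rw [Ext.eq_zero_of_projective y, map_zero, map_zero, map_zero]

/-- The long exact sequence relating the `Ext` groups of `M`, `ΩM` and `Ω₁M`. -/
theorem exists_ext_sequence (M : A) (N : B) :
    ∃ (E : ∀ s : ℕ, Ext (D.loop M) N s →+ Ext M (F.obj N) s)
      (H : ∀ s : ℕ, Ext M (F.obj N) (s + 1) →+ Ext (D.loopOne M) N s)
      (P : ∀ s : ℕ, Ext (D.loopOne M) N s →+ Ext (D.loop M) N (s + 2)),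
      Function.Bijective (E 0) ∧ Function.Injective (E 1) ∧
      ∀ s : ℕ, Function.Exact (E (s + 1)) (H s) ∧ Function.Exact (H s) (P s) ∧
        Function.Exact (P s) (E (s + 2)) := by
  obtain ⟨S, rfl, hS, hP, hm₁, hm₂⟩ := D.exists_presentation M
  obtain ⟨w, hw, hmono, hepi, he₁, he₂⟩ := D.exists_loop_exact hS hm₂
  -- I is the image of ΩS.X₁ in ΩS.X₂; the four-term sequence is cut there.
  obtain ⟨I, q, p, hwq, hpc, hqp, hT₁, hT₂⟩ := exists_splice w (D.loopMap S.f) (D.loopMap S.g) hw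
    (D.loopMap_comp_zero _ _ S.zero) hmono hepi he₁ he₂
  have := D.projective_loop S.X₂
  choose θ hθ using fun s => D.exists_extEquiv N s S.X₁ hm₁
  obtain ⟨E, H, P, hE, h⟩ := exists_long_exact hS hT₁ hT₂ θ
    (fun s => by rw [hqp]; exact (hθ s S.X₂ hP S.f).1)
    (fun s => by rw [hqp]; exact (hθ s S.X₂ hP S.f).2) (D.extZeroEquiv S.X₃ N).toAddMonoidHom
  exact ⟨E, H, P, by rw [hE]; exact (D.extZeroEquiv S.X₃ N).bijective, h⟩

end SuspensionData

end LoopSequence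

/-! ### Exactness of modules over a ringoid -/

section Exactness

theorem functor_exact_iff {C : Type} [Category.{0} C] (S : ShortComplex (C ⥤ AddCommGrpCat.{u})) :
    S.Exact ↔ ∀ X, (S.map ((evaluation C AddCommGrpCat.{u}).obj X)).Exact := by
  simp only [ShortComplex.exact_iff_isZero_homology]
  rw [Functor.isZero_iff]
  exact forall_congr' fun X =>
    (S.mapHomologyIso ((evaluation C AddCommGrpCat.{u}).obj X)).symm.isZero_iff

variable {C : Type} [Category.{0} C] [Preadditive C]

instance : (AdditiveFunctor.forget C AddCommGrpCat.{u}).PreservesHomology where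
  preservesKernels _ _ f := (additiveFunctor C AddCommGrpCat.{u}).preservesKernels_ι f
  preservesCokernels _ _ f := (additiveFunctor C AddCommGrpCat.{u}).preservesCokernels_ι f

/-- Kernels and cokernels of additive functors are those of arbitrary functors, hence computed
objectwise. -/
theorem module_exact_iff (S : ShortComplex (C ⥤+ AddCommGrpCat.{u})) :
    S.Exact ↔ ∀ X, Function.Exact (S.f.hom.app X) (S.g.hom.app X) := by
  rw [← S.exact_map_iff_of_faithful (AdditiveFunctor.forget C AddCommGrpCat.{u}),
    functor_exact_iff]
  exact forall_congr' fun X => ShortComplex.ab_exact_iff_function_exact _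

theorem module_epi_iff {M N : C ⥤+ AddCommGrpCat.{u}} (f : M ⟶ N) :
    Epi f ↔ ∀ X, Function.Surjective (f.hom.app X) := by
  rw [← (ShortComplex.mk f (0 : N ⟶ N) comp_zero).exact_iff_epi rfl, module_exact_iff]
  exact forall_congr' fun X =>
    ⟨fun h y => (h y).1 rfl, fun h y => ⟨fun _ => h y, fun _ => rfl⟩⟩

theorem module_mono_iff {M N : C ⥤+ AddCommGrpCat.{u}} (f : M ⟶ N) :
    Mono f ↔ ∀ X, Function.Injective (f.hom.app X) := by
  rw [← (ShortComplex.mk (0 : M ⟶ M) f zero_comp).exact_iff_mono rfl, module_exact_iff]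
  refine forall_congr' fun X => ?_
  rw [injective_iff_map_eq_zero]
  exact ⟨fun h y hy => ((h y).1 hy).choose_spec.symm,
    fun h y => ⟨fun hy => ⟨0, (h y hy).symm⟩, fun ⟨_, hz⟩ => hz ▸ map_zero _⟩⟩

end Exactness

/-! ### Suspension -/

section Susp

/-- Restriction along a full functor that is surjective on objects is full. -/
theorem exists_natTrans_of_full {C D E : Type*} [Category* C] [Category* D] [Category* E]
    (F : C ⥤ D) [F.Full] (hF : ∀ Y, ∃ X, F.obj X = Y) {M N : D ⥤ E}
    (α : ∀ X, M.obj (F.obj X) ⟶ N.obj (F.obj X))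
    (hα : ∀ {X X' : C} (g : X ⟶ X'), M.map (F.map g) ≫ α X' = α X ≫ N.map (F.map g)) :
    ∃ φ : M ⟶ N, ∀ X, φ.app (F.obj X) = α X := by
  have key : ∀ {X X' : C} (g : F.obj X ⟶ F.obj X'), M.map g ≫ α X' = α X ≫ N.map g := by
    intro X X' g
    obtain ⟨g, rfl⟩ := F.map_surjective g
    exact hα g
  choose s hs using hF
  let φ : ∀ Y, M.obj Y ⟶ N.obj Y := fun Y =>
    M.map (eqToHom (hs Y).symm) ≫ α (s Y) ≫ N.map (eqToHom (hs Y))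
  have hφ : ∀ X, φ (F.obj X) = α X := by
    intro X
    change M.map (eqToHom _) ≫ α _ ≫ N.map (eqToHom _) = _
    rw [← key, ← Category.assoc, ← Functor.map_comp, eqToHom_trans, eqToHom_refl,
      CategoryTheory.Functor.map_id, Category.id_comp]
  refine ⟨{ app := φ, naturality := ?_ }, hφ⟩
  intro Y Y' g
  have h1 := hs Y
  have h2 := hs Y'
  generalize s Y = X at h1
  generalize s Y' = X' at h2
  subst h1 h2
  rw [hφ, hφ]
  exact key g

variable (k : ℕ)

instance : (susp.{u} k).Additive where
  map_add := rfl

instance : (susp.{u} k).Faithful where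
  map_injective {M N f g} h := by
    apply ObjectProperty.hom_ext
    apply NatTrans.ext
    funext Y
    obtain ⟨X, rfl⟩ := Qk.sigma_obj_surjective k Y
    exact congrArg (fun t => t.hom.app X) h

instance : (susp.{u} k).Full where
  map_surjective {M N} f := by
    obtain ⟨g, hg⟩ := exists_natTrans_of_full (Qk.sigma k) (Qk.sigma_obj_surjective k)
      (M := M.obj) (N := N.obj) (fun X => f.hom.app X) (fun g => f.hom.naturality g)
    refine ⟨⟨g⟩, ?_⟩
    apply ObjectProperty.hom_ext
    apply NatTrans.ext
    funext X
    exact hg X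

theorem susp_exact_iff (S : ShortComplex (U.{u} k)) : (S.map (susp k)).Exact ↔ S.Exact := by
  rw [module_exact_iff, module_exact_iff]
  refine ⟨fun h Y => ?_, fun h X => h _⟩
  obtain ⟨X, rfl⟩ := Qk.sigma_obj_surjective k Y
  exact h X

theorem susp_epi {M N : U.{u} k} (f : M ⟶ N) (hf : Epi f) : Epi ((susp k).map f) := by
  rw [module_epi_iff] at hf ⊢
  exact fun X => hf _

end Susp

/-! ### The Frobenius functor -/

section Frobenius

variable {S : Subringoid Q}

/-- The component at an object of `Q⁺` of a morphism of modules. -/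
noncomputable def Plus.extendApp {M N : S.Obj ⥤ AddCommGrpCat.{u}} (f : M ⟶ N) :
    ∀ X : Plus Q, Plus.extendObj M X ⟶ Plus.extendObj N X
  | ⟨some X⟩ => f.app ⟨X⟩
  | ⟨none⟩ => 0

/-- Extension of modules to `Q⁺` on morphisms. -/
noncomputable def Plus.extendHom {M N : S.Obj ⥤ AddCommGrpCat.{u}} [M.Additive] [N.Additive] (f : M ⟶ N) :
    Plus.extend M ⟶ Plus.extend N where
  app X := Plus.extendApp f X.as
  naturality := by
    rintro ⟨⟨_ | X⟩⟩ ⟨⟨_ | Y⟩⟩ g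
    · exact zero_comp.trans comp_zero.symm
    · exact zero_comp.trans zero_comp.symm
    · exact comp_zero.trans comp_zero.symm
    · exact f.naturality (X := ⟨X⟩) (Y := ⟨Y⟩) g

theorem Plus.extendApp_exact {M N P : S.Obj ⥤ AddCommGrpCat.{u}} (f : M ⟶ N) (g : N ⟶ P)
    (h : ∀ X, Function.Exact (f.app X) (g.app X)) (X : Plus Q) :
    Function.Exact (Plus.extendApp f X) (Plus.extendApp g X) := by
  obtain ⟨_ | X⟩ := X
  · exact fun y => ⟨fun _ => ⟨0, rfl⟩, fun _ => rfl⟩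
  · exact h _

theorem Plus.extendApp_surjective {M N : S.Obj ⥤ AddCommGrpCat.{u}} (f : M ⟶ N)
    (h : ∀ X, Function.Surjective (f.app X)) (X : Plus Q) :
    Function.Surjective (Plus.extendApp f X) := by
  obtain ⟨_ | X⟩ := X
  · exact fun y => ⟨0, rfl⟩
  · exact h _

theorem Plus.extendApp_injective {M N : S.Obj ⥤ AddCommGrpCat.{u}} (f : M ⟶ N)
    (h : ∀ X, Function.Injective (f.app X)) (X : Plus Q) :
    Function.Injective (Plus.extendApp f X) := by
  obtain ⟨_ | X⟩ := X
  · exact fun _ _ _ => rfl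
  · exact h _

variable (k : ℕ)

/-- The functor `uΦ : U_{k+1} ⥤ U_{k+1}`. -/
noncomputable def frobTop : U.{u} (k + 1) ⥤ U.{u} (k + 1) where
  obj M := (forgetTop (two_mul_ge k)).obj (frobenius M)
  map f := ⟨Functor.whiskerLeft (Qk.incl (two_mul_ge k) ⋙ Qk.frob (k + 1)) (Plus.extendHom f.hom)⟩
  map_id M := by
    apply ObjectProperty.hom_ext
    apply NatTrans.ext
    funext X
    have key : ∀ Y : Plus Q, Plus.extendApp (𝟙 M.obj) Y = 𝟙 _ := by
      rintro ⟨_ | Y⟩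
      · ext
        rfl
      · rfl
    exact key (Q.frob.obj X.as)
  map_comp f g := by
    apply ObjectProperty.hom_ext
    apply NatTrans.ext
    funext X
    have key : ∀ Y : Plus Q, Plus.extendApp (f.hom ≫ g.hom) Y =
        Plus.extendApp f.hom Y ≫ Plus.extendApp g.hom Y := by
      rintro ⟨_ | Y⟩
      · exact zero_comp.symm
      · rfl
    exact key (Q.frob.obj X.as)

instance : (frobTop.{u} k).Additive where
  map_add {M N f g} := by
    apply ObjectProperty.hom_ext
    apply NatTrans.ext
    funext X
    have key : ∀ Y : Plus Q, Plus.extendApp (f.hom + g.hom) Y =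
        Plus.extendApp f.hom Y + Plus.extendApp g.hom Y := by
      rintro ⟨_ | Y⟩
      · exact (add_zero _).symm
      · rfl
    exact key (Q.frob.obj X.as)

theorem frobTop_exact (T : ShortComplex (U.{u} (k + 1))) (hT : T.Exact) :
    (T.map (frobTop k)).Exact := by
  rw [module_exact_iff] at hT ⊢
  exact fun X => Plus.extendApp_exact T.f.hom T.g.hom hT (Q.frob.obj X.as)

theorem frobTop_epi {M N : U.{u} (k + 1)} (f : M ⟶ N) (hf : Epi f) : Epi ((frobTop k).map f) := by
  rw [module_epi_iff] at hf ⊢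
  exact fun X => Plus.extendApp_surjective f.hom hf (Q.frob.obj X.as)

theorem frobTop_mono {M N : U.{u} (k + 1)} (f : M ⟶ N) (hf : Mono f) :
    Mono ((frobTop k).map f) := by
  rw [module_mono_iff] at hf ⊢
  exact fun X => Plus.extendApp_injective f.hom hf (Q.frob.obj X.as)

/-- The natural transformation `λ`. -/
noncomputable def lamNat : frobTop.{u} k ⟶ 𝟭 (U.{u} (k + 1)) where
  app M := lam M
  naturality M N f := by
    apply ObjectProperty.hom_ext
    apply NatTrans.ext
    funext X
    have h : Plus.extendMap M.obj (Q.frob.obj X.as) (Plus.of X.as) _ ≫ f.hom.app X =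
        Plus.extendApp f.hom (Q.frob.obj X.as) ≫
          Plus.extendMap N.obj (Q.frob.obj X.as) (Plus.of X.as) _ :=
      (Plus.extendHom f.hom).naturality ((Qk.sqZero k).app X)
    exact h.symm

end Frobenius


/-! ### Desuspension -/

section Desuspension

/-! ### The counit of coextension along a full functor. -/

section Counit

variable {C : Type} [Category.{0} C] [Preadditive C] {D : Type} [Category.{0} D] [Preadditive D]
  (F : C ⥤ D) (M : C ⥤ AddCommGrpCat.{u})

/-- The counit of coextension of scalars. -/
def coindCounit : F ⋙ coind F M ⟶ M where
  app X := AddCommGrpCat.ofHom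
    { toFun := fun η : coindGroup F M (F.obj X) => η.1 X (𝟙 (F.obj X))
      map_zero' := rfl
      map_add' _ _ := rfl }
  naturality X X' f := AddCommGrpCat.hom_ext <| AddMonoidHom.ext fun (η : coindGroup F M _) =>
    (congrArg (η.1 X') ((Category.comp_id _).trans (Category.id_comp _).symm)).trans
      (η.2 f (𝟙 (F.obj X)))

/-- Fullness determines η from η(1), because η(F f) = M(f) η(1). Conversely, x defines F f ↦ M(f) x,
independent of the lift f because M kills the kernel of F. -/
theorem coindCounit_bijective [F.Full] [F.Additive] [M.Additive]
    (h : ∀ ⦃X X' : C⦄ (f : X ⟶ X'), F.map f = 0 → M.map f = 0) (X : C) :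
    Function.Bijective ((coindCounit F M).app X) := by
  have h' : ∀ {X X' : C} (f g : X ⟶ X') (x : M.obj X), F.map f = F.map g →
      M.map f x = M.map g x := by
    intro X X' f g x hfg
    have := h (f - g) (by rw [F.map_sub, hfg, sub_self])
    rw [M.map_sub, sub_eq_zero] at this
    rw [this]
  constructor
  · intro (η : coindGroup F M _) (θ : coindGroup F M _) (e : η.1 X (𝟙 _) = θ.1 X (𝟙 _))
    refine Subtype.ext (funext fun X' => AddMonoidHom.ext fun g => ?_)
    obtain ⟨f, rfl⟩ := F.map_surjective g
    have h1 := η.2 f (𝟙 (F.obj X))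
    have h2 := θ.2 f (𝟙 (F.obj X))
    rw [Category.id_comp] at h1 h2
    rw [h1, h2, e]
  · intro x
    let η : coindGroup F M (F.obj X) :=
      ⟨fun X' =>
        { toFun g := M.map (F.preimage g) x
          map_zero' := (h' _ 0 x (by rw [F.map_preimage, F.map_zero])).trans (by
            rw [M.map_zero]
            rfl)
          map_add' g g' := (h' _ (F.preimage g + F.preimage g') x (by
            rw [F.map_add, F.map_preimage, F.map_preimage, F.map_preimage])).trans (by
              rw [M.map_add]
              rfl) },
        fun X' X'' f g => (h' _ (F.preimage g ≫ f) x (by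
          rw [F.map_comp, F.map_preimage, F.map_preimage])).trans (by
            rw [M.map_comp]
            rfl)⟩
    refine ⟨η, ?_⟩
    change M.map (F.preimage (𝟙 (F.obj X))) x = x
    rw [h' _ (𝟙 X) x (by rw [F.map_preimage, F.map_id]), M.map_id]
    rfl

end Counit

variable {k : ℕ}

/-- σ lowers the source to m - 1 and keeps the exponent n - m = m, which makes the square unstable.
-/
theorem sigma_map_sqZero {m n : ℤ} (hn : n = 2 * m)
    (t : (Qk.deg (k + 1) m : Qk (k + 1)) ⟶ Qk.deg (k + 1) n) (ht : t.1 = Q.sq m n) :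
    (Qk.sigma k).map t = 0 := by
  refine Subtype.ext ?_
  change Q.sigma.map t.1 = 0
  rw [ht]
  exact (Q.sigma_sq m n).trans (Q.sq_unstable (by omega))

/-- A morphism of `Q_{k+1}` killed by `σ_k` acts as zero on the modules on which `Sq_0` is zero. -/
theorem map_eq_zero_of_sqZero (M : U.{u} (k + 1))
    (hM : ∀ (m n : ℤ) (t : (Qk.deg (k + 1) m : Qk (k + 1)) ⟶ Qk.deg (k + 1) n), n = 2 * m →
      t.1 = Q.sq m n → M.obj.map t = 0)
    ⦃X Y : Qk (k + 1)⦄ (f : X ⟶ Y) (hf : (Qk.sigma k).map f = 0) : M.obj.map f = 0 := by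
  rcases topSub_eq_comp_sqZero (k := k) (a := Q.val X.as) (m := Q.val Y.as) f.2
    (congrArg Subtype.val hf) with h | ⟨h, g, hm, hg, hfg⟩
  · obtain rfl : f = 0 := Subtype.ext h
    exact M.obj.map_zero _ _
  -- For h ≥ 0 the square Sq_0 belongs to Q_{k+1}, since its lower index 0 is below k + 1. For h < 0
  -- it would lower the degree and is zero by convention.
  · rcases le_or_gt 0 h with h0 | h0
    · have hs : Q.sq h (Q.val Y.as) ∈ (topSub (k + 1)).hom (Q.deg h) (Q.deg (Q.val Y.as)) :=
        Subringoid.mem_generated _ (TopSq.mk h _ (by omega) (by push_cast; omega))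
      have hc : f = (⟨g, hg⟩ : X ⟶ Qk.deg (k + 1) h) ≫
          (⟨Q.sq h (Q.val Y.as), hs⟩ : (Qk.deg (k + 1) h : Qk (k + 1)) ⟶ Y) := Subtype.ext hfg
      rw [hc]
      refine (M.obj.map_comp _ _).trans ?_
      exact (congrArg (M.obj.map _ ≫ ·) (hM h (Q.val Y.as) ⟨_, hs⟩ hm rfl)).trans comp_zero
    · have : f = 0 := Subtype.ext (hfg.trans (by
        rw [Q.sq_of_gt (by omega)]
        exact comp_zero))
      rw [this]
      exact M.obj.map_zero _ _

/-- The counit `ΣΩC ⟶ C` of the desuspension. -/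
noncomputable def desuspCounit (M : U.{u} (k + 1)) : (susp k).obj (desusp M) ⟶ M :=
  ⟨coindCounit (Qk.sigma k) M.obj⟩

/-- If `Sq_0` acts as zero on `M`, then `M` is the suspension of its desuspension. -/
noncomputable def desuspIso (M : U.{u} (k + 1))
    (hM : ∀ (m n : ℤ) (t : (Qk.deg (k + 1) m : Qk (k + 1)) ⟶ Qk.deg (k + 1) n), n = 2 * m →
      t.1 = Q.sq m n → M.obj.map t = 0) : (susp k).obj (desusp M) ≅ M := by
  have h := coindCounit_bijective (Qk.sigma k) M.obj (map_eq_zero_of_sqZero M hM)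
  have : Mono (desuspCounit M) := (module_mono_iff _).2 fun X => (h X).1
  have : Epi (desuspCounit M) := (module_epi_iff _).2 fun X => (h X).2
  have := isIso_of_mono_of_epi (desuspCounit M)
  exact asIso (desuspCounit M)

theorem Q.half_eq_some {n : ℤ} {X : Q} (h : Q.half n = ⟨some X⟩) :
    ∃ m, n = 2 * m ∧ X = Q.deg m := by
  obtain ⟨m, rfl | rfl⟩ := Int.even_or_odd' n
  · rw [Q.half_two] at h
    exact ⟨m, rfl, (Option.some.inj (congrArg Plus.as h)).symm⟩
  · rw [Q.half_odd] at h
    exact absurd (congrArg Plus.as h) (by simp)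

theorem Q.half_eq_none {n : ℤ} (h : Q.half n = ⟨none⟩) : Odd n := by
  obtain ⟨m, rfl | rfl⟩ := Int.even_or_odd' n
  · rw [Q.half_two] at h
    exact absurd (congrArg Plus.as h) (by simp)
  · exact odd_two_mul_add_one m

/-- The components of `λ_M` are given by `Sq_0` in even degrees and are zero in odd degrees. -/
theorem lam_app_cases (M : U.{u} (k + 1)) (n : ℤ)
    (P : ∀ G : AddCommGrpCat.{u}, (G ⟶ M.obj.obj (Qk.deg (k + 1) n)) → Prop)
    (hodd : Odd n → P (AddCommGrpCat.of PUnit) 0)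
    (heven : ∀ (m : ℤ) (t : (Qk.deg (k + 1) m : Qk (k + 1)) ⟶ Qk.deg (k + 1) n), n = 2 * m →
      t.1 = Q.sq m n → P _ (M.obj.map t)) :
    P _ ((lam M).hom.app (Qk.deg (k + 1) n)) := by
  -- The source of λ in degree n is the extended module at `Q.half n`, known only up to a
  -- propositional equality. Replacing `Q.half n` by an arbitrary Y avoids transport, which is also
  -- why P ranges over all source groups.
  have key : ∀ (Y : Plus Q) (h : (Q.psq Y (Plus.of (Q.deg n))) ∈
      (Plus.sub (topSub (k + 1))).hom Y (Plus.of (Q.deg n))), Q.half n = Y →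
      P (Plus.extendObj M.obj Y) (Plus.extendMap M.obj Y (Plus.of (Q.deg n)) ⟨_, h⟩) := by
    rintro ⟨_ | X⟩ h hY
    · exact hodd (Q.half_eq_none hY)
    · obtain ⟨m, hm, rfl⟩ := Q.half_eq_some hY
      exact heven m ⟨_, h⟩ hm rfl
  exact key (Q.half n) (Q.sqZero_mem k (Q.deg n)) rfl

theorem lam_susp (N : U.{u} k) : lam ((susp k).obj N) = 0 := by
  apply ObjectProperty.hom_ext
  apply NatTrans.ext
  funext X
  refine lam_app_cases ((susp k).obj N) (Q.val X.as) (fun _ f => f = 0) (fun _ => rfl) ?_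
  intro m t hm ht
  change N.obj.map ((Qk.sigma k).map t) = 0
  rw [sigma_map_sqZero hm t ht]
  exact N.obj.map_zero _ _

/-- `Sq_0` acts as zero on the cokernel of `λ_M`. -/
theorem cokernel_map_eq_zero (M : U.{u} (k + 1)) (m n : ℤ)
    (t : (Qk.deg (k + 1) m : Qk (k + 1)) ⟶ Qk.deg (k + 1) n) (hn : n = 2 * m)
    (ht : t.1 = Q.sq m n) : (cokernel (lam M)).obj.map t = 0 := by
  have hs := (module_epi_iff (cokernel.π (lam M))).1 inferInstance
  refine AddCommGrpCat.hom_ext (AddMonoidHom.ext fun y => ?_)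
  obtain ⟨x, rfl⟩ := hs _ y
  have h1 : ∃ z, (lam M).hom.app (Qk.deg (k + 1) n) z = M.obj.map t x := by
    refine lam_app_cases M n (fun _ f => ∃ z, f z = M.obj.map t x) ?_ ?_
    · intro ho
      exact absurd ho (by simp [hn])
    · intro m' t' hm' ht'
      obtain rfl : m = m' := by omega
      exact ⟨x, congrArg (fun r => M.obj.map r x) (Subtype.ext (ht'.trans ht.symm))⟩
  obtain ⟨z, hz⟩ := h1
  have h2 : (cokernel.π (lam M)).hom.app (Qk.deg (k + 1) n) (M.obj.map t x) =
      (cokernel (lam M)).obj.map t ((cokernel.π (lam M)).hom.app _ x) :=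
    congrArg (fun f => f x) (congrArg (fun r => r.hom)
      ((cokernel.π (lam M)).hom.naturality t))
  refine h2.symm.trans ?_
  rw [← hz]
  exact congrArg (fun f => (f.hom.app (Qk.deg (k + 1) n)).hom z) (cokernel.condition (lam M))

/-- Sq_0 : m ⟶ 2m acts on ΦM through φ(Sq_0), which is the very morphism φ(m) ⟶ m defining λ_M in
degree m once (ΦM)^{2m} is read as M^m. Hence it kills the kernel of λ_M. -/
theorem frobTop_map_eq_zero (M : U.{u} (k + 1)) (m n : ℤ)
    (t : (Qk.deg (k + 1) m : Qk (k + 1)) ⟶ Qk.deg (k + 1) n) (hn : n = 2 * m)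
    (ht : t.1 = Q.sq m n) (y : ((frobTop k).obj M).obj.obj (Qk.deg (k + 1) m))
    (hy : (lam M).hom.app (Qk.deg (k + 1) m) y = 0) : ((frobTop k).obj M).obj.map t y = 0 := by
  have key : ∀ (Z : Plus Q), Z = Plus.of (Q.deg m) → ∀ (p : Q.half m ⟶ Z)
      (hp : p ∈ (Plus.sub (topSub (k + 1))).hom (Q.half m) Z), p = Q.psq (Q.half m) Z →
      Plus.extendMap M.obj (Q.half m) Z ⟨p, hp⟩ y = 0 := by
    rintro _ rfl _ hp rfl
    exact hy
  refine key (Q.half n) (by rw [hn, Q.half_two]) (Q.frob.map t.1) _ ?_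
  rw [ht]
  exact Q.frob_sq m n

/-- `Sq_0` acts as zero on the kernel of `λ_M`. -/
theorem kernel_map_eq_zero (M : U.{u} (k + 1)) (m n : ℤ)
    (t : (Qk.deg (k + 1) m : Qk (k + 1)) ⟶ Qk.deg (k + 1) n) (hn : n = 2 * m)
    (ht : t.1 = Q.sq m n) : (kernel (lam M)).obj.map t = 0 := by
  have hi := (module_mono_iff (kernel.ι (lam M))).1 inferInstance
  refine AddCommGrpCat.hom_ext (AddMonoidHom.ext fun y => hi _ ?_)
  have h2 : (kernel.ι (lam M)).hom.app (Qk.deg (k + 1) n) ((kernel (lam M)).obj.map t y) =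
      ((frobTop k).obj M).obj.map t ((kernel.ι (lam M)).hom.app _ y) :=
    congrArg (fun f => f y) (congrArg (fun r => r.hom)
      ((kernel.ι (lam M)).hom.naturality t))
  refine (h2.trans (frobTop_map_eq_zero M m n t hn ht _ ?_)).trans (map_zero _).symm
  exact congrArg (fun f => (f.hom.app (Qk.deg (k + 1) m)).hom y) (kernel.condition (lam M))

/-- The isomorphism `ΣΩM ≅ coker λ_M`. -/
noncomputable def suspLoopIso (M : U.{u} (k + 1)) :
    (susp k).obj (loop M) ≅ cokernel (lam M) :=
  desuspIso (cokernel (lam M)) (cokernel_map_eq_zero M)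

/-- The isomorphism `ΣΩ₁M ≅ ker λ_M`. -/
noncomputable def suspLoopOneIso (M : U.{u} (k + 1)) :
    (susp k).obj (loopOne M) ≅ kernel (lam M) :=
  desuspIso (kernel (lam M)) (kernel_map_eq_zero M)

end Desuspension

/-! ### Free modules -/

section Free

open DirectSum

variable {C : Type} [Category.{0} C] [Preadditive C] {I : Type u} (x : I → C)

theorem directSum_rightComp_of [DecidableEq I] {Y Y' : C} (f : Y ⟶ Y') (i : I) (g : x i ⟶ Y) :
    DirectSum.map (fun i => Preadditive.rightComp (x i) f) (DirectSum.of (fun i => (x i ⟶ Y)) i g) =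
      DirectSum.of (fun i => (x i ⟶ Y')) i (g ≫ f) :=
  DirectSum.map_of (fun i => Preadditive.rightComp (x i) f) i g

/-- The free module with a generator in `x i` for every `i`. -/
noncomputable def freeFunctor : C ⥤ AddCommGrpCat.{u} where
  obj Y := AddCommGrpCat.of (⨁ i, (x i ⟶ Y))
  map f := AddCommGrpCat.ofHom (DirectSum.map fun i => Preadditive.rightComp (x i) f)
  map_id Y := by
    classical
    refine AddCommGrpCat.hom_ext (DirectSum.addHom_ext fun i g => ?_)
    refine (directSum_rightComp_of x (𝟙 Y) i g).trans ?_
    rw [Category.comp_id]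
    rfl
  map_comp {Y Y' Y''} f f' := by
    classical
    refine AddCommGrpCat.hom_ext (DirectSum.addHom_ext fun i g => ?_)
    refine (directSum_rightComp_of x (f ≫ f') i g).trans ?_
    refine Eq.trans ?_ (congrArg (DirectSum.map fun i => Preadditive.rightComp (x i) f')
      (directSum_rightComp_of x f i g)).symm
    rw [directSum_rightComp_of, Category.assoc]

instance : (freeFunctor x).Additive where
  map_add {Y Y' f f'} := by
    classical
    refine AddCommGrpCat.hom_ext (DirectSum.addHom_ext fun i g => ?_)
    refine (directSum_rightComp_of x (f + f') i g).trans ?_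
    refine Eq.trans ?_ (congrArg₂ (· + ·) (directSum_rightComp_of x f i g)
      (directSum_rightComp_of x f' i g)).symm
    rw [Preadditive.comp_add, map_add]

/-- The free module with a generator in `x i` for every `i`. -/
noncomputable def freeModule : C ⥤+ AddCommGrpCat.{u} := AdditiveFunctor.of (freeFunctor x)

/-- The element `g` of the summand with index `i`. -/
noncomputable def freeModule.of [DecidableEq I] (i : I) {Y : C} (g : x i ⟶ Y) :
    (freeModule x).obj.obj Y :=
  DirectSum.of (fun i => (x i ⟶ Y)) i g

theorem freeModule.map_of [DecidableEq I] (i : I) {Y Y' : C} (g : x i ⟶ Y) (f : Y ⟶ Y') :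
    (freeModule x).obj.map f (freeModule.of x i g) = freeModule.of x i (g ≫ f) :=
  directSum_rightComp_of x f i g

theorem freeModule.hom_ext [DecidableEq I] {M : C ⥤+ AddCommGrpCat.{u}} {f g : freeModule x ⟶ M}
    (h : ∀ i, f.hom.app (x i) (freeModule.of x i (𝟙 (x i))) =
      g.hom.app (x i) (freeModule.of x i (𝟙 (x i)))) : f = g := by
  apply ObjectProperty.hom_ext
  apply NatTrans.ext
  funext Y
  refine AddCommGrpCat.hom_ext (DirectSum.addHom_ext fun i r => ?_)
  have hr : freeModule.of x i r = (freeModule x).obj.map r (freeModule.of x i (𝟙 (x i))) := by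
    rw [freeModule.map_of, Category.id_comp]
  change f.hom.app Y (freeModule.of x i r) = g.hom.app Y (freeModule.of x i r)
  rw [hr]
  have key : ∀ e : freeModule x ⟶ M, e.hom.app Y ((freeModule x).obj.map r
      (freeModule.of x i (𝟙 (x i)))) = M.obj.map r (e.hom.app _ (freeModule.of x i (𝟙 (x i)))) :=
    fun e => congrArg (fun t => t.hom (freeModule.of x i (𝟙 (x i)))) (e.hom.naturality r)
  rw [key f, key g]
  exact congrArg (M.obj.map r) (h i)

/-- The components of the morphism from a free module given by a family of elements. -/
noncomputable def freeModule.descApp [DecidableEq I] {M : C ⥤+ AddCommGrpCat.{u}}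
    (m : ∀ i, M.obj.obj (x i)) (Y : C) : (⨁ i, (x i ⟶ Y)) →+ M.obj.obj Y :=
  DirectSum.toAddMonoid fun i =>
    { toFun g := M.obj.map g (m i)
      map_zero' := by
        rw [Functor.map_zero]
        rfl
      map_add' g g' := by
        rw [Functor.map_add]
        rfl }

theorem freeModule.descApp_of [DecidableEq I] {M : C ⥤+ AddCommGrpCat.{u}}
    (m : ∀ i, M.obj.obj (x i)) {Y : C} (i : I) (g : x i ⟶ Y) :
    freeModule.descApp x m Y (DirectSum.of (fun i => (x i ⟶ Y)) i g) = M.obj.map g (m i) :=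
  DirectSum.toAddMonoid_of (β := fun i => (x i ⟶ Y)) _ i g

/-- The morphism from a free module given by a family of elements. -/
noncomputable def freeModule.desc [DecidableEq I] {M : C ⥤+ AddCommGrpCat.{u}}
    (m : ∀ i, M.obj.obj (x i)) : freeModule x ⟶ M :=
  ⟨{ app Y := AddCommGrpCat.ofHom (freeModule.descApp x m Y)
     naturality Y Y' f := by
       refine AddCommGrpCat.hom_ext (DirectSum.addHom_ext fun i g => ?_)
       refine (congrArg (freeModule.descApp x m Y') (directSum_rightComp_of x f i g)).trans ?_
       refine (freeModule.descApp_of x m i _).trans ?_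
       refine Eq.trans ?_ (congrArg (M.obj.map f) (freeModule.descApp_of x m i g)).symm
       rw [Functor.map_comp]
       rfl }⟩

theorem freeModule.desc_of [DecidableEq I] {M : C ⥤+ AddCommGrpCat.{u}}
    (m : ∀ i, M.obj.obj (x i)) (i : I) :
    (freeModule.desc x m).hom.app (x i) (freeModule.of x i (𝟙 (x i))) = m i := by
  refine (freeModule.descApp_of x m i _).trans ?_
  rw [CategoryTheory.Functor.map_id]
  rfl

instance : Projective (freeModule x) where
  factors {M N} f e he := by
    classical
    rw [module_epi_iff] at he
    choose m hm using fun i => he (x i) (f.hom.app (x i) (freeModule.of x i (𝟙 (x i))))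
    refine ⟨freeModule.desc x m, freeModule.hom_ext x fun i => ?_⟩
    exact (congrArg (e.hom.app (x i)) (freeModule.desc_of x m i)).trans (hm i)

theorem freeModule.map_injective {Y Y' : C} (f : Y ⟶ Y')
    (hf : ∀ (i : I) (g : x i ⟶ Y), g ≫ f = 0 → g = 0) :
    Function.Injective ((freeModule x).obj.map f) :=
  (DirectSum.map_injective fun i => Preadditive.rightComp (x i) f).2 fun i =>
    (injective_iff_map_eq_zero _).2 (hf i)

theorem exists_free_epi (M : C ⥤+ AddCommGrpCat.{u}) :
    ∃ (I : Type u) (x : I → C) (f : freeModule x ⟶ M), Epi f := by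
  classical
  refine ⟨Σ X : C, M.obj.obj X, Sigma.fst, freeModule.desc _ Sigma.snd, ?_⟩
  rw [module_epi_iff]
  exact fun X y => ⟨_, freeModule.desc_of (M := M) (Sigma.fst : (Σ X : C, M.obj.obj X) → C)
    Sigma.snd ⟨X, y⟩⟩

end Free

/-- In even degrees λ is, on each summand, right composition with Sq_0; in odd degrees its source is
zero. As Q_{k+1} is a subringoid of Q, injectivity in Q suffices, and no separate argument for each
k is required. -/
theorem lam_free_mono {k : ℕ} {I : Type u} (x : I → Qk (k + 1)) : Mono (lam (freeModule x)) := by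
  rw [module_mono_iff]
  intro X
  refine lam_app_cases (freeModule x) (Q.val X.as) (fun _ f => Function.Injective f)
    (fun _ _ _ _ => rfl) ?_
  intro m t hm ht
  refine freeModule.map_injective x t fun i g hg => Subtype.ext ?_
  have h : g.1 ≫ t.1 = 0 := congrArg Subtype.val hg
  rw [ht, hm] at h
  exact Q.sqZero_injective (n := Q.val (x i).as) g.1 h

/-! ### The long exact sequence -/

/-- The suspension functor `U_k ⥤ U_{k+1}` together with `λ`. -/
noncomputable def suspensionData (k : ℕ) : SuspensionData (susp.{u} k) where
  exact_of_map S := (susp_exact_iff k S).1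
  epi_map := susp_epi k
  Φ := frobTop k
  exact_Φ := frobTop_exact k
  epi_Φ := frobTop_epi k
  mono_Φ := frobTop_mono k
  lam := lamNat k
  lam_susp := lam_susp
  loop := loop
  loopOne := loopOne
  loopIso := suspLoopIso
  loopOneIso := suspLoopOneIso
  resolve M := by
    obtain ⟨I, x, f, hf⟩ := exists_free_epi M
    exact ⟨freeModule x, f, inferInstance, lam_free_mono x, hf⟩

end TopSquares

/-- Here k + 1 plays the role of the positive index. Since Ext vanishes in negative degrees, the
beginning of the long exact sequence amounts to bijectivity of `E 0` and injectivity of `E 1`. -/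
theorem mainTheorem5 (k : ℕ) (M : TopSquares.U.{u} (k + 1)) (N : TopSquares.U.{u} k) :
    Nonempty ((TopSquares.susp k).obj (TopSquares.loop M) ≅ cokernel (TopSquares.lam M)) ∧
    Nonempty ((TopSquares.susp k).obj (TopSquares.loopOne M) ≅ kernel (TopSquares.lam M)) ∧
    ∃ (E : ∀ s : ℕ, Abelian.Ext (TopSquares.loop M) N s →ₗ[ZMod 2]
          Abelian.Ext M ((TopSquares.susp k).obj N) s)
      (H : ∀ s : ℕ, Abelian.Ext M ((TopSquares.susp k).obj N) (s + 1) →ₗ[ZMod 2]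
          Abelian.Ext (TopSquares.loopOne M) N s)
      (P : ∀ s : ℕ, Abelian.Ext (TopSquares.loopOne M) N s →ₗ[ZMod 2]
          Abelian.Ext (TopSquares.loop M) N (s + 2)),
      Function.Bijective (E 0) ∧ Function.Injective (E 1) ∧
      ∀ s : ℕ, Function.Exact (E (s + 1)) (H s) ∧ Function.Exact (H s) (P s) ∧
        Function.Exact (P s) (E (s + 2)) := by
  obtain ⟨E, H, P, h₀, h₁, h⟩ := (TopSquares.suspensionData k).exists_ext_sequence M N
  exact ⟨⟨TopSquares.suspLoopIso M⟩, ⟨TopSquares.suspLoopOneIso M⟩,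
    fun s => (E s).toZModLinearMap 2, fun s => (H s).toZModLinearMap 2,
    fun s => (P s).toZModLinearMap 2, h₀, h₁, h⟩
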